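/- Let $\mathcal G$ be an undirected weighted graph with a finite set $\mathcal V$ of $N$ vertices and real symmetric weight matrix $W$, let $L=D-W$ be its Laplacian (where $D$ is the diagonal matrix of the degrees $d_i=\sum_j w_{ij}$), and let $L=U\Lambda U^{H}$ with $U$ unitary and $\Lambda$ diagonal. For $X\in L^2(\mathcal V\times\mathbb R)$ let $\mathcal F_J(X)(i,f)=\sum_{v}\overline{U(v,i)}\,\widehat{X(v,\cdot)}(f)$, $i=1,\dots,N$, be its joint Fourier transform, where $\hat x(f)=\int_{\mathbb R} x(t)e^{-2\pi \mathrm{i} ft}\,dt$ (in the $L^2$ sense). Let $F_1,\dots,F_N\subseteq\mathbb R$ be finite unions of intervals with finite joint bandwidth $B=\sum_i\mu(F_i)<\infty$ ($\mu$ is Lebesgue measure), let $B_{\mathcal G}=|\{i: F_i\neq\emptyset\}|$, and let $\mathcal{BL}$ be the space of all $X\in L^2(\mathcal V\times\mathbb R)$ with $\mathcal F_J(X)(i,f)=0$ for every $i$ and almost every $f\notin F_i$, each $X$ being represented by its continuous representative. Then there is a set $S\subseteq\mathcal V\times\mathbb R$, depending on $U$ and the $F_i$ but not on the individual signal $X$,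 with finitely many points in each $\mathcal V\times[-t,t]$, such that: (i) $S$ is a stable sampling set for $\mathcal{BL}$: there are constants $0<A$ and $C<\infty$ with $$A\,\|X\|^2\le\sum_{(v,t)\in S}|X(v,t)|^2\le C\,\|X\|^2\qquad\text{for all }X\in\mathcal{BL},$$ where $\|X\|^2=\sum_v\int_{\mathbb R}|X(v,t)|^2\,dt$; (ii) its total sampling density is exactly $B/N$: $$\liminf_{t\to\infty}\frac{|S\cap(\mathcal V\times[-t,t])|}{2tN}=\frac BN ;$$ (iii) at most $B_{\mathcal G}$ vertices are sampled: $|\{v:(v,t)\in S\text{ for some }t\}|\le B_{\mathcal G}$. That is, critical sampling is achievable using at most $B_{\mathcal G}$ vertices. -/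

import Mathlib

open MeasureTheory Filter
open scoped ENNReal NNReal FourierTransform

namespace CTVGS

/-- The Laplacian `D - W` of the weighted graph with weight matrix `W`, where `D` is the diagonal
matrix of the degrees `d_i = ∑ j, W i j`. -/
def laplacian {V : Type*} [Fintype V] [DecidableEq V] (W : Matrix V V ℝ) : Matrix V V ℝ :=
  Matrix.diagonal (fun v => ∑ w, W v w) - W

/-- `U` is an eigenmatrix of the graph Laplacian: `U` is unitary and `L = U Λ Uᴴ` for a (real)
diagonal matrix `Λ`. The columns of `U` are the graph Fourier basis vectors. -/
def IsGraphFourierBasis {V : Type*} [Fintype V] [DecidableEq V]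
    (W : Matrix V V ℝ) (U : Matrix V V ℂ) : Prop :=
  U ∈ Matrix.unitaryGroup V ℂ ∧
    ∃ eig : V → ℝ, (laplacian W).map (fun x : ℝ => (x : ℂ)) =
      U * Matrix.diagonal (fun i => (eig i : ℂ)) * U.conjTranspose

/-- The joint time-vertex Fourier transform of a signal in `L²(V × ℝ)`: the (Plancherel) Fourier
transform in time, with kernel `exp (-2πift)` (frequencies in Hz), on each vertex, followed by the
graph Fourier transform `Uᴴ`. -/
noncomputable def jft {V : Type*} [Fintype V] (U : Matrix V V ℂ)
    (Y : V → Lp ℂ 2 (volume : Measure ℝ)) (i : V) : Lp ℂ 2 (volume : Measure ℝ) :=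
  ∑ v, star (U v i) • 𝓕 (Y v)

/-- A finite union of intervals (open, closed, half-open, degenerate, or unbounded). -/
def IsFiniteUnionOfIntervals (s : Set ℝ) : Prop :=
  ∃ T : Set (Set ℝ), T.Finite ∧ (∀ J ∈ T, J.OrdConnected) ∧ s = ⋃₀ T

/-- The joint bandwidth `B = ∑ i, μ(F i)`. -/
noncomputable def jointBandwidth {V : Type*} [Fintype V] (F : V → Set ℝ) : ℝ≥0∞ :=
  ∑ i, volume (F i)

/-- The projection bandwidth `B_G` in the vertex domain: the cardinality of the union over all
frequencies `f` of the index sets `I_f = {i | f ∈ F i}`. -/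
noncomputable def vertexBandwidth {V : Type*} (F : V → Set ℝ) : ℕ :=
  (⋃ f : ℝ, {i : V | f ∈ F i}).ncard

/-- The space of signals whose `i`-th joint spectral function vanishes off `F i`. When the joint
bandwidth is finite, every `L²` class with this property has exactly one continuous representative;
it is the one that is sampled, so the elements are taken to be continuous functions. -/
def BL {V : Type*} [Fintype V] (U : Matrix V V ℂ) (F : V → Set ℝ) : Set (V → ℝ → ℂ) :=
  {X | (∀ v, Continuous (X v)) ∧
    ∃ hX : ∀ v, MemLp (X v) 2 (volume : Measure ℝ),
      ∀ i, ∀ᵐ f ∂(volume : Measure ℝ), f ∉ F i → jft U (fun v => (hX v).toLp (X v)) i f = 0}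

/-- `‖X‖² = ∑ v, ∫ |X(v,t)|² dt`. -/
noncomputable def normSq {V : Type*} [Fintype V] (X : V → ℝ → ℂ) : ℝ≥0∞ :=
  ∑ v, ∫⁻ t : ℝ, ‖X v t‖ₑ ^ 2

/-- The energy of the samples, `∑_{(v,t) ∈ S} |X(v,t)|²`. -/
noncomputable def sampleEnergy {V : Type*} (S : Set (V × ℝ)) (X : V → ℝ → ℂ) : ℝ≥0∞ :=
  ∑' p : S, ‖X p.1.1 p.1.2‖ₑ ^ 2

/-- A set of vertex-time points is a sampling set if the set of sampling times on each vertex is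
discrete, that is, has finitely many points in every bounded interval. -/
def IsSamplingSet {V : Type*} (S : Set (V × ℝ)) : Prop :=
  ∀ (v : V) (r : ℝ), {t : ℝ | (v, t) ∈ S ∧ t ∈ Set.Icc (-r) r}.Finite

/-- Stable sampling: `A ‖X‖² ≤ ∑_{(v,t) ∈ S} |X(v,t)|² ≤ C ‖X‖²` for all `X` in the class `Γ`,
with constants `0 < A` and `C < ∞` that do not depend on `X`. -/
def IsStableSamplingSet {V : Type*} [Fintype V] (Γ : Set (V → ℝ → ℂ)) (S : Set (V × ℝ)) : Prop :=
  IsSamplingSet S ∧ ∃ A C : ℝ≥0, 0 < A ∧ ∀ X ∈ Γ,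
    (A : ℝ≥0∞) * normSq X ≤ sampleEnergy S X ∧ sampleEnergy S X ≤ (C : ℝ≥0∞) * normSq X

/-- The total sampling density `liminf_{t → ∞} |S ∩ (V × [-t,t])| / (2 t N)`, with `N = |V|`. -/
noncomputable def density {V : Type*} [Fintype V] (S : Set (V × ℝ)) : ℝ≥0∞ :=
  liminf (fun t : ℝ => ((S ∩ Set.univ ×ˢ Set.Icc (-t) t).encard : ℝ≥0∞) /
    ENNReal.ofReal (2 * t * Fintype.card V)) atTop

/-- A critical sampling set: a stable sampling set for the band-limited class whose total sampling
density is `B / N`. -/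
def IsCriticalSamplingSet {V : Type*} [Fintype V] (U : Matrix V V ℂ) (F : V → Set ℝ)
    (S : Set (V × ℝ)) : Prop :=
  IsStableSamplingSet (BL U F) S ∧ density S = jointBandwidth F / (Fintype.card V : ℝ≥0∞)

/-- The projection of a sampling set to the vertex domain. -/
def vertexProjection {V : Type*} (S : Set (V × ℝ)) : Set V :=
  {v | ∃ t : ℝ, (v, t) ∈ S}

end CTVGS

/-! Once the spectra are cut into unit cells, sampling becomes linear algebra at each point of the
unit interval. Up to null sets each `F i` is a finite union of bounded half-open intervals, and all
of them lie in one window `[a, a + N)` with integer ends. Let z_i be the i-th joint spectrum. The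
samples of X at the vertex v and the times n + s/N are the Fourier coefficients on `[0, 1)` of a
unimodular factor times the row (v, s) of R ⊗ DFT, applied to the vector of all translates z_i(u + a
+ k). Here R keeps the columns of `U` with `F i` nonempty, and only so many rows as are needed for
injectivity, hence at most B_G vertices.

At a given u only the coordinates in a finite set C(u) can be nonzero. Exactly |C(u)| rows, chosen
greedily, determine all the others there. So row r has to be sampled only as a function on the set
of those u where it is chosen; elsewhere it is a combination of earlier rows
(`exists_elimination_bound`). Since |C(u)| rows are chosen at every u, the measures of these sets
add up to B. There remains a scalar problem: for a finite union A of intervals in `[0, 1)`, find a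
set of integers of density |A| that samples the square integrable functions supported in A.

The scalar problem is solved by induction on the number of jumps of the indicator function of A on
the circle (`criticalUpTo`). Folding N times replaces A by the level sets of the count u ↦ #{k : (u
+ k)/N ∈ A}. Sampling sets for the levels, placed in the residue classes modulo N, form one for A
(`HasCriticalSampling.of_fold`); this is the same elimination, and the Vandermonde structure of the
DFT makes the greedy choice the first |C| rows. It suffices to find an N for which every level has
fewer jumps. If two jumps collide after folding, this holds. Otherwise all jumps of the fold are ±1,
and one level can carry all of them only if the fold takes just two values. With at least four jumps
this fails for some N, by a mean square estimate of exponential sums (`exists_fold_many_values`).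
With two jumps, N can be chosen so that the levels are trivial or an arc of length β ≤ 1/10, and
there the integers nearest to n/β work, as a small perturbation of an orthogonal basis
(`short_interval_bound`). -/

namespace CTVGS

/-! ### Fourier integrals over the unit interval -/

/-- The character `x ↦ exp (2πix)`. -/
noncomputable def ex (x : ℝ) : ℂ := Complex.exp (2 * Real.pi * Complex.I * x)

lemma ex_add (x y : ℝ) : ex (x + y) = ex x * ex y := by
  simp only [ex, ← Complex.exp_add]; push_cast; ring_nf

lemma ex_zero : ex 0 = 1 := by simp [ex]

lemma norm_ex (x : ℝ) : ‖ex x‖ = 1 := by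
  have : ex x = Complex.exp (((2 * Real.pi * x : ℝ) : ℂ) * Complex.I) := by
    unfold ex; congr 1; push_cast; ring
  rw [this, Complex.norm_exp_ofReal_mul_I]

lemma enorm_ex (x : ℝ) : ‖ex x‖ₑ = 1 := by
  rw [← ofReal_norm, norm_ex]; simp

lemma ex_ne_zero (x : ℝ) : ex x ≠ 0 := Complex.exp_ne_zero _

lemma ex_intCast (n : ℤ) : ex n = 1 := by
  unfold ex
  rw [Complex.exp_eq_one_iff]
  exact ⟨n, by push_cast; ring⟩

lemma ex_eq_one_iff {x : ℝ} : ex x = 1 ↔ ∃ n : ℤ, x = n := by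
  constructor
  · intro h
    unfold ex at h
    rw [Complex.exp_eq_one_iff] at h
    obtain ⟨n, hn⟩ := h
    refine ⟨n, ?_⟩
    have h2 : (2 * Real.pi * Complex.I : ℂ) ≠ 0 := Complex.two_pi_I_ne_zero
    have : (x : ℂ) = n := by
      apply mul_left_cancel₀ h2
      rw [hn]; ring
    exact_mod_cast this
  · rintro ⟨n, rfl⟩
    exact ex_intCast n

lemma ex_neg (x : ℝ) : ex (-x) = star (ex x) := by
  have h : (starRingEnd ℂ) 2 = 2 := Complex.conj_ofNat 2
  simp only [ex, Complex.star_def, ← Complex.exp_conj]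
  simp [h]

lemma ex_pow (x : ℝ) (n : ℕ) : ex x ^ n = ex (n * x) := by
  simp only [ex, ← Complex.exp_nat_mul]
  push_cast; ring_nf

lemma continuous_ex : Continuous ex := by
  unfold ex; fun_prop

/-- Lebesgue measure on the unit interval. -/
noncomputable abbrev unitMeasure : Measure ℝ := volume.restrict (Set.Ico (0 : ℝ) 1)

/-- The Fourier integral of `f` over the unit interval, at real frequencies. -/
noncomputable def fint (f : ℝ → ℂ) (t : ℝ) : ℂ := ∫ u in Set.Ico (0 : ℝ) 1, f u * ex (t * u)

/-- The energy of `f` over the unit interval. -/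
noncomputable def energy (f : ℝ → ℂ) : ℝ≥0∞ := ∫⁻ u in Set.Ico (0 : ℝ) 1, ‖f u‖ₑ ^ 2

lemma restrict_Ico_eq_Ioc (a b : ℝ) :
    (volume : Measure ℝ).restrict (Set.Ico a b) = volume.restrict (Set.Ioc a b) :=
  Measure.restrict_congr_set Ico_ae_eq_Ioc

lemma lintegral_enorm_sq_lt_top {μ : Measure ℝ} {f : ℝ → ℂ} (hf : MemLp f 2 μ) :
    ∫⁻ u, ‖f u‖ₑ ^ 2 ∂μ < ⊤ := by
  have := lintegral_rpow_enorm_lt_top_of_eLpNorm_lt_top (p := 2) (by norm_num) (by norm_num)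
    hf.eLpNorm_lt_top
  simpa using this

lemma memLp_two_of_lintegral {μ : Measure ℝ} {f : ℝ → ℂ} (hm : AEStronglyMeasurable f μ)
    (h : ∫⁻ u, ‖f u‖ₑ ^ 2 ∂μ < ⊤) : MemLp f 2 μ := by
  refine ⟨hm, ?_⟩
  rw [eLpNorm_lt_top_iff_lintegral_rpow_enorm_lt_top (by norm_num) (by norm_num)]
  simpa using h

lemma energy_lt_top {f : ℝ → ℂ} (hf : MemLp f 2 unitMeasure) : energy f < ⊤ :=
  lintegral_enorm_sq_lt_top hf

/-- Parseval's identity on an interval. -/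
lemma parseval_Ico {a b : ℝ} (hab : a < b) {f : ℝ → ℂ}
    (hf : MemLp f 2 (volume.restrict (Set.Ico a b))) :
    ∑' n : ℤ, ‖∫ u in Set.Ico a b, f u * ex (n * (u / (b - a)))‖ₑ ^ 2 =
      ENNReal.ofReal (b - a) * ∫⁻ u in Set.Ico a b, ‖f u‖ₑ ^ 2 := by
  rw [restrict_Ico_eq_Ioc] at *
  have hba : 0 < b - a := sub_pos.2 hab
  have h1 := hasSum_sq_fourierCoeffOn hab hf
  -- The kernel has the opposite sign from the one in `fourierCoeffOn`, whence the index `-n`; the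
  -- reflection is undone in `h3`.
  have hcoef : ∀ n : ℤ, (∫ u in Set.Ioc a b, f u * ex (n * (u / (b - a)))) =
      ((b - a : ℝ) : ℂ) * fourierCoeffOn hab f (-n) := by
    intro n
    rw [fourierCoeffOn_eq_integral, intervalIntegral.integral_of_le hab.le, Complex.real_smul,
      ← mul_assoc, ← Complex.ofReal_mul, mul_one_div_cancel hba.ne', Complex.ofReal_one, one_mul]
    refine integral_congr_ae (ae_of_all _ fun u => ?_)
    simp only [neg_neg, smul_eq_mul, fourier_coe_apply, ex]
    rw [mul_comm]
    congr 2
    push_cast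
    ring
  have h2 : ∀ n : ℤ, ‖∫ u in Set.Ioc a b, f u * ex (n * (u / (b - a)))‖ₑ ^ 2 =
      ENNReal.ofReal ((b - a) ^ 2 * ‖fourierCoeffOn hab f (-n)‖ ^ 2) := by
    intro n
    rw [hcoef, ← ofReal_norm, norm_mul, Complex.norm_real, Real.norm_eq_abs,
      abs_of_pos hba, ← ENNReal.ofReal_pow (by positivity), mul_pow]
  simp_rw [h2]
  have h3 : HasSum (fun n : ℤ => (b - a) ^ 2 * ‖fourierCoeffOn hab f (-n)‖ ^ 2)
      ((b - a) ^ 2 * ((b - a)⁻¹ • ∫ x in a..b, ‖f x‖ ^ 2)) :=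
    ((Equiv.neg ℤ).hasSum_iff.2 h1).mul_left _
  rw [← ENNReal.ofReal_tsum_of_nonneg (fun n => by positivity) h3.summable, h3.tsum_eq,
    smul_eq_mul, ← mul_assoc, show (b - a) ^ 2 * (b - a)⁻¹ = b - a by field_simp,
    ENNReal.ofReal_mul hba.le, intervalIntegral.integral_of_le hab.le,
    ofReal_integral_eq_lintegral_ofReal]
  · congr 1
    refine lintegral_congr fun u => ?_
    rw [ENNReal.ofReal_pow (norm_nonneg _), ofReal_norm]
  · exact hf.integrable_norm_pow (by norm_num)
  · exact ae_of_all _ fun u => by positivity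

lemma tsum_fint_sq {f : ℝ → ℂ} (hf : MemLp f 2 unitMeasure) :
    ∑' n : ℤ, ‖fint f n‖ₑ ^ 2 = energy f := by
  have := parseval_Ico zero_lt_one hf
  simpa [fint, energy] using this

lemma tsum_fint_sq_le {f : ℝ → ℂ} (hf : MemLp f 2 unitMeasure) (Λ : Set ℤ) :
    ∑' n : Λ, ‖fint f (n : ℤ)‖ₑ ^ 2 ≤ energy f := by
  rw [← tsum_fint_sq hf]
  exact ENNReal.tsum_comp_le_tsum_of_injective Subtype.val_injective
    (fun n : ℤ => ‖fint f n‖ₑ ^ 2)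

lemma _root_.MeasureTheory.MemLp.integrable_unit {f : ℝ → ℂ} (hf : MemLp f 2 unitMeasure) :
    Integrable f unitMeasure :=
  hf.integrable (by norm_num)

lemma integrable_mul_ex {μ : Measure ℝ} {f : ℝ → ℂ} (hf : Integrable f μ) (t : ℝ) :
    Integrable (fun u => f u * ex (t * u)) μ := by
  refine hf.mul_bdd (c := 1) ?_ ?_
  · exact (continuous_ex.comp (by fun_prop)).aestronglyMeasurable
  · exact ae_of_all _ fun u => (norm_ex _).le

lemma fint_add {f g : ℝ → ℂ} (hf : Integrable f unitMeasure) (hg : Integrable g unitMeasure)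
    (t : ℝ) : fint (f + g) t = fint f t + fint g t := by
  unfold fint
  rw [← integral_add (integrable_mul_ex hf t) (integrable_mul_ex hg t)]
  simp only [Pi.add_apply, add_mul]

lemma enorm_sq_add_le (a b : ℂ) : ‖a + b‖ₑ ^ 2 ≤ 2 * (‖a‖ₑ ^ 2 + ‖b‖ₑ ^ 2) := by
  have h := norm_add_le a b
  have : ‖a + b‖ ^ 2 ≤ 2 * (‖a‖ ^ 2 + ‖b‖ ^ 2) := by
    nlinarith [sq_nonneg (‖a‖ - ‖b‖), norm_nonneg (a + b), norm_nonneg a, norm_nonneg b]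
  have h2 := ENNReal.ofReal_le_ofReal this
  rw [ENNReal.ofReal_mul (by norm_num), ENNReal.ofReal_add (by positivity) (by positivity),
    ENNReal.ofReal_pow (norm_nonneg _), ENNReal.ofReal_pow (norm_nonneg _),
    ENNReal.ofReal_pow (norm_nonneg _)] at h2
  simpa only [ofReal_norm, ENNReal.ofReal_ofNat] using h2

/-! ### Sampling sets of integers -/

/-- The integers in `Λ` sample the square integrable functions on the unit interval that are
supported in `A`. -/
def Samples (Λ : Set ℤ) (A : Set ℝ) : Prop :=
  ∃ C : ℝ≥0, ∀ f : ℝ → ℂ, MemLp f 2 unitMeasure → (∀ u ∈ Set.Ico (0 : ℝ) 1, u ∉ A → f u = 0) →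
    energy f ≤ C * ∑' n : Λ, ‖fint f (n : ℤ)‖ₑ ^ 2

/-- Sampling is applied to the part of f on A, and Bessel's inequality bounds the samples of the
part off A. In the elimination argument the extra energy term is the one that earlier rows control.
-/
lemma Samples.exists_bound {Λ : Set ℤ} {A : Set ℝ} (h : Samples Λ A) (hA : MeasurableSet A) :
    ∃ C : ℝ≥0, ∀ f : ℝ → ℂ, MemLp f 2 unitMeasure →
      energy f ≤ C * (∑' n : Λ, ‖fint f (n : ℤ)‖ₑ ^ 2 + energy (Aᶜ.indicator f)) := by
  obtain ⟨C, hC⟩ := h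
  refine ⟨4 * C + 2, fun f hf => ?_⟩
  have h1 : MemLp (A.indicator f) 2 unitMeasure := hf.indicator hA
  have h2 : MemLp (Aᶜ.indicator f) 2 unitMeasure := hf.indicator hA.compl
  have hsum : f = A.indicator f + Aᶜ.indicator f := (Set.indicator_self_add_compl A f).symm
  have hE : energy f ≤ 2 * (energy (A.indicator f) + energy (Aᶜ.indicator f)) := by
    conv_lhs => rw [hsum]
    unfold energy
    rw [← lintegral_add_right', ← lintegral_const_mul']
    · exact lintegral_mono fun u => enorm_sq_add_le _ _
    · norm_num
    · exact (h2.1.enorm.pow_const 2)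
  have hA1 := hC _ h1 fun u _ hu => by simp [hu]
  have hsub : ∀ n : ℤ, ‖fint (A.indicator f) n‖ₑ ^ 2 ≤
      2 * (‖fint f n‖ₑ ^ 2 + ‖fint (Aᶜ.indicator f) n‖ₑ ^ 2) := by
    intro n
    have h3 : fint f n = fint (A.indicator f) n + fint (Aᶜ.indicator f) n := by
      conv_lhs => rw [hsum]
      exact fint_add h1.integrable_unit h2.integrable_unit _
    have h4 : fint (A.indicator f) n = fint f n + -fint (Aᶜ.indicator f) n := by
      rw [h3]; ring
    rw [h4]
    refine (enorm_sq_add_le _ _).trans ?_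
    rw [enorm_neg]
  have hA2 : ∑' n : Λ, ‖fint (A.indicator f) (n : ℤ)‖ₑ ^ 2 ≤
      2 * (∑' n : Λ, ‖fint f (n : ℤ)‖ₑ ^ 2 + energy (Aᶜ.indicator f)) := by
    refine (ENNReal.tsum_le_tsum fun n : Λ => hsub n).trans ?_
    rw [ENNReal.tsum_mul_left, ENNReal.tsum_add]
    gcongr
    exact tsum_fint_sq_le h2 Λ
  set X := ∑' n : Λ, ‖fint f (n : ℤ)‖ₑ ^ 2
  set Y := energy (Aᶜ.indicator f)
  calc energy f ≤ 2 * (energy (A.indicator f) + Y) := hE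
    _ ≤ 2 * (C * (2 * (X + Y)) + Y) := by gcongr; exact hA1.trans (by gcongr)
    _ ≤ 2 * (C * (2 * (X + Y)) + (X + Y)) := by gcongr; exact le_add_self
    _ = _ := by push_cast; ring

end CTVGS

namespace CTVGS

/-! ### Greedy row selection -/

section Greedy

variable {n : ℕ} {κ : Type*}

/-- The row `r` of `M`, restricted to the columns in `C`. -/
def restrictedRow (M : Matrix (Fin n) κ ℂ) (C : Finset κ) (r : Fin n) : C → ℂ := fun c => M r c

/-- The rows of `M` which, restricted to the columns in `C`, are not linear combinations of
earlier rows. -/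
def greedyRows (M : Matrix (Fin n) κ ℂ) (C : Finset κ) : Set (Fin n) :=
  {r | restrictedRow M C r ∉ Submodule.span ℂ (restrictedRow M C '' {s | s < r})}

/-- Induction over the rows read so far: a row is kept exactly when it enlarges the span, so the
kept rows stay independent and lose nothing of the span. -/
lemma greedyRows_aux (M : Matrix (Fin n) κ ℂ) (C : Finset κ) (j : ℕ) :
    LinearIndepOn ℂ (restrictedRow M C) {r | r ∈ greedyRows M C ∧ (r : ℕ) < j} ∧
      Submodule.span ℂ (restrictedRow M C '' {r | r ∈ greedyRows M C ∧ (r : ℕ) < j}) =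
        Submodule.span ℂ (restrictedRow M C '' {r | (r : ℕ) < j}) := by
  induction j with
  | zero => simp
  | succ j ih =>
    obtain ⟨ih1, ih2⟩ := ih
    by_cases hj : j < n
    · have hlt : {r : Fin n | (r : ℕ) < j + 1} = insert ⟨j, hj⟩ {r : Fin n | (r : ℕ) < j} := by
        ext r
        simp only [Set.mem_ofPred_eq, Set.mem_insert_iff, Fin.ext_iff]
        omega
      have hset : {s : Fin n | s < ⟨j, hj⟩} = {r : Fin n | (r : ℕ) < j} := by
        ext r; simp [Fin.lt_def]
      by_cases hg : (⟨j, hj⟩ : Fin n) ∈ greedyRows M C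
      · have hins : {r : Fin n | r ∈ greedyRows M C ∧ (r : ℕ) < j + 1} =
            insert ⟨j, hj⟩ {r : Fin n | r ∈ greedyRows M C ∧ (r : ℕ) < j} := by
          ext r
          simp only [Set.mem_ofPred_eq, Set.mem_insert_iff]
          constructor
          · rintro ⟨h1, h2⟩
            by_cases h : (r : ℕ) = j
            · left; exact Fin.ext h
            · right; exact ⟨h1, by omega⟩
          · rintro (rfl | ⟨h1, h2⟩)
            · exact ⟨hg, by simp⟩
            · exact ⟨h1, by omega⟩
        rw [hins, hlt]
        constructor
        · refine (linearIndepOn_insert (by simp)).2 ⟨ih1, ?_⟩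
          rw [ih2]
          simpa only [greedyRows, Set.mem_ofPred_eq, hset] using hg
        · rw [Set.image_insert_eq, Set.image_insert_eq, Submodule.span_insert,
            Submodule.span_insert, ih2]
      · have hins : {r : Fin n | r ∈ greedyRows M C ∧ (r : ℕ) < j + 1} =
            {r : Fin n | r ∈ greedyRows M C ∧ (r : ℕ) < j} := by
          ext r
          simp only [Set.mem_ofPred_eq]
          constructor
          · rintro ⟨h1, h2⟩
            refine ⟨h1, ?_⟩
            by_contra h
            have : r = ⟨j, hj⟩ := Fin.ext (by simp; omega)
            exact hg (this ▸ h1)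
          · rintro ⟨h1, h2⟩
            exact ⟨h1, by omega⟩
        rw [hins, hlt]
        refine ⟨ih1, ?_⟩
        rw [ih2, Set.image_insert_eq]
        symm
        apply Submodule.span_insert_eq_span
        simpa only [greedyRows, Set.mem_ofPred_eq, not_not, hset] using hg
    · have h1 : ∀ r : Fin n, (r : ℕ) < j + 1 ↔ (r : ℕ) < j := fun r => by
        have := r.2
        omega
      simp only [h1]
      exact ⟨ih1, ih2⟩

lemma linearIndepOn_greedyRows (M : Matrix (Fin n) κ ℂ) (C : Finset κ) :
    LinearIndepOn ℂ (restrictedRow M C) (greedyRows M C) := by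
  simpa using (greedyRows_aux M C n).1

lemma span_greedyRows (M : Matrix (Fin n) κ ℂ) (C : Finset κ) :
    Submodule.span ℂ (restrictedRow M C '' greedyRows M C) =
      Submodule.span ℂ (Set.range (restrictedRow M C)) := by
  simpa using (greedyRows_aux M C n).2

/-- Injectivity of `M` makes the columns in `C` independent, so the restricted matrix has rank |C|,
and the greedy rows form a basis of its row space. This count is what makes the densities add up
exactly. -/
lemma ncard_greedyRows [Fintype κ] (M : Matrix (Fin n) κ ℂ) (hM : Function.Injective M.mulVec)
    (C : Finset κ) : (greedyRows M C).ncard = C.card := by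
  classical
  have h1 := linearIndepOn_greedyRows M C
  have h2 := finrank_span_eq_card h1
  have h3 : (M.submatrix id ((↑) : C → κ)).rank = C.card := by
    rw [Matrix.rank, LinearMap.finrank_range_of_inj]
    · simp
    · intro x y hxy
      have h4 : ∀ z : C → ℂ, (M.submatrix id ((↑) : C → κ)).mulVec z =
          M.mulVec (fun c => if h : c ∈ C then z ⟨c, h⟩ else 0) := by
        intro z
        ext r
        simp only [Matrix.mulVec, dotProduct, Matrix.submatrix_apply, id]
        rw [← Finset.sum_subset (Finset.subset_univ C), ← Finset.sum_coe_sort C]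
        · refine Finset.sum_congr rfl fun c _ => ?_
          simp
        · intro c _ hc
          simp [hc]
      simp only [Matrix.mulVecLin_apply, h4] at hxy
      have h5 := hM hxy
      ext c
      simpa using congrFun h5 c
  rw [Matrix.rank_eq_finrank_span_row] at h3
  have h6 : Set.range (fun r : greedyRows M C => restrictedRow M C r) =
      restrictedRow M C '' greedyRows M C := by
    rw [Set.image_eq_range]
  rw [h6, span_greedyRows] at h2
  rw [← h3, ← Nat.card_coe_set_eq, Nat.card_eq_fintype_card, ← h2]
  rfl

/-- On `C` a rejected row is a fixed combination of earlier ones; the constant comes from its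
coefficients and not from `x`. -/
lemma exists_bound_of_notMem_greedyRows [Fintype κ] (M : Matrix (Fin n) κ ℂ) (C : Finset κ) (r : Fin n)
    (hr : r ∉ greedyRows M C) : ∃ K : ℝ≥0, ∀ x : κ → ℂ, (∀ c ∉ C, x c = 0) →
      ‖∑ c, M r c * x c‖ₑ ^ 2 ≤ K * ∑ s with s < r, ‖∑ c, M s c * x c‖ₑ ^ 2 := by
  have key : ∀ v ∈ Submodule.span ℂ (restrictedRow M C '' {s | s < r}),
      ∃ K : ℝ≥0, ∀ x : κ → ℂ, (∀ c ∉ C, x c = 0) →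
      ‖∑ c : C, v c * x c‖ₑ ^ 2 ≤ K * ∑ s with s < r, ‖∑ c, M s c * x c‖ₑ ^ 2 := by
    intro v hv
    induction hv using Submodule.span_induction with
    | mem v hv =>
      obtain ⟨s, hs, rfl⟩ := hv
      refine ⟨1, fun x hx => ?_⟩
      have : ∑ c : C, restrictedRow M C s c * x c = ∑ c, M s c * x c := by
        simp only [restrictedRow]
        rw [Finset.sum_coe_sort C (fun c => M s c * x c)]
        exact Finset.sum_subset (Finset.subset_univ C) fun c _ hc => by simp [hx c hc]
      rw [this, ENNReal.coe_one, one_mul]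
      exact Finset.single_le_sum (f := fun s => ‖∑ c, M s c * x c‖ₑ ^ 2) (fun _ _ => zero_le)
        (by simpa using hs)
    | zero => exact ⟨0, fun x _ => by simp⟩
    | add v w _ _ hv hw =>
      obtain ⟨K, hK⟩ := hv
      obtain ⟨L, hL⟩ := hw
      refine ⟨2 * (K + L), fun x hx => ?_⟩
      simp only [Pi.add_apply, add_mul, Finset.sum_add_distrib]
      refine (enorm_sq_add_le _ _).trans ?_
      push_cast
      rw [mul_assoc, add_mul]
      gcongr
      exacts [hK x hx, hL x hx]
    | smul a v _ hv =>
      obtain ⟨K, hK⟩ := hv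
      refine ⟨‖a‖₊ ^ 2 * K, fun x hx => ?_⟩
      simp only [Pi.smul_apply, smul_eq_mul, mul_assoc, ← Finset.mul_sum, enorm_mul, mul_pow]
      push_cast
      rw [mul_assoc]
      gcongr
      · exact le_rfl
      · exact hK x hx
  simp only [greedyRows, Set.mem_ofPred_eq, not_not] at hr
  obtain ⟨K, hK⟩ := key _ hr
  refine ⟨K, fun x hx => ?_⟩
  have : ∑ c : C, restrictedRow M C r c * x c = ∑ c, M r c * x c := by
    simp only [restrictedRow]
    rw [Finset.sum_coe_sort C (fun c => M r c * x c)]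
    exact Finset.sum_subset (Finset.subset_univ C) fun c _ hc => by simp [hx c hc]
  rw [← this]
  exact hK x hx

/-- There are finitely many pairs (C, r), so one constant serves them all. This allows `C` to vary
with the frequency. -/
lemma exists_uniform_bound [Fintype κ] (M : Matrix (Fin n) κ ℂ) :
    ∃ K : ℝ≥0, ∀ (C : Finset κ) (r : Fin n), r ∉ greedyRows M C →
      ∀ x : κ → ℂ, (∀ c ∉ C, x c = 0) →
      ‖∑ c, M r c * x c‖ₑ ^ 2 ≤ K * ∑ s with s < r, ‖∑ c, M s c * x c‖ₑ ^ 2 := by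
  classical
  have h : ∀ p : Finset κ × Fin n, ∃ K : ℝ≥0, p.2 ∉ greedyRows M p.1 →
      ∀ x : κ → ℂ, (∀ c ∉ p.1, x c = 0) →
      ‖∑ c, M p.2 c * x c‖ₑ ^ 2 ≤ K * ∑ s with s < p.2, ‖∑ c, M s c * x c‖ₑ ^ 2 := by
    intro p
    by_cases hp : p.2 ∈ greedyRows M p.1
    · exact ⟨0, fun h => absurd hp h⟩
    · obtain ⟨K, hK⟩ := exists_bound_of_notMem_greedyRows M p.1 p.2 hp
      exact ⟨K, fun _ => hK⟩
  choose K hK using h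
  refine ⟨∑ p, K p, fun C r hr x hx => (hK (C, r) hr x hx).trans ?_⟩
  gcongr
  exact Finset.single_le_sum (f := K) (fun _ _ => zero_le) (Finset.mem_univ _)

/-- An injective linear map in finite dimension is bounded below. The antilipschitz constant refers
to sup norms; passing to sums of squares costs the factor |κ|. -/
lemma exists_bound_of_injective [Fintype κ] (M : Matrix (Fin n) κ ℂ) (hM : Function.Injective M.mulVec) :
    ∃ K : ℝ≥0, ∀ x : κ → ℂ, ∑ c, ‖x c‖ₑ ^ 2 ≤ K * ∑ r, ‖∑ c, M r c * x c‖ₑ ^ 2 := by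
  obtain ⟨K, -, hK⟩ := M.mulVecLin.exists_antilipschitzWith (LinearMap.ker_eq_bot.2 hM)
  refine ⟨Fintype.card κ * K ^ 2, fun x => ?_⟩
  have h1 : ‖x‖ₑ ^ 2 ≤ (K : ℝ≥0∞) ^ 2 * ∑ r, ‖∑ c, M r c * x c‖ₑ ^ 2 := by
    have h2 : ‖x‖ₑ ≤ K * ‖M.mulVec x‖ₑ := by
      have := hK x 0
      simpa [edist_zero_right] using this
    calc ‖x‖ₑ ^ 2 ≤ (K * ‖M.mulVec x‖ₑ) ^ 2 := by gcongr
      _ = (K : ℝ≥0∞) ^ 2 * ‖M.mulVec x‖ₑ ^ 2 := mul_pow _ _ _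
      _ ≤ _ := by
        gcongr
        rcases isEmpty_or_nonempty (Fin n) with h | h
        · have : M.mulVec x = 0 := by ext r; exact h.elim r
          simp [this]
        · obtain ⟨r, hr⟩ : ∃ r, ‖M.mulVec x‖ = ‖M.mulVec x r‖ := by
            obtain ⟨r, -, hr⟩ := Finset.exists_mem_eq_sup' (Finset.univ_nonempty (α := Fin n))
              (fun r => ‖M.mulVec x r‖)
            refine ⟨r, le_antisymm ?_ (norm_le_pi_norm _ _)⟩
            refine (pi_norm_le_iff_of_nonneg (norm_nonneg _)).2 fun s => ?_
            rw [← hr]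
            exact Finset.le_sup' (fun r => ‖M.mulVec x r‖) (Finset.mem_univ s)
          have h3 : ‖M.mulVec x‖ₑ = ‖∑ c, M r c * x c‖ₑ := by
            rw [← ofReal_norm, ← ofReal_norm, hr]; rfl
          rw [h3]
          exact Finset.single_le_sum (f := fun r => ‖∑ c, M r c * x c‖ₑ ^ 2)
            (fun _ _ => zero_le) (Finset.mem_univ r)
  calc ∑ c, ‖x c‖ₑ ^ 2 ≤ ∑ _c : κ, ‖x‖ₑ ^ 2 := by
        gcongr with c
        rw [← ofReal_norm, ← ofReal_norm]
        exact ENNReal.ofReal_le_ofReal (norm_le_pi_norm x c)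
    _ = Fintype.card κ * ‖x‖ₑ ^ 2 := by simp
    _ ≤ _ := by
      push_cast
      rw [mul_assoc]
      gcongr

/-- Sampling the rows one after the other: each row is determined by the earlier ones outside the
set where it is selected greedily. -/
lemma exists_elimination_bound [Fintype κ] (M : Matrix (Fin n) κ ℂ) (hM : Function.Injective M.mulVec)
    (C : ℝ → Finset κ) (φ : Fin n → ℝ → ℂ) (hφ : ∀ r u, ‖φ r u‖ₑ = 1)
    (hφc : ∀ r, Continuous (φ r)) (Λ : Fin n → Set ℤ)
    (hmeas : ∀ r, MeasurableSet {u | r ∈ greedyRows M (C u)})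
    (hΛ : ∀ r, Samples (Λ r) {u | r ∈ greedyRows M (C u)}) :
    ∃ K : ℝ≥0, ∀ x : κ → ℝ → ℂ, (∀ c, MemLp (x c) 2 unitMeasure) →
      (∀ u ∈ Set.Ico (0 : ℝ) 1, ∀ c ∉ C u, x c u = 0) →
      ∑ c, energy (x c) ≤
        K * ∑ r, ∑' m : Λ r, ‖fint (fun u => φ r u * ∑ c, M r c * x c u) (m : ℤ)‖ₑ ^ 2 := by
  obtain ⟨K₀, hK₀⟩ := exists_uniform_bound M
  obtain ⟨K₁, hK₁⟩ := exists_bound_of_injective M hM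
  choose B hB using fun r => (hΛ r).exists_bound (hmeas r)
  have hmem : ∀ (x : κ → ℝ → ℂ), (∀ c, MemLp (x c) 2 unitMeasure) → ∀ r,
      MemLp (fun u => φ r u * ∑ c, M r c * x c u) 2 unitMeasure := by
    intro x hx r
    have h1 : MemLp (fun u => ∑ c, M r c * x c u) 2 unitMeasure :=
      memLp_finsetSum _ fun c _ => (hx c).const_mul (M r c)
    refine h1.of_le ((hφc r).aestronglyMeasurable.mul h1.1) (ae_of_all _ fun u => ?_)
    have : ‖φ r u‖ = 1 := by
      have := hφ r u
      rw [← ofReal_norm, ENNReal.ofReal_eq_one] at this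
      exact this
    simp [this]
  have henergy : ∀ (x : κ → ℝ → ℂ) r, energy (fun u => φ r u * ∑ c, M r c * x c u) =
      ∫⁻ u in Set.Ico (0 : ℝ) 1, ‖∑ c, M r c * x c u‖ₑ ^ 2 := by
    intro x r
    simp [energy, enorm_mul, hφ]
  have hae : ∀ (x : κ → ℝ → ℂ), (∀ c, MemLp (x c) 2 unitMeasure) → ∀ r,
      AEMeasurable (fun u => ‖∑ c, M r c * x c u‖ₑ ^ 2) unitMeasure := by
    intro x hx r
    have h1 : MemLp (fun u => ∑ c, M r c * x c u) 2 unitMeasure :=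
      memLp_finsetSum _ fun c _ => (hx c).const_mul (M r c)
    exact h1.1.enorm.pow_const 2
  -- Strong induction on the row: where r is chosen its own samples control it, and elsewhere the
  -- earlier rows do, pointwise in u.
  have key : ∀ r : Fin n, ∃ K : ℝ≥0, ∀ x : κ → ℝ → ℂ, (∀ c, MemLp (x c) 2 unitMeasure) →
      (∀ u ∈ Set.Ico (0 : ℝ) 1, ∀ c ∉ C u, x c u = 0) →
      energy (fun u => φ r u * ∑ c, M r c * x c u) ≤
        K * ∑ r, ∑' m : Λ r, ‖fint (fun u => φ r u * ∑ c, M r c * x c u) (m : ℤ)‖ₑ ^ 2 := by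
    intro r
    induction r using WellFoundedLT.induction with
    | ind r ih =>
      choose! K hK using ih
      refine ⟨B r * (1 + K₀ * ∑ s with s < r, K s), fun x hx hC => ?_⟩
      set S := ∑ r, ∑' m : Λ r, ‖fint (fun u => φ r u * ∑ c, M r c * x c u) (m : ℤ)‖ₑ ^ 2 with hS
      have h1 := hB r _ (hmem x hx r)
      have h2 : ∑' m : Λ r, ‖fint (fun u => φ r u * ∑ c, M r c * x c u) (m : ℤ)‖ₑ ^ 2 ≤ S :=
        Finset.single_le_sum (f := fun r => ∑' m : Λ r,
          ‖fint (fun u => φ r u * ∑ c, M r c * x c u) (m : ℤ)‖ₑ ^ 2) (fun _ _ => zero_le)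
          (Finset.mem_univ r)
      have h3 : energy ({u | r ∈ greedyRows M (C u)}ᶜ.indicator
          (fun u => φ r u * ∑ c, M r c * x c u)) ≤ K₀ * ∑ s with s < r, K s * S := by
        calc energy ({u | r ∈ greedyRows M (C u)}ᶜ.indicator
              (fun u => φ r u * ∑ c, M r c * x c u))
            ≤ ∫⁻ u in Set.Ico (0 : ℝ) 1,
              K₀ * ∑ s with s < r, ‖∑ c, M s c * x c u‖ₑ ^ 2 := by
              refine setLIntegral_mono_ae' measurableSet_Ico (ae_of_all _ fun u hu => ?_)
              by_cases hr : r ∈ greedyRows M (C u)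
              · simp [Set.indicator, hr]
              · simp only [Set.indicator, Set.mem_compl_iff, Set.mem_ofPred_eq, hr,
                  not_false_eq_true, if_true, enorm_mul, hφ, one_mul]
                exact hK₀ (C u) r hr (fun c => x c u) (hC u hu)
          _ = K₀ * ∑ s with s < r, energy (fun u => φ s u * ∑ c, M s c * x c u) := by
              rw [lintegral_const_mul' _ _ ENNReal.coe_ne_top, lintegral_finsetSum']
              · simp_rw [henergy]
              · exact fun s _ => hae x hx s
          _ ≤ _ := by
              gcongr with s hs
              exact hK s (by simpa using hs) x hx hC
      refine h1.trans ?_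
      push_cast
      rw [mul_assoc, add_mul, one_mul, mul_assoc, Finset.sum_mul]
      gcongr
  choose K hK using key
  refine ⟨K₁ * ∑ r, K r, fun x hx hC => ?_⟩
  calc ∑ c, energy (x c) = ∫⁻ u in Set.Ico (0 : ℝ) 1, ∑ c, ‖x c u‖ₑ ^ 2 := by
        rw [lintegral_finsetSum']
        · rfl
        · exact fun c _ => (hx c).1.enorm.pow_const 2
    _ ≤ ∫⁻ u in Set.Ico (0 : ℝ) 1, K₁ * ∑ r, ‖∑ c, M r c * x c u‖ₑ ^ 2 :=
        lintegral_mono fun u => hK₁ _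
    _ = K₁ * ∑ r, energy (fun u => φ r u * ∑ c, M r c * x c u) := by
        rw [lintegral_const_mul' _ _ ENNReal.coe_ne_top, lintegral_finsetSum']
        · simp_rw [henergy]
        · exact fun s _ => hae x hx s
    _ ≤ _ := by
        push_cast
        rw [mul_assoc, Finset.sum_mul]
        gcongr with r
        exact hK r x hx hC

end Greedy

end CTVGS

namespace CTVGS

/-! ### Uniform density -/

/-- `Λ` has `d (y - x) + O(1)` points in every interval `[x, y]`. -/
def UniformDensity (Λ : Set ℝ) (d : ℝ) : Prop :=
  ∃ K : ℝ, ∀ x y : ℝ, x ≤ y → (Λ ∩ Set.Icc x y).Finite ∧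
    |((Λ ∩ Set.Icc x y).ncard : ℝ) - d * (y - x)| ≤ K

lemma uniformDensity_empty : UniformDensity ∅ 0 := ⟨0, fun x y _ => by simp⟩

lemma uniformDensity_range_intCast : UniformDensity (Set.range ((↑) : ℤ → ℝ)) 1 := by
  refine ⟨1, fun x y hxy => ?_⟩
  have h1 : Set.range ((↑) : ℤ → ℝ) ∩ Set.Icc x y =
      (fun n : ℤ => (n : ℝ)) '' (Finset.Icc ⌈x⌉ ⌊y⌋ : Finset ℤ) := by
    ext z
    simp only [Set.mem_inter_iff, Set.mem_range, Set.mem_Icc, Finset.coe_Icc, Set.mem_image]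
    constructor
    · rintro ⟨⟨n, rfl⟩, h1, h2⟩
      exact ⟨n, ⟨Int.ceil_le.2 h1, Int.le_floor.2 h2⟩, rfl⟩
    · rintro ⟨n, ⟨h1, h2⟩, rfl⟩
      exact ⟨⟨n, rfl⟩, Int.ceil_le.1 h1, Int.le_floor.1 h2⟩
  rw [h1]
  refine ⟨(Finset.finite_toSet _).image _, ?_⟩
  rw [Set.ncard_image_of_injective _ Int.cast_injective, Set.ncard_coe_finset, Int.card_Icc]
  -- The cardinality formula is not truncated by `toNat`: an interval without integers has ⌈x⌉ = ⌊y⌋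
  -- + 1.
  have h2 : (0 : ℤ) ≤ ⌊y⌋ + 1 - ⌈x⌉ := by
    have : ⌈x⌉ ≤ ⌊y⌋ + 1 := by
      rw [Int.ceil_le]
      push_cast
      linarith [Int.lt_floor_add_one y]
    omega
  have h3 : (((⌊y⌋ + 1 - ⌈x⌉).toNat : ℤ) : ℝ) = (⌊y⌋ + 1 - ⌈x⌉ : ℝ) := by
    rw [Int.toNat_of_nonneg h2]; push_cast; ring
  rw [Int.cast_natCast] at h3
  rw [h3, abs_le]
  constructor <;> linarith [Int.lt_floor_add_one y, Int.floor_le y, Int.le_ceil x,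
    Int.ceil_lt_add_one x]

lemma UniformDensity.affine {Λ : Set ℝ} {d : ℝ} (h : UniformDensity Λ d) {p : ℝ} (hp : 0 < p)
    (q : ℝ) : UniformDensity ((fun x => p * x + q) '' Λ) (d / p) := by
  obtain ⟨K, hK⟩ := h
  refine ⟨K, fun x y hxy => ?_⟩
  have hinj : Function.Injective (fun x => p * x + q) := fun a b hab => by
    simpa [hp.ne'] using hab
  have h1 : (fun x => p * x + q) '' Λ ∩ Set.Icc x y =
      (fun x => p * x + q) '' (Λ ∩ Set.Icc ((x - q) / p) ((y - q) / p)) := by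
    ext z
    simp only [Set.mem_inter_iff, Set.mem_image, Set.mem_Icc]
    constructor
    · rintro ⟨⟨w, hw, rfl⟩, h1, h2⟩
      refine ⟨w, ⟨hw, ?_, ?_⟩, rfl⟩
      · rw [div_le_iff₀ hp]; linarith
      · rw [le_div_iff₀ hp]; linarith
    · rintro ⟨w, ⟨hw, h1, h2⟩, rfl⟩
      rw [div_le_iff₀ hp] at h1
      rw [le_div_iff₀ hp] at h2
      exact ⟨⟨w, hw, rfl⟩, by linarith, by linarith⟩
  obtain ⟨h2, h3⟩ := hK ((x - q) / p) ((y - q) / p) (by gcongr)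
  rw [h1, Set.ncard_image_of_injective _ hinj]
  refine ⟨h2.image _, ?_⟩
  convert h3 using 3
  field_simp
  ring

lemma UniformDensity.iUnion {ι : Type*} [Fintype ι] {Λ : ι → Set ℝ} {d : ι → ℝ}
    (h : ∀ i, UniformDensity (Λ i) (d i)) (hd : Pairwise (Function.onFun Disjoint Λ)) :
    UniformDensity (⋃ i, Λ i) (∑ i, d i) := by
  choose K hK using h
  refine ⟨∑ i, K i, fun x y hxy => ?_⟩
  rw [Set.iUnion_inter]
  have hfin := fun i => (hK i x y hxy).1
  refine ⟨Set.finite_iUnion hfin, ?_⟩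
  rw [Set.ncard_iUnion_of_finite hfin, finsum_eq_sum_of_fintype]
  · push_cast
    rw [Finset.sum_mul, ← Finset.sum_sub_distrib]
    exact (Finset.abs_sum_le_sum_abs _ _).trans (Finset.sum_le_sum fun i _ => (hK i x y hxy).2)
  · exact fun i j hij => (hd hij).mono Set.inter_subset_left Set.inter_subset_left

/-! ### Cutting integrals into pieces of equal length -/

lemma hasDerivWithinAt_affine (q k x : ℝ) (s : Set ℝ) :
    HasDerivWithinAt (fun u : ℝ => q * (u + k)) q s x := by
  simpa using (((hasDerivAt_id x).add_const k).const_mul q).hasDerivWithinAt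

lemma image_affine_Ico {q : ℝ} (hq : 0 < q) (k : ℝ) :
    (fun u : ℝ => q * (u + k)) '' Set.Ico 0 1 = Set.Ico (q * k) (q * (k + 1)) := by
  ext w
  simp only [Set.mem_image, Set.mem_Ico]
  constructor
  · rintro ⟨u, ⟨h0, h1⟩, rfl⟩
    exact ⟨mul_le_mul_of_nonneg_left (by linarith) hq.le, mul_lt_mul_of_pos_left (by linarith) hq⟩
  · rintro ⟨h0, h1⟩
    refine ⟨w / q - k, ⟨?_, ?_⟩, ?_⟩
    · rw [sub_nonneg, le_div_iff₀ hq]; linarith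
    · rw [sub_lt_iff_lt_add, div_lt_iff₀ hq]; linarith
    · field_simp; ring

lemma injective_affine {q : ℝ} (hq : 0 < q) (k : ℝ) :
    Function.Injective (fun u : ℝ => q * (u + k)) := fun a b hab => by
  simpa [hq.ne'] using hab

lemma setIntegral_affine {q : ℝ} (hq : 0 < q) (k : ℝ) (F : ℝ → ℂ) :
    ∫ w in Set.Ico (q * k) (q * (k + 1)), F w = q * ∫ u in Set.Ico (0 : ℝ) 1, F (q * (u + k)) := by
  rw [← image_affine_Ico hq, integral_image_eq_integral_abs_deriv_smul measurableSet_Ico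
    (fun x _ => hasDerivWithinAt_affine q k x _) (injective_affine hq k).injOn]
  simp_rw [abs_of_pos hq, Complex.real_smul]
  rw [integral_const_mul]

lemma setLIntegral_affine {q : ℝ} (hq : 0 < q) (k : ℝ) (F : ℝ → ℝ≥0∞) :
    ∫⁻ w in Set.Ico (q * k) (q * (k + 1)), F w =
      ENNReal.ofReal q * ∫⁻ u in Set.Ico (0 : ℝ) 1, F (q * (u + k)) := by
  rw [← image_affine_Ico hq, lintegral_image_eq_lintegral_abs_deriv_mul measurableSet_Ico
    (fun x _ => hasDerivWithinAt_affine q k x _) (injective_affine hq k).injOn]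
  simp_rw [abs_of_pos hq]
  rw [lintegral_const_mul' _ _ ENNReal.ofReal_ne_top]

lemma quasiMeasurePreserving_affine {q : ℝ} (hq : 0 < q) (k : ℝ) :
    Measure.QuasiMeasurePreserving (fun u : ℝ => q * (u + k)) volume volume :=
  (Measure.quasiMeasurePreserving_smul (volume : Measure ℝ) hq.ne').comp
    (quasiMeasurePreserving_add_right volume k)

lemma memLp_affine {q : ℝ} (hq : 0 < q) (k : ℝ) {f : ℝ → ℂ}
    (hf : MemLp f 2 (volume.restrict (Set.Ico (q * k) (q * (k + 1))))) :
    MemLp (fun u => f (q * (u + k))) 2 unitMeasure := by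
  refine memLp_two_of_lintegral ?_ ?_
  · have h1 : AEStronglyMeasurable ((Set.Ico (q * k) (q * (k + 1))).indicator f) volume :=
      (aestronglyMeasurable_indicator_iff measurableSet_Ico).2 hf.1
    have h2 := h1.comp_quasiMeasurePreserving (quasiMeasurePreserving_affine hq k)
    refine (h2.mono_measure Measure.restrict_le_self).congr ?_
    refine (ae_restrict_iff' measurableSet_Ico).2 (ae_of_all _ fun u hu => ?_)
    have : q * (u + k) ∈ Set.Ico (q * k) (q * (k + 1)) := by
      rw [← image_affine_Ico hq]; exact ⟨u, hu, rfl⟩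
    simp only [Function.comp, Set.indicator_of_mem this]
  · have h := lintegral_enorm_sq_lt_top hf
    rw [setLIntegral_affine hq k] at h
    by_contra hc
    rw [not_lt, top_le_iff] at hc
    rw [hc, ENNReal.mul_top (by simpa using hq)] at h
    exact lt_irrefl _ h

lemma Ico_affine_union {q : ℝ} (hq : 0 < q) (a : ℝ) (n : ℕ) :
    Set.Ico (q * a) (q * (a + (n + 1 : ℕ))) =
      Set.Ico (q * a) (q * (a + n)) ∪ Set.Ico (q * (a + n)) (q * (a + n + 1)) := by
  rw [Set.Ico_union_Ico_eq_Ico]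
  · push_cast; ring_nf
  · exact mul_le_mul_of_nonneg_left (by linarith [(Nat.cast_nonneg n : (0 : ℝ) ≤ n)]) hq.le
  · exact mul_le_mul_of_nonneg_left (by linarith) hq.le

lemma disjoint_Ico_affine (q a : ℝ) (n : ℕ) :
    Disjoint (Set.Ico (q * a) (q * (a + n))) (Set.Ico (q * (a + n)) (q * (a + n + 1))) :=
  Set.disjoint_left.2 fun _ hx hy => not_lt.2 hy.1 hx.2

/-- Used with q = 1/N to fold the unit interval, and with q = 1 to cut spectra at the integers. -/
lemma setLIntegral_pieces {q : ℝ} (hq : 0 < q) (a : ℝ) (n : ℕ) (F : ℝ → ℝ≥0∞) :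
    ∫⁻ w in Set.Ico (q * a) (q * (a + n)), F w =
      ENNReal.ofReal q * ∑ k : Fin n, ∫⁻ u in Set.Ico (0 : ℝ) 1, F (q * (u + (a + (k : ℕ)))) := by
  rw [Fin.sum_univ_eq_sum_range (fun k => ∫⁻ u in Set.Ico (0 : ℝ) 1, F (q * (u + (a + k))))]
  induction n with
  | zero => simp
  | succ n ih =>
    rw [Ico_affine_union hq, lintegral_union measurableSet_Ico (disjoint_Ico_affine q a n), ih,
      setLIntegral_affine hq, Finset.sum_range_succ, mul_add]

lemma setIntegral_pieces {q : ℝ} (hq : 0 < q) (a : ℝ) (n : ℕ) (F : ℝ → ℂ)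
    (hF : IntegrableOn F (Set.Ico (q * a) (q * (a + n)))) :
    ∫ w in Set.Ico (q * a) (q * (a + n)), F w =
      q * ∑ k : Fin n, ∫ u in Set.Ico (0 : ℝ) 1, F (q * (u + (a + (k : ℕ)))) := by
  rw [Fin.sum_univ_eq_sum_range (fun k => ∫ u in Set.Ico (0 : ℝ) 1, F (q * (u + (a + k))))]
  induction n with
  | zero => simp
  | succ n ih =>
    rw [Ico_affine_union hq] at hF ⊢
    rw [setIntegral_union (disjoint_Ico_affine q a n) measurableSet_Ico hF.left_of_union
      hF.right_of_union, ih hF.left_of_union, setIntegral_affine hq, Finset.sum_range_succ, mul_add]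

lemma Ico_piece_subset {q : ℝ} (hq : 0 < q) (a : ℝ) {n : ℕ} (k : Fin n) :
    Set.Ico (q * (a + (k : ℕ))) (q * (a + (k : ℕ) + 1)) ⊆ Set.Ico (q * a) (q * (a + n)) := by
  have h : ((k : ℕ) : ℝ) + 1 ≤ n := by exact_mod_cast k.2
  apply Set.Ico_subset_Ico
  · exact mul_le_mul_of_nonneg_left (by linarith [(Nat.cast_nonneg (k : ℕ) : (0 : ℝ) ≤ (k : ℕ))])
      hq.le
  · exact mul_le_mul_of_nonneg_left (by linarith) hq.le

lemma memLp_piece {q : ℝ} (hq : 0 < q) (a : ℝ) {n : ℕ} {f : ℝ → ℂ}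
    (hf : MemLp f 2 (volume.restrict (Set.Ico (q * a) (q * (a + n))))) (k : Fin n) :
    MemLp (fun u => f (q * (u + (a + (k : ℕ))))) 2 unitMeasure :=
  memLp_affine hq _ (hf.mono_measure (Measure.restrict_mono (Ico_piece_subset hq a k) le_rfl))

/-! ### Critical sampling on the unit interval -/

/-- A subset of the unit interval for which there is a sampling set of integers of density equal to
its measure. -/
def HasCriticalSampling (A : Set ℝ) : Prop :=
  ∃ Λ : Set ℤ, Samples Λ A ∧ UniformDensity (((↑) : ℤ → ℝ) '' Λ) (volume.real A)

end CTVGS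

namespace CTVGS

/-! ### Frequency-dependent finite sets: measurability and counting. -/

lemma Samples.mono {Λ : Set ℤ} {A B : Set ℝ} (h : Samples Λ A)
    (hBA : ∀ u ∈ Set.Ico (0 : ℝ) 1, u ∈ B → u ∈ A) : Samples Λ B := by
  obtain ⟨C, hC⟩ := h
  exact ⟨C, fun f hf hB => hC f hf fun u hu hA => hB u hu fun h => hA (hBA u hu h)⟩

lemma measurableSet_of_finset {κ : Type*} [Fintype κ] {C : ℝ → Finset κ}
    (hC : ∀ c, MeasurableSet {u | c ∈ C u}) (P : Finset κ → Prop) :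
    MeasurableSet {u | P (C u)} := by
  classical
  have : {u | P (C u)} = ⋃ D : {D : Finset κ // P D}, ⋂ c, {u | c ∈ C u ↔ c ∈ D.1} := by
    ext u
    simp only [Set.mem_ofPred_eq, Set.mem_iUnion, Set.mem_iInter]
    constructor
    · exact fun h => ⟨⟨C u, h⟩, fun c => Iff.rfl⟩
    · rintro ⟨⟨D, hD⟩, h⟩
      have : C u = D := Finset.ext h
      rwa [this]
  rw [this]
  refine MeasurableSet.iUnion fun D => MeasurableSet.iInter fun c => ?_
  by_cases hc : c ∈ D.1
  · simpa [hc] using hC c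
  · simp only [hc, iff_false]
    exact (hC c).compl

lemma ofReal_sum_volume {ι : Type*} [Fintype ι] {S : ι → Set ℝ}
    (hS : ∀ i, MeasurableSet (S i)) :
    ENNReal.ofReal (∑ i, volume.real (S i ∩ Set.Ico 0 1)) =
      ∫⁻ u in Set.Ico (0 : ℝ) 1, ({i | u ∈ S i}.ncard : ℝ≥0∞) := by
  classical
  have h1 : ∀ u, ({i | u ∈ S i}.ncard : ℝ≥0∞) = ∑ i, (S i).indicator 1 u := by
    intro u
    have : {i | u ∈ S i} = ((Finset.univ.filter fun i => u ∈ S i : Finset ι) : Set ι) := by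
      ext i; simp
    rw [this, Set.ncard_coe_finset, Finset.card_filter]
    push_cast
    exact Finset.sum_congr rfl fun i _ => by simp [Set.indicator]
  simp_rw [h1]
  rw [lintegral_finsetSum _ fun i _ => measurable_one.indicator (hS i),
    ENNReal.ofReal_sum_of_nonneg fun i _ => measureReal_nonneg]
  refine Finset.sum_congr rfl fun i _ => ?_
  rw [lintegral_indicator_one (hS i), Measure.restrict_apply (hS i),
    ofReal_measureReal (((measure_mono Set.inter_subset_right).trans_lt (by simp)).ne)]

/-- Both sums are integrals of counting functions. This turns the pointwise rank count into an
identity of densities. -/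
lemma sum_volume_eq_of_ncard_eq {ι κ : Type*} [Fintype ι] [Fintype κ] {S : ι → Set ℝ}
    {T : κ → Set ℝ} (hS : ∀ i, MeasurableSet (S i)) (hT : ∀ c, MeasurableSet (T c))
    (h : ∀ u ∈ Set.Ico (0 : ℝ) 1, {i | u ∈ S i}.ncard = {c | u ∈ T c}.ncard) :
    ∑ i, volume.real (S i ∩ Set.Ico 0 1) = ∑ c, volume.real (T c ∩ Set.Ico 0 1) := by
  have h2 : ENNReal.ofReal (∑ i, volume.real (S i ∩ Set.Ico 0 1)) =
      ENNReal.ofReal (∑ c, volume.real (T c ∩ Set.Ico 0 1)) := by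
    rw [ofReal_sum_volume hS, ofReal_sum_volume hT]
    refine setLIntegral_congr_fun measurableSet_Ico fun u hu => ?_
    simp only [h u hu]
  rwa [ENNReal.ofReal_eq_ofReal_iff (Finset.sum_nonneg fun _ _ => measureReal_nonneg)
    (Finset.sum_nonneg fun _ _ => measureReal_nonneg)] at h2

/-! ### Folding -/

/-- The matrix of the discrete Fourier transform. -/
noncomputable def dft (N : ℕ) : Matrix (Fin N) (Fin N) ℂ :=
  Matrix.of fun s k => ex ((s : ℕ) * ((k : ℕ) / N))

lemma ex_div_injective (N : ℕ) : Function.Injective (fun k : Fin N => ex ((k : ℕ) / N)) := by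
  intro k l hkl
  have hN : (0 : ℝ) < N := by exact_mod_cast k.pos
  have h1 : ex ((k : ℕ) / N - (l : ℕ) / N) = 1 := by
    have h2 : ex ((k : ℕ) / N) = ex ((k : ℕ) / N - (l : ℕ) / N) * ex ((l : ℕ) / N) := by
      rw [← ex_add, sub_add_cancel]
    simp only at hkl
    rw [hkl] at h2
    exact mul_right_cancel₀ (ex_ne_zero _) (by rw [one_mul]; exact h2.symm)
  obtain ⟨n, hn⟩ := ex_eq_one_iff.1 h1
  have h3 : ((k : ℕ) : ℝ) - (l : ℕ) = n * N := by
    field_simp at hn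
    linarith
  have h4 : ((k : ℕ) : ℤ) - (l : ℕ) = n * N := by exact_mod_cast h3
  have hk := k.2
  have hl := l.2
  -- Since |k - l| < N, the only possible multiple of N is 0.
  have h5 : n = 0 := by
    by_contra h0
    rcases lt_or_gt_of_ne h0 with h | h
    · nlinarith
    · nlinarith
  rw [h5] at h4
  exact Fin.ext (by omega)

lemma dft_apply (N : ℕ) (s k : Fin N) : dft N s k = ex ((k : ℕ) / N) ^ (s : ℕ) := by
  rw [ex_pow]; rfl

lemma dft_mulVec_injective (N : ℕ) : Function.Injective (dft N).mulVec := by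
  have h : dft N = (Matrix.vandermonde fun k : Fin N => ex ((k : ℕ) / N)).transpose := by
    ext s k
    rw [dft_apply, Matrix.transpose_apply, Matrix.vandermonde_apply]
  rw [Matrix.mulVec_injective_iff_isUnit, Matrix.isUnit_iff_isUnit_det, h, Matrix.det_transpose,
    isUnit_iff_ne_zero, Matrix.det_vandermonde_ne_zero_iff]
  exact ex_div_injective N

/-- On the columns in `C`, row s lists the values of X^s at |C| distinct nodes. If it were a
combination of earlier rows, a monic polynomial of degree s would vanish at all the nodes, which is
impossible for s < |C|. So the first |C| rows are greedy, and the rank count leaves no room for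
others. -/
lemma greedyRows_dft {N : ℕ} (C : Finset (Fin N)) :
    greedyRows (dft N) C = {s : Fin N | (s : ℕ) < C.card} := by
  classical
  symm
  apply Set.eq_of_subset_of_ncard_le
  · intro s hs
    simp only [Set.mem_ofPred_eq] at hs
    have key : ∀ v ∈ Submodule.span ℂ (restrictedRow (dft N) C '' {r | r < s}),
        ∃ p : Polynomial ℂ, p.degree < (s : ℕ) ∧ ∀ c : C, p.eval (ex ((c : Fin N) / N)) = v c := by
      intro v hv
      induction hv using Submodule.span_induction with
      | mem v hv =>
        obtain ⟨r, hr, rfl⟩ := hv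
        refine ⟨Polynomial.X ^ (r : ℕ), ?_, fun c => ?_⟩
        · rw [Polynomial.degree_X_pow]
          exact_mod_cast hr
        · simp [restrictedRow, dft_apply]
      | zero => exact ⟨0, by simp, by simp⟩
      | add v w _ _ hv hw =>
        obtain ⟨p, hp, hp'⟩ := hv
        obtain ⟨q, hq, hq'⟩ := hw
        exact ⟨p + q, (Polynomial.degree_add_le _ _).trans_lt (max_lt hp hq), fun c => by
          simp [hp', hq']⟩
      | smul a v _ hv =>
        obtain ⟨p, hp, hp'⟩ := hv
        exact ⟨a • p, (Polynomial.degree_smul_le _ _).trans_lt hp, fun c => by simp [hp']⟩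
    intro hmem
    obtain ⟨p, hp, hp'⟩ := key _ hmem
    have h1 := Polynomial.monic_X_pow_sub (p := p) (n := (s : ℕ)) hp
    have h2 : (Polynomial.X ^ (s : ℕ) - p).natDegree ≤ (s : ℕ) := by
      refine Polynomial.natDegree_le_of_degree_le ?_
      refine (Polynomial.degree_sub_le _ _).trans (max_le ?_ hp.le)
      rw [Polynomial.degree_X_pow]
    have h3 := Polynomial.eq_zero_of_natDegree_lt_card_of_eval_eq_zero'
      (Polynomial.X ^ (s : ℕ) - p) (C.image fun k : Fin N => ex ((k : ℕ) / N)) (by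
        intro i hi
        obtain ⟨c, hc, rfl⟩ := Finset.mem_image.1 hi
        have := hp' ⟨c, hc⟩
        simp only [Polynomial.eval_sub, Polynomial.eval_pow, Polynomial.eval_X]
        rw [this]
        simp [restrictedRow, dft_apply]) (by
        rw [Finset.card_image_of_injective _ (ex_div_injective N)]
        omega)
    exact h1.ne_zero h3
  · rw [ncard_greedyRows _ (dft_mulVec_injective N)]
    have hle : C.card ≤ N := by simpa using Finset.card_le_univ C
    have : {s : Fin N | (s : ℕ) < C.card} =
        Set.range (Fin.castLE hle) := by
      rw [Fin.range_castLE]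
    rw [this, ← Set.image_univ, Set.ncard_image_of_injective _ (Fin.castLE_injective hle)]
    simp
  · exact Set.toFinite _

/-- The indices `k` such that `(u + k) / N ∈ A`. -/
noncomputable def foldFiber (A : Set ℝ) (N : ℕ) (u : ℝ) : Finset (Fin N) :=
  open Classical in Finset.univ.filter fun k => (N : ℝ)⁻¹ * (u + (0 + (k : ℕ))) ∈ A

lemma mem_foldFiber {A : Set ℝ} {N : ℕ} {u : ℝ} {k : Fin N} :
    k ∈ foldFiber A N u ↔ (N : ℝ)⁻¹ * (u + (0 + (k : ℕ))) ∈ A := by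
  simp [foldFiber]

lemma measurableSet_mem_foldFiber {A : Set ℝ} (hA : MeasurableSet A) (N : ℕ) (k : Fin N) :
    MeasurableSet {u | k ∈ foldFiber A N u} := by
  simp only [mem_foldFiber]
  exact hA.preimage (by fun_prop)

lemma sum_volume_foldFiber {A : Set ℝ} (hA : MeasurableSet A) (hA1 : A ⊆ Set.Ico 0 1) {N : ℕ}
    (hN : 0 < N) : ∑ k : Fin N, volume.real ({u | k ∈ foldFiber A N u} ∩ Set.Ico 0 1) =
      N * volume.real A := by
  have hq : (0 : ℝ) < (N : ℝ)⁻¹ := by positivity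
  have h1 := setLIntegral_pieces hq 0 N (A.indicator 1)
  have h2 : Set.Ico ((N : ℝ)⁻¹ * 0) ((N : ℝ)⁻¹ * (0 + N)) = Set.Ico 0 1 := by
    rw [mul_zero, zero_add, inv_mul_cancel₀ (by positivity)]
  rw [h2, lintegral_indicator_one hA, Measure.restrict_apply hA,
    Set.inter_eq_left.2 hA1] at h1
  have h3 : ∀ k : Fin N, ∫⁻ u in Set.Ico (0 : ℝ) 1,
      A.indicator 1 ((N : ℝ)⁻¹ * (u + (0 + (k : ℕ)))) =
      volume ({u | k ∈ foldFiber A N u} ∩ Set.Ico 0 1) := by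
    intro k
    rw [← Measure.restrict_apply (measurableSet_mem_foldFiber hA N k),
      ← lintegral_indicator_one (measurableSet_mem_foldFiber hA N k)]
    refine lintegral_congr fun u => ?_
    by_cases h : k ∈ foldFiber A N u
    · rw [Set.indicator_of_mem (mem_foldFiber.1 h),
        Set.indicator_of_mem (show u ∈ {u | k ∈ foldFiber A N u} from h)]
      rfl
    · rw [Set.indicator_of_notMem (fun h' => h (mem_foldFiber.2 h')),
        Set.indicator_of_notMem (show u ∉ {u | k ∈ foldFiber A N u} from h)]
  simp_rw [h3] at h1
  have h4 : ∀ k : Fin N, volume ({u | k ∈ foldFiber A N u} ∩ Set.Ico 0 1) ≠ ⊤ := fun k =>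
    ((measure_mono Set.inter_subset_right).trans_lt (by simp)).ne
  simp only [Measure.real]
  rw [h1, ENNReal.toReal_mul, ENNReal.toReal_ofReal hq.le, ENNReal.toReal_sum fun k _ => h4 k,
    ← mul_assoc, mul_inv_cancel₀ (by positivity), one_mul]

/-- The coefficients of f at the integers N m + s are, up to the factor N, the m-th coefficients of
row s of the DFT applied to the N pieces of f. Row s is chosen greedily exactly where the fibre has
more than s points, so elimination asks for sampling on that level set only. -/
lemma HasCriticalSampling.of_fold {A : Set ℝ} (hA : MeasurableSet A) (hA1 : A ⊆ Set.Ico 0 1)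
    {N : ℕ} (hN : 0 < N)
    (h : ∀ s : Fin N, HasCriticalSampling {u | s < (foldFiber A N u).card ∧ u ∈ Set.Ico 0 1}) :
    HasCriticalSampling A := by
  choose Λ hΛ hD using h
  have hq : (0 : ℝ) < (N : ℝ)⁻¹ := by positivity
  have hN0 : (N : ℝ) ≠ 0 := by positivity
  have hmod : ∀ (s t : Fin N) (m l : ℤ), N * m + (s : ℕ) = N * l + (t : ℕ) → s = t ∧ m = l := by
    intro s t m l h
    have hs := s.2
    have ht := t.2
    have h1 : m = l := by
      have h2 : (N : ℤ) * (m - l) = (t : ℕ) - (s : ℕ) := by linarith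
      by_contra hne
      rcases lt_or_gt_of_ne hne with h' | h'
      · nlinarith
      · nlinarith
    subst h1
    exact ⟨Fin.ext (by omega), rfl⟩
  have hmeas := measurableSet_mem_foldFiber hA N
  refine ⟨⋃ s : Fin N, (fun m : ℤ => (N : ℤ) * m + (s : ℕ)) '' Λ s, ?_, ?_⟩
  · obtain ⟨K, hK⟩ := exists_elimination_bound (dft N) (dft_mulVec_injective N) (foldFiber A N)
      (fun s u => ex ((s : ℕ) * u / N)) (fun s u => enorm_ex _)
      (fun s => continuous_ex.comp (by fun_prop)) Λ
      (fun s => measurableSet_of_finset hmeas fun C => s ∈ greedyRows (dft N) C) (fun s => by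
        refine (hΛ s).mono fun u hu h => ⟨?_, hu⟩
        rw [Set.mem_ofPred_eq, greedyRows_dft] at h
        exact h)
    refine ⟨K * N, fun f hf hfA => ?_⟩
    have h2 : Set.Ico ((N : ℝ)⁻¹ * 0) ((N : ℝ)⁻¹ * (0 + N)) = Set.Ico 0 1 := by
      rw [mul_zero, zero_add, inv_mul_cancel₀ (by positivity)]
    set x : Fin N → ℝ → ℂ := fun k u => f ((N : ℝ)⁻¹ * (u + (0 + (k : ℕ)))) with hx
    have hf' : MemLp f 2 (volume.restrict (Set.Ico ((N : ℝ)⁻¹ * 0) ((N : ℝ)⁻¹ * (0 + N)))) := by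
      rwa [h2]
    have hxm : ∀ k, MemLp (x k) 2 unitMeasure := memLp_piece hq 0 hf'
    have hE : energy f = ENNReal.ofReal (N : ℝ)⁻¹ * ∑ k, energy (x k) := by
      have := setLIntegral_pieces hq 0 N (fun w => ‖f w‖ₑ ^ 2)
      rw [h2] at this
      exact this
    -- With w = (u + k)/N, the phase (N m + s) w is the sum of m u, s u/N, s k/N and the integer m
    -- k, which drops out.
    have hfi : ∀ (s : Fin N) (m : ℤ),
        fint (fun u => ex ((s : ℕ) * u / N) * ∑ k, dft N s k * x k u) m =
          N * fint f ((N * m + (s : ℕ) : ℤ) : ℝ) := by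
      intro s m
      have h3 := setIntegral_pieces hq 0 N (fun w => f w * ex (((N * m + (s : ℕ) : ℤ) : ℝ) * w))
        (by rw [h2]; exact integrable_mul_ex hf.integrable_unit _)
      rw [h2] at h3
      simp only [fint]
      rw [h3, ← mul_assoc]
      push_cast
      rw [mul_inv_cancel₀ (by exact_mod_cast hN0), one_mul, ← integral_finsetSum]
      · refine integral_congr_ae (ae_of_all _ fun u => ?_)
        simp only [Finset.mul_sum, Finset.sum_mul]
        refine Finset.sum_congr rfl fun k _ => ?_
        have : ex ((N * m + (s : ℕ)) * ((N : ℝ)⁻¹ * (u + (0 + (k : ℕ))))) =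
            ex (m * u) * ex ((s : ℕ) * u / N) * dft N s k := by
          have h5 : (N * m + (s : ℕ)) * ((N : ℝ)⁻¹ * (u + (0 + (k : ℕ)))) =
            m * u + (s : ℕ) * u / N + (s : ℕ) * ((k : ℕ) / N) + ((m * (k : ℕ) : ℤ) : ℝ) := by
            push_cast
            field_simp
            ring
          rw [h5, ex_add, ex_intCast, mul_one, ex_add, ex_add]
          rfl
        rw [this]
        simp only [hx]
        ring
      · intro k _
        have h4 := memLp_piece hq 0 hf' k
        have h5 := integrable_mul_ex h4.integrable_unit
          (((N * m + (s : ℕ) : ℝ)) * (N : ℝ)⁻¹)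
        refine (h5.mul_const (ex (((N * m + (s : ℕ) : ℝ)) * (N : ℝ)⁻¹ * (k : ℕ)))).congr
          (ae_of_all _ fun u => ?_)
        simp only [mul_assoc, ← ex_add]
        congr 2
        ring
    have h6 := hK x hxm fun u hu k hk => by
      rw [mem_foldFiber] at hk
      refine hfA _ ?_ hk
      rw [← h2]
      refine Ico_piece_subset hq 0 k ?_
      rw [← image_affine_Ico hq]
      exact ⟨u, hu, rfl⟩
    simp only [hfi, enorm_mul, mul_pow, ENNReal.tsum_mul_left, ← Finset.mul_sum] at h6
    have h7 : ∑ s, ∑' m : Λ s, ‖fint f ((N * (m : ℤ) + (s : ℕ) : ℤ) : ℝ)‖ₑ ^ 2 ≤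
        ∑' n : (⋃ s : Fin N, (fun m : ℤ => (N : ℤ) * m + (s : ℕ)) '' Λ s : Set ℤ),
          ‖fint f (n : ℤ)‖ₑ ^ 2 := by
      rw [← tsum_fintype (L := SummationFilter.unconditional _), ← ENNReal.tsum_sigma
        (fun s (m : Λ s) => ‖fint f ((N * (m : ℤ) + (s : ℕ) : ℤ) : ℝ)‖ₑ ^ 2)]
      have hinj : Function.Injective (fun p : Σ s, Λ s =>
          (⟨N * (p.2 : ℤ) + (p.1 : ℕ), Set.mem_iUnion.2 ⟨p.1, p.2, p.2.2, rfl⟩⟩ :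
            (⋃ s : Fin N, (fun m : ℤ => (N : ℤ) * m + (s : ℕ)) '' Λ s : Set ℤ))) := by
        rintro ⟨s, m, hm⟩ ⟨t, l, hl⟩ h
        simp only [Subtype.mk.injEq] at h
        obtain ⟨rfl, rfl⟩ := hmod _ _ _ _ h
        rfl
      exact ENNReal.tsum_comp_le_tsum_of_injective hinj
        (fun n : (⋃ s : Fin N, (fun m : ℤ => (N : ℤ) * m + (s : ℕ)) '' Λ s : Set ℤ) =>
          ‖fint f (n : ℤ)‖ₑ ^ 2)
    have h8 : ‖(N : ℂ)‖ₑ = N := by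
      rw [← ofReal_norm]; simp
    rw [h8] at h6
    rw [hE]
    calc ENNReal.ofReal (N : ℝ)⁻¹ * ∑ k, energy (x k) ≤ ENNReal.ofReal (N : ℝ)⁻¹ *
          (K * ((N : ℝ≥0∞) ^ 2 * ∑ s, ∑' m : Λ s,
            ‖fint f ((N * (m : ℤ) + (s : ℕ) : ℤ) : ℝ)‖ₑ ^ 2)) := by gcongr
      _ = (K * N : ℝ≥0) * ∑ s, ∑' m : Λ s,
            ‖fint f ((N * (m : ℤ) + (s : ℕ) : ℤ) : ℝ)‖ₑ ^ 2 := by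
          have h9 : ENNReal.ofReal (N : ℝ)⁻¹ * N = 1 := by
            rw [← ENNReal.ofReal_natCast, ← ENNReal.ofReal_mul hq.le, inv_mul_cancel₀ hN0,
              ENNReal.ofReal_one]
          push_cast
          calc _ = (ENNReal.ofReal (N : ℝ)⁻¹ * N) * (K * N * ∑ s, ∑' m : Λ s,
            ‖fint f ((N * (m : ℤ) + (s : ℕ) : ℤ) : ℝ)‖ₑ ^ 2) := by push_cast; ring
            _ = _ := by rw [h9, one_mul]; push_cast; rfl
      _ ≤ _ := by gcongr
  · have h1 : ((↑) : ℤ → ℝ) '' (⋃ s : Fin N, (fun m : ℤ => (N : ℤ) * m + (s : ℕ)) '' Λ s) =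
        ⋃ s : Fin N, (fun x : ℝ => N * x + (s : ℕ)) '' (((↑) : ℤ → ℝ) '' Λ s) := by
      rw [Set.image_iUnion]
      refine Set.iUnion_congr fun s => ?_
      rw [Set.image_image, Set.image_image]
      refine Set.image_congr fun m _ => ?_
      push_cast
      rfl
    -- At each u as many levels are exceeded as the fibre has points, so the measures of the levels
    -- sum to N |A|; spreading over a residue class divides a density by N.
    have h2 : volume.real A = ∑ s : Fin N,
        volume.real {u | s < (foldFiber A N u).card ∧ u ∈ Set.Ico 0 1} / N := by
      rw [← Finset.sum_div, eq_div_iff hN0, mul_comm, ← sum_volume_foldFiber hA hA1 hN]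
      symm
      refine sum_volume_eq_of_ncard_eq (S := fun s : Fin N => {u | s < (foldFiber A N u).card})
        (fun s => measurableSet_of_finset hmeas fun C => s < C.card) hmeas fun u _ => ?_
      have h3 := ncard_greedyRows _ (dft_mulVec_injective N) (foldFiber A N u)
      rw [greedyRows_dft] at h3
      refine h3.trans ?_
      rw [← Set.ncard_coe_finset]
      rfl
    rw [h1, h2]
    refine UniformDensity.iUnion (fun s => (hD s).affine (by positivity) _) ?_
    intro s t hst
    refine Set.disjoint_left.2 ?_
    rintro _ ⟨_, ⟨m, _, rfl⟩, rfl⟩ ⟨_, ⟨l, _, rfl⟩, h⟩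
    have h' : (N : ℤ) * l + (t : ℕ) = N * m + (s : ℕ) := by
      simp only at h
      exact_mod_cast h
    exact hst (hmod _ _ _ _ h').1.symm

end CTVGS

namespace CTVGS

/-! ### Short arcs -/

lemma hasDerivAt_ex_mul (v s : ℝ) :
    HasDerivAt (fun s : ℝ => ex (s * v)) (2 * Real.pi * Complex.I * v * ex (s * v)) s := by
  unfold ex
  have h1 : HasDerivAt (fun s : ℝ => (2 * Real.pi * Complex.I * ((s * v : ℝ) : ℂ)))
      (2 * Real.pi * Complex.I * v) s := by
    have h2 : HasDerivAt (fun s : ℝ => ((s * v : ℝ) : ℂ)) (v : ℂ) s := by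
      have := (HasDerivAt.ofReal_comp (hasDerivAt_id s)).mul_const (v : ℂ)
      simpa using this
    exact h2.const_mul _
  refine h1.cexp.congr_deriv ?_
  ring

lemma ex_mul_sub_one (d v : ℝ) :
    ex (d * v) - 1 = ∫ s in (0 : ℝ)..d, 2 * Real.pi * Complex.I * v * ex (s * v) := by
  rw [intervalIntegral.integral_eq_sub_of_hasDerivAt (f := fun s => ex (s * v))]
  · simp [ex_zero]
  · exact fun s _ => hasDerivAt_ex_mul v s
  · refine Continuous.intervalIntegrable ?_ _ _
    exact continuous_const.mul (continuous_ex.comp (by fun_prop))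

lemma sq_lintegral_le {μ : Measure ℝ} [IsProbabilityMeasure μ] {g : ℝ → ℝ≥0∞}
    (hg : AEMeasurable g μ) : (∫⁻ s, g s ∂μ) ^ 2 ≤ ∫⁻ s, g s ^ 2 ∂μ := by
  have h := ENNReal.lintegral_mul_le_Lp_mul_Lq μ (p := 2) (q := 2)
    (by constructor <;> norm_num) hg (aemeasurable_const (b := (1 : ℝ≥0∞)))
  simp only [Pi.mul_apply, mul_one, ENNReal.one_rpow, lintegral_const, measure_univ] at h
  calc (∫⁻ s, g s ∂μ) ^ 2 ≤ ((∫⁻ s, g s ^ (2 : ℝ) ∂μ) ^ (1 / (2 : ℝ))) ^ 2 := by gcongr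
    _ = ∫⁻ s, g s ^ 2 ∂μ := by
      rw [← ENNReal.rpow_natCast, ← ENNReal.rpow_mul]
      norm_num

lemma le_two_mul_of_le_add_half {a b : ℝ≥0∞} (ha : a ≠ ⊤) (h : a ≤ b + a / 2) : a ≤ 2 * b := by
  have h1 : a / 2 + a / 2 ≤ b + a / 2 := by rwa [ENNReal.add_halves]
  have h2 : a / 2 ≤ b := (ENNReal.add_le_add_iff_right (ENNReal.div_ne_top ha (by norm_num))).1 h1
  calc a = 2 * (a / 2) := by rw [two_mul, ENNReal.add_halves]
    _ ≤ 2 * b := by gcongr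

/-- The difference is the integral of the t-derivative over a segment of length |d| ≤ 1/2. Enlarging
the segment to a fixed interval of length one removes the dependence on d, so that the bound can be
summed by Parseval for each s. Centring at the midpoint keeps the factor produced by the derivative
below πβ. -/
lemma interval_integral_bound {α β : ℝ} {H : ℝ → ℂ} (hHm : StronglyMeasurable H)
    (hH : MemLp H 2 (volume.restrict (Set.Ico α (α + β)))) (t d : ℝ) (hd : |d| ≤ 1 / 2) :
    ‖(∫ w in Set.Ico α (α + β), H w * ex ((t + d) * (w - (α + β / 2)))) -
        ∫ w in Set.Ico α (α + β), H w * ex (t * (w - (α + β / 2)))‖ₑ ^ 2 ≤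
      ∫⁻ s in Set.Icc (-(1 / 2) : ℝ) (1 / 2), ‖∫ w in Set.Ico α (α + β),
        H w * (2 * Real.pi * Complex.I * ((w - (α + β / 2) : ℝ) : ℂ)) *
          ex ((t + s) * (w - (α + β / 2)))‖ₑ ^ 2 := by
  set γ := α + β / 2 with hγ
  set μ := (volume : Measure ℝ).restrict (Set.Ico α (α + β)) with hμ
  have hint : Integrable H μ := hH.integrable (by norm_num)
  have hexm : ∀ r : ℝ, Continuous fun w : ℝ => ex (r * (w - γ)) := fun r =>
    continuous_ex.comp (by fun_prop)
  have hi : ∀ r : ℝ, Integrable (fun w => H w * ex (r * (w - γ))) μ := fun r =>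
    hint.mul_bdd (c := 1) (hexm r).aestronglyMeasurable (ae_of_all _ fun w => (norm_ex _).le)
  have hv : ∀ᵐ w ∂μ, ‖2 * Real.pi * Complex.I * ((w - γ : ℝ) : ℂ)‖ ≤ Real.pi * β := by
    refine (ae_restrict_iff' measurableSet_Ico).2 (ae_of_all _ fun w hw => ?_)
    simp only [norm_mul, Complex.norm_ofNat, Complex.norm_real, Complex.norm_I, mul_one,
      Real.norm_eq_abs, abs_of_pos Real.pi_pos]
    have : |w - γ| ≤ β / 2 := by
      rw [abs_le]; constructor <;> linarith [hw.1, hw.2]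
    nlinarith [Real.pi_pos]
  set K : ℝ → ℂ := fun s => ∫ w, H w * (2 * Real.pi * Complex.I * ((w - γ : ℝ) : ℂ)) *
          ex ((t + s) * (w - γ)) ∂μ with hK
  have hKm : StronglyMeasurable K := by
    apply StronglyMeasurable.integral_prod_right
    refine StronglyMeasurable.mul (StronglyMeasurable.mul (hHm.comp_measurable measurable_snd) ?_) ?_
    · exact Continuous.stronglyMeasurable (by fun_prop)
    · exact Continuous.stronglyMeasurable (continuous_ex.comp (by fun_prop))
  have hdiff : (∫ w, H w * ex ((t + d) * (w - γ)) ∂μ) - ∫ w, H w * ex (t * (w - γ)) ∂μ =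
      ∫ s in (0 : ℝ)..d, K s := by
    have : IsFiniteMeasure ((volume : Measure ℝ).restrict (Set.uIoc 0 d)) :=
      ⟨by rw [Measure.restrict_apply_univ, Set.uIoc]; exact measure_Ioc_lt_top⟩
    have hprod : Integrable (Function.uncurry fun w s : ℝ =>
        H w * (2 * Real.pi * Complex.I * ((w - γ : ℝ) : ℂ)) * ex ((t + s) * (w - γ)))
        (μ.prod (volume.restrict (Set.uIoc 0 d))) := by
      have h1 : Integrable (fun p : ℝ × ℝ => H p.1) (μ.prod (volume.restrict (Set.uIoc 0 d))) :=
        hint.comp_fst _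
      have h2 := Measure.quasiMeasurePreserving_fst (μ := μ)
        (ν := volume.restrict (Set.uIoc 0 d)) |>.ae hv
      refine (h1.mul_bdd (g := fun p : ℝ × ℝ => (2 * Real.pi * Complex.I *
        ((p.1 - γ : ℝ) : ℂ)) * ex ((t + p.2) * (p.1 - γ))) (c := Real.pi * β) ?_ ?_).congr ?_
      · exact Continuous.aestronglyMeasurable
          ((by fun_prop : Continuous fun p : ℝ × ℝ => 2 * Real.pi * Complex.I *
            ((p.1 - γ : ℝ) : ℂ)).mul (continuous_ex.comp (by fun_prop)))
      · filter_upwards [h2] with p hp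
        rw [norm_mul, norm_ex, mul_one]
        exact hp
      · exact ae_of_all _ fun p => by simp only [Function.uncurry, mul_assoc]
    have h3 : ∀ w, H w * ex ((t + d) * (w - γ)) - H w * ex (t * (w - γ)) =
        (if 0 ≤ d then (1 : ℝ) else -1) • ∫ s in Set.uIoc 0 d,
          H w * (2 * Real.pi * Complex.I * ((w - γ : ℝ) : ℂ)) * ex ((t + s) * (w - γ)) := by
      intro w
      rw [← intervalIntegral.intervalIntegral_eq_integral_uIoc]
      have h4 : ∀ s : ℝ, H w * (2 * Real.pi * Complex.I * ((w - γ : ℝ) : ℂ)) *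
          ex ((t + s) * (w - γ)) = H w * ex (t * (w - γ)) *
            (2 * Real.pi * Complex.I * ((w - γ : ℝ) : ℂ) * ex (s * (w - γ))) := by
        intro s
        rw [add_mul, ex_add]
        ring
      simp_rw [h4]
      rw [intervalIntegral.integral_const_mul, ← ex_mul_sub_one, add_mul, ex_add]
      ring
    rw [← integral_sub (hi _) (hi _)]
    simp_rw [h3]
    rw [integral_smul, integral_integral_swap hprod,
      intervalIntegral.intervalIntegral_eq_integral_uIoc]
  have hsub : Set.uIoc 0 d ⊆ Set.Icc (-(1 / 2) : ℝ) (1 / 2) := by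
    intro s hs
    rw [abs_le] at hd
    rw [Set.mem_uIoc] at hs
    rcases hs with hs | hs <;> constructor <;> linarith [hs.1, hs.2]
  have : IsProbabilityMeasure ((volume : Measure ℝ).restrict (Set.Icc (-(1 / 2) : ℝ) (1 / 2))) :=
    ⟨by rw [Measure.restrict_apply_univ, Real.volume_Icc]; norm_num⟩
  rw [hdiff]
  calc ‖∫ s in (0 : ℝ)..d, K s‖ₑ ^ 2 ≤ (∫⁻ s in Set.Icc (-(1 / 2) : ℝ) (1 / 2), ‖K s‖ₑ) ^ 2 := by
        gcongr
        calc ‖∫ s in (0 : ℝ)..d, K s‖ₑ = ‖∫ s in Set.uIoc 0 d, K s‖ₑ := by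
              rw [← ofReal_norm, intervalIntegral.norm_intervalIntegral_eq, ofReal_norm]
          _ ≤ ∫⁻ s in Set.uIoc 0 d, ‖K s‖ₑ := enorm_integral_le_lintegral_enorm _
          _ ≤ _ := lintegral_mono_set hsub
    _ ≤ _ := sq_lintegral_le hKm.enorm.aemeasurable

/-- The frequencies n/β give an orthogonal basis on the interval, and rounding moves each by at most
1/2. By Parseval the total squared error is at most (πβ)² times the energy term on the left. For β ≤
1/10, twice this is less than half of that term and can be absorbed, which leaves the constant 4. -/
lemma short_interval_bound {α β : ℝ} (hβ : 0 < β) (hβ1 : β ≤ 1 / 10) {H : ℝ → ℂ}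
    (hHm : StronglyMeasurable H) (hH : MemLp H 2 (volume.restrict (Set.Ico α (α + β)))) :
    ENNReal.ofReal β * ∫⁻ w in Set.Ico α (α + β), ‖H w‖ₑ ^ 2 ≤
      4 * ∑' n : ℤ, ‖∫ w in Set.Ico α (α + β), H w * ex ((round (n / β) : ℤ) * w)‖ₑ ^ 2 := by
  set γ := α + β / 2 with hγ
  set μ := (volume : Measure ℝ).restrict (Set.Ico α (α + β)) with hμ
  have hβ0 : β ≠ 0 := hβ.ne'
  -- recentring the frequency variable changes the integrals by unimodular factors
  have hshift : ∀ (G : ℝ → ℂ) (r : ℝ), ‖∫ w, G w * ex (r * (w - γ)) ∂μ‖ₑ =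
      ‖∫ w, G w * ex (r * w) ∂μ‖ₑ := by
    intro G r
    have h1 : ∀ w, G w * ex (r * (w - γ)) = ex (-(r * γ)) * (G w * ex (r * w)) := by
      intro w
      rw [show r * (w - γ) = -(r * γ) + r * w by ring, ex_add]
      ring
    simp_rw [h1]
    rw [integral_const_mul, enorm_mul, enorm_ex, one_mul]
  have hparseval : ∀ G : ℝ → ℂ, MemLp G 2 μ →
      ∑' n : ℤ, ‖∫ w, G w * ex (n / β * (w - γ)) ∂μ‖ₑ ^ 2 =
        ENNReal.ofReal β * ∫⁻ w, ‖G w‖ₑ ^ 2 ∂μ := by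
    intro G hG
    have h1 := parseval_Ico (a := α) (b := α + β) (by linarith) hG
    rw [add_sub_cancel_left] at h1
    rw [← h1]
    refine tsum_congr fun n => ?_
    rw [hshift]
    simp_rw [mul_div_assoc', div_mul_eq_mul_div]
    rfl
  have herr : ∑' n : ℤ, ‖(∫ w, H w * ex (round (n / β) * (w - γ)) ∂μ) -
      ∫ w, H w * ex (n / β * (w - γ)) ∂μ‖ₑ ^ 2 ≤
      ENNReal.ofReal ((Real.pi * β) ^ 2) * (ENNReal.ofReal β * ∫⁻ w, ‖H w‖ₑ ^ 2 ∂μ) := by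
    have h1 : ∀ n : ℤ, ‖(∫ w, H w * ex (round (n / β) * (w - γ)) ∂μ) -
        ∫ w, H w * ex (n / β * (w - γ)) ∂μ‖ₑ ^ 2 ≤
        ∫⁻ s in Set.Icc (-(1 / 2) : ℝ) (1 / 2), ‖∫ w,
          H w * (2 * Real.pi * Complex.I * ((w - γ : ℝ) : ℂ)) *
            ex ((n / β + s) * (w - γ)) ∂μ‖ₑ ^ 2 := by
      intro n
      have h2 := interval_integral_bound hHm hH (n / β) (round (n / β) - n / β) (by
        rw [abs_sub_comm]; exact abs_sub_round _)
      rwa [add_sub_cancel] at h2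
    have hKm : ∀ n : ℤ, StronglyMeasurable fun s : ℝ => ∫ w,
        H w * (2 * Real.pi * Complex.I * ((w - γ : ℝ) : ℂ)) *
            ex ((n / β + s) * (w - γ)) ∂μ := by
      intro n
      apply StronglyMeasurable.integral_prod_right
      refine StronglyMeasurable.mul (StronglyMeasurable.mul
        (hHm.comp_measurable measurable_snd) ?_) ?_
      · exact Continuous.stronglyMeasurable (by fun_prop)
      · exact Continuous.stronglyMeasurable (continuous_ex.comp (by fun_prop))
    have hpt : ∀ s : ℝ, ∀ w ∈ Set.Ico α (α + β),
        ‖H w * (2 * Real.pi * Complex.I * ((w - γ : ℝ) : ℂ)) * ex (s * (w - γ))‖ₑ ≤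
        ENNReal.ofReal (Real.pi * β) * ‖H w‖ₑ := by
      intro s w hw
      rw [enorm_mul, enorm_ex, mul_one, enorm_mul, mul_comm]
      gcongr
      rw [← ofReal_norm]
      apply ENNReal.ofReal_le_ofReal
      simp only [norm_mul, Complex.norm_ofNat, Complex.norm_real, Complex.norm_I, mul_one,
        Real.norm_eq_abs, abs_of_pos Real.pi_pos]
      have : |w - γ| ≤ β / 2 := by
        rw [abs_le]; constructor <;> linarith [hw.1, hw.2]
      nlinarith [Real.pi_pos]
    have hlint : ∀ s : ℝ, ∫⁻ w, ‖H w * (2 * Real.pi * Complex.I * ((w - γ : ℝ) : ℂ)) *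
        ex (s * (w - γ))‖ₑ ^ 2 ∂μ ≤
        ENNReal.ofReal ((Real.pi * β) ^ 2) * ∫⁻ w, ‖H w‖ₑ ^ 2 ∂μ := by
      intro s
      rw [← lintegral_const_mul' _ _ ENNReal.ofReal_ne_top]
      refine setLIntegral_mono_ae' measurableSet_Ico (ae_of_all _ fun w hw => ?_)
      calc _ ≤ (ENNReal.ofReal (Real.pi * β) * ‖H w‖ₑ) ^ 2 := by gcongr; exact hpt s w hw
        _ = _ := by rw [mul_pow, ENNReal.ofReal_pow (by positivity)]
    have hmem : ∀ s : ℝ, MemLp (fun w => H w * (2 * Real.pi * Complex.I * ((w - γ : ℝ) : ℂ)) *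
        ex (s * (w - γ))) 2 μ := by
      intro s
      refine memLp_two_of_lintegral ?_ ((hlint s).trans_lt
        (ENNReal.mul_lt_top ENNReal.ofReal_lt_top (lintegral_enorm_sq_lt_top hH)))
      refine ((hHm.mul ?_).mul ?_).aestronglyMeasurable
      · exact Continuous.stronglyMeasurable (by fun_prop)
      · exact Continuous.stronglyMeasurable (continuous_ex.comp (by fun_prop))
    calc _ ≤ ∑' n : ℤ, ∫⁻ s in Set.Icc (-(1 / 2) : ℝ) (1 / 2), ‖∫ w,
          H w * (2 * Real.pi * Complex.I * ((w - γ : ℝ) : ℂ)) *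
            ex ((n / β + s) * (w - γ)) ∂μ‖ₑ ^ 2 := ENNReal.tsum_le_tsum h1
      _ = ∫⁻ s in Set.Icc (-(1 / 2) : ℝ) (1 / 2), ∑' n : ℤ, ‖∫ w,
          H w * (2 * Real.pi * Complex.I * ((w - γ : ℝ) : ℂ)) *
            ex ((n / β + s) * (w - γ)) ∂μ‖ₑ ^ 2 := by
          rw [lintegral_tsum]
          exact fun n => ((hKm n).enorm.pow_const 2).aemeasurable
      _ ≤ ∫⁻ s in Set.Icc (-(1 / 2) : ℝ) (1 / 2), ENNReal.ofReal ((Real.pi * β) ^ 2) *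
          (ENNReal.ofReal β * ∫⁻ w, ‖H w‖ₑ ^ 2 ∂μ) := by
          refine lintegral_mono fun s => ?_
          have h2 := hparseval _ (hmem s)
          have h3 : ∀ n : ℤ, (∫ w, H w * (2 * Real.pi * Complex.I * ((w - γ : ℝ) : ℂ)) *
              ex (s * (w - γ)) * ex (n / β * (w - γ)) ∂μ) =
              ∫ w, H w * (2 * Real.pi * Complex.I * ((w - γ : ℝ) : ℂ)) *
              ex ((n / β + s) * (w - γ)) ∂μ := by
            intro n
            refine integral_congr_ae (ae_of_all _ fun w => ?_)
            simp only [add_mul, ex_add]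
            ring
          simp_rw [h3] at h2
          rw [h2, mul_left_comm]
          gcongr
          exact hlint s
      _ = _ := by
          rw [lintegral_const, Measure.restrict_apply_univ, Real.volume_Icc]
          norm_num
  set E := ENNReal.ofReal β * ∫⁻ w, ‖H w‖ₑ ^ 2 ∂μ with hE
  have hEtop : E ≠ ⊤ :=
    (ENNReal.mul_lt_top ENNReal.ofReal_lt_top (lintegral_enorm_sq_lt_top hH)).ne
  set S := ∑' n : ℤ, ‖∫ w, H w * ex (round (n / β) * w) ∂μ‖ₑ ^ 2 with hS
  have hle : E ≤ 2 * S + 2 * (ENNReal.ofReal ((Real.pi * β) ^ 2) * E) := by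
    rw [hE, ← hparseval H hH]
    calc ∑' n : ℤ, ‖∫ w, H w * ex (n / β * (w - γ)) ∂μ‖ₑ ^ 2 ≤
        ∑' n : ℤ, 2 * (‖∫ w, H w * ex (round (n / β) * w) ∂μ‖ₑ ^ 2 +
          ‖(∫ w, H w * ex (round (n / β) * (w - γ)) ∂μ) -
            ∫ w, H w * ex (n / β * (w - γ)) ∂μ‖ₑ ^ 2) := by
          refine ENNReal.tsum_le_tsum fun n => ?_
          rw [← hshift H, ← enorm_neg ((∫ w, H w * ex (round (n / β) * (w - γ)) ∂μ) - _)]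
          refine le_trans (le_of_eq ?_) (enorm_sq_add_le _ _)
          congr 2
          ring
      _ ≤ _ := by
          rw [ENNReal.tsum_mul_left, ENNReal.tsum_add, mul_add]
          gcongr
          rw [hparseval H hH]
          exact herr
  have hhalf : 2 * (ENNReal.ofReal ((Real.pi * β) ^ 2) * E) ≤ E / 2 := by
    have h1 : (2 : ℝ≥0∞) * ENNReal.ofReal ((Real.pi * β) ^ 2) ≤ 2⁻¹ := by
      rw [← ENNReal.ofReal_ofNat, ← ENNReal.ofReal_mul (by norm_num),
        ← ENNReal.ofReal_inv_of_pos (by norm_num)]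
      apply ENNReal.ofReal_le_ofReal
      have := Real.pi_lt_d2
      have h2 : Real.pi * β ≤ 3.15 * (1 / 10) := by
        apply mul_le_mul this.le hβ1 hβ.le (by norm_num)
      have h3 : 0 ≤ Real.pi * β := by positivity
      nlinarith
    rw [← mul_assoc, ENNReal.div_eq_inv_mul]
    gcongr
  calc E ≤ 2 * (2 * S) := le_two_mul_of_le_add_half hEtop (hle.trans (by gcongr))
    _ = 4 * S := by rw [← mul_assoc]; norm_num

/-- Points landing in `[x, y]` come from `[x - r, y + r]`, and all points of `[x + r, y - r]` land
there; each change of window costs a bounded number of points. If the smaller window is empty, the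
expected count is itself bounded. -/
lemma UniformDensity.image {Λ : Set ℝ} {d : ℝ} (h : UniformDensity Λ d) {φ : ℝ → ℝ} {r : ℝ}
    (hφ : ∀ a, |φ a - a| ≤ r) (hinj : Set.InjOn φ Λ) : UniformDensity (φ '' Λ) d := by
  obtain ⟨K, hK⟩ := h
  have hr : 0 ≤ r := (abs_nonneg _).trans (hφ 0)
  have hdr : 0 ≤ |d| * r := mul_nonneg (abs_nonneg _) hr
  have hd := neg_abs_le d
  have hd' := le_abs_self d
  refine ⟨|K| + 2 * (|d| * r), fun x y hxy => ?_⟩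
  have hKK := le_abs_self K
  have hsub : φ '' Λ ∩ Set.Icc x y ⊆ φ '' (Λ ∩ Set.Icc (x - r) (y + r)) := by
    rintro _ ⟨⟨a, ha, rfl⟩, h1, h2⟩
    have := abs_le.1 (hφ a)
    exact ⟨a, ⟨ha, by linarith, by linarith⟩, rfl⟩
  obtain ⟨hf, hc⟩ := hK (x - r) (y + r) (by linarith)
  have hfin : (φ '' Λ ∩ Set.Icc x y).Finite := (hf.image φ).subset hsub
  refine ⟨hfin, ?_⟩
  have hupper : ((φ '' Λ ∩ Set.Icc x y).ncard : ℝ) ≤ (Λ ∩ Set.Icc (x - r) (y + r)).ncard := by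
    exact_mod_cast (Set.ncard_le_ncard hsub (hf.image φ)).trans (Set.ncard_image_le hf)
  rw [abs_le] at hc ⊢
  constructor
  · by_cases hxy' : x + r ≤ y - r
    · obtain ⟨hf', hc'⟩ := hK (x + r) (y - r) hxy'
      have hsub' : φ '' (Λ ∩ Set.Icc (x + r) (y - r)) ⊆ φ '' Λ ∩ Set.Icc x y := by
        rintro _ ⟨a, ⟨ha, h1, h2⟩, rfl⟩
        have := abs_le.1 (hφ a)
        exact ⟨⟨a, ha, rfl⟩, by linarith, by linarith⟩
      have hlower : ((Λ ∩ Set.Icc (x + r) (y - r)).ncard : ℝ) ≤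
          (φ '' Λ ∩ Set.Icc x y).ncard := by
        rw [← Set.InjOn.ncard_image (hinj.mono Set.inter_subset_left)]
        exact_mod_cast Set.ncard_le_ncard hsub' hfin
      rw [abs_le] at hc'
      nlinarith
    · have h1 : d * (y - x) ≤ 2 * (|d| * r) := by
        calc d * (y - x) ≤ |d| * (y - x) := by gcongr
          _ ≤ |d| * (2 * r) := by gcongr; linarith
          _ = _ := by ring
      have : (0 : ℝ) ≤ (φ '' Λ ∩ Set.Icc x y).ncard := by positivity
      linarith [abs_nonneg K]
  · nlinarith

/-! ### The unit interval as a circle, cut at an arbitrary point. -/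

lemma setLIntegral_fract (F : ℝ → ℝ≥0∞) (α : ℝ) :
    ∫⁻ w in Set.Ico α (α + 1), F (Int.fract w) = ∫⁻ w in Set.Ico (0 : ℝ) 1, F w := by
  have hper : Function.Periodic (fun w => F (Int.fract w)) 1 := fun w => by
    simp [Int.fract_add_one]
  have h1 := AddCircle.lintegral_preimage (1 : ℝ) α hper.lift
  have h2 := AddCircle.lintegral_preimage (1 : ℝ) 0 hper.lift
  simp only [Function.Periodic.lift_coe, zero_add] at h1 h2
  rw [restrict_Ico_eq_Ioc, h1, ← h2, ← restrict_Ico_eq_Ioc]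
  refine setLIntegral_congr_fun measurableSet_Ico fun w hw => ?_
  simp only [Int.fract_eq_self.2 hw]

lemma setIntegral_fract (F : ℝ → ℂ) (α : ℝ) :
    ∫ w in Set.Ico α (α + 1), F (Int.fract w) = ∫ w in Set.Ico (0 : ℝ) 1, F w := by
  have hper : Function.Periodic (fun w => F (Int.fract w)) 1 := fun w => by
    simp [Int.fract_add_one]
  have h1 := AddCircle.integral_preimage (1 : ℝ) α hper.lift
  have h2 := AddCircle.integral_preimage (1 : ℝ) 0 hper.lift
  simp only [Function.Periodic.lift_coe, zero_add] at h1 h2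
  rw [restrict_Ico_eq_Ioc, h1, ← h2, ← restrict_Ico_eq_Ioc]
  refine setIntegral_congr_fun measurableSet_Ico fun w hw => ?_
  simp only [Int.fract_eq_self.2 hw]

lemma ex_mul_fract (n : ℤ) (w : ℝ) : ex (n * Int.fract w) = ex (n * w) := by
  have : (n : ℝ) * w = n * Int.fract w + ((n * ⌊w⌋ : ℤ) : ℝ) := by
    conv_lhs => rw [← Int.fract_add_floor w]
    push_cast; ring
  rw [this, ex_add, ex_intCast, mul_one]

/-- Arcs of length at most `1 / 10` admit critical sampling. -/
lemma hasCriticalSampling_arc {A : Set ℝ} (hA : MeasurableSet A) (hA1 : A ⊆ Set.Ico 0 1)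
    {α β : ℝ} (hβ : 0 < β) (hβ1 : β ≤ 1 / 10)
    (h : ∀ w ∈ Set.Ico α (α + 1), Int.fract w ∈ A ↔ w < α + β) : HasCriticalSampling A := by
  have hsub : Set.Ico α (α + β) ⊆ Set.Ico α (α + 1) := Set.Ico_subset_Ico_right (by linarith)
  have hvol : volume.real A = β := by
    have h1 := setLIntegral_fract (A.indicator 1) α
    rw [lintegral_indicator_one hA, Measure.restrict_apply hA, Set.inter_eq_left.2 hA1] at h1
    have h2 : ∫⁻ w in Set.Ico α (α + 1), A.indicator (1 : ℝ → ℝ≥0∞) (Int.fract w) =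
        ∫⁻ w in Set.Ico α (α + 1), (Set.Iio (α + β)).indicator 1 w := by
      refine setLIntegral_congr_fun measurableSet_Ico fun w hw => ?_
      by_cases hw' : w < α + β
      · rw [Set.indicator_of_mem ((h w hw).2 hw'), Set.indicator_of_mem (by exact hw')]
        rfl
      · rw [Set.indicator_of_notMem (fun h' => hw' ((h w hw).1 h')),
          Set.indicator_of_notMem (by exact hw')]
    rw [h2, lintegral_indicator_one measurableSet_Iio, Measure.restrict_apply measurableSet_Iio,
      show Set.Iio (α + β) ∩ Set.Ico α (α + 1) = Set.Ico α (α + β) by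
        ext w
        simp only [Set.mem_inter_iff, Set.mem_Iio, Set.mem_Ico]
        constructor
        · rintro ⟨h1, h2, h3⟩; exact ⟨h2, h1⟩
        · rintro ⟨h1, h2⟩; exact ⟨h2, h1, by linarith⟩, Real.volume_Ico, add_sub_cancel_left] at h1
    rw [Measure.real, ← h1, ENNReal.toReal_ofReal hβ.le]
  -- Neighbouring points n/β are 1/β ≥ 10 apart, so rounding cannot merge them.
  have hrinj : Set.InjOn (fun a : ℝ => ((round a : ℤ) : ℝ))
      ((fun x => β⁻¹ * x + 0) '' Set.range ((↑) : ℤ → ℝ)) := by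
    rintro _ ⟨_, ⟨m, rfl⟩, rfl⟩ _ ⟨_, ⟨l, rfl⟩, rfl⟩ hml
    simp only [add_zero] at hml ⊢
    have h1 := abs_le.1 (abs_sub_round (β⁻¹ * (m : ℝ)))
    have h2 := abs_le.1 (abs_sub_round (β⁻¹ * (l : ℝ)))
    rw [hml] at h1
    have h3 : β⁻¹ * |(m : ℝ) - l| ≤ 1 := by
      rw [← abs_of_pos (inv_pos.2 hβ), ← abs_mul, mul_sub, abs_le]
      constructor <;> linarith [h1.1, h1.2, h2.1, h2.2]
    have h4 : |(m : ℝ) - l| ≤ β := by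
      rwa [inv_mul_le_iff₀ hβ, mul_one] at h3
    have h5 : |m - l| < 1 := by
      have : ((|m - l| : ℤ) : ℝ) < 1 := by push_cast; linarith
      exact_mod_cast this
    have h6 : m = l := by
      have := abs_lt.1 h5; omega
    rw [h6]
  refine ⟨Set.range fun n : ℤ => round ((n : ℝ) / β), ?_, ?_⟩
  · have hβE : ENNReal.ofReal β ≠ 0 := by simpa using hβ
    refine ⟨β⁻¹.toNNReal * 4, fun f hf hfA => ?_⟩
    -- A strongly measurable representative, as `short_interval_bound` requires, which vanishes off
    -- A at every point.
    set g := A.indicator (hf.1.mk f) with hg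
    have hgm : StronglyMeasurable g := hf.1.stronglyMeasurable_mk.indicator hA
    have hfg : f =ᵐ[unitMeasure] g := by
      filter_upwards [hf.1.ae_eq_mk, ae_restrict_mem measurableSet_Ico] with u hu hu1
      by_cases huA : u ∈ A
      · rw [hg, Set.indicator_of_mem huA, hu]
      · rw [hg, Set.indicator_of_notMem huA, hfA u hu1 huA]
    have hzero : ∀ w ∈ Set.Ico α (α + 1), w ∉ Set.Ico α (α + β) → g (Int.fract w) = 0 := by
      intro w hw hw'
      rw [hg, Set.indicator_of_notMem]
      rw [h w hw]
      exact fun h' => hw' ⟨hw.1, h'⟩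
    have henergy : energy f = ∫⁻ w in Set.Ico α (α + β), ‖g (Int.fract w)‖ₑ ^ 2 := by
      calc energy f = ∫⁻ w in Set.Ico (0 : ℝ) 1, ‖g w‖ₑ ^ 2 := by
            refine lintegral_congr_ae ?_
            filter_upwards [hfg] with u hu
            rw [hu]
        _ = ∫⁻ w in Set.Ico α (α + 1), ‖g (Int.fract w)‖ₑ ^ 2 :=
            (setLIntegral_fract (fun w => ‖g w‖ₑ ^ 2) α).symm
        _ = _ := by
            symm
            rw [← lintegral_indicator measurableSet_Ico, ← lintegral_indicator measurableSet_Ico]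
            refine lintegral_congr fun w => ?_
            by_cases hw' : w ∈ Set.Ico α (α + β)
            · rw [Set.indicator_of_mem hw', Set.indicator_of_mem (hsub hw')]
            · by_cases hw : w ∈ Set.Ico α (α + 1)
              · rw [Set.indicator_of_notMem hw', Set.indicator_of_mem hw, hzero w hw hw']
                simp
              · rw [Set.indicator_of_notMem hw', Set.indicator_of_notMem hw]
    have hfint : ∀ n : ℤ, fint f n = ∫ w in Set.Ico α (α + β), g (Int.fract w) * ex (n * w) := by
      intro n
      calc fint f n = ∫ w in Set.Ico (0 : ℝ) 1, g w * ex (n * w) := by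
            refine integral_congr_ae ?_
            filter_upwards [hfg] with u hu
            rw [hu]
        _ = ∫ w in Set.Ico α (α + 1), g (Int.fract w) * ex (n * w) := by
            rw [← setIntegral_fract (fun w => g w * ex (n * w)) α]
            simp only [ex_mul_fract]
        _ = _ := by
            refine setIntegral_eq_of_subset_of_forall_sdiff_eq_zero measurableSet_Ico hsub ?_
            rintro w ⟨hw, hw'⟩
            rw [hzero w hw hw', zero_mul]
    have hHm : StronglyMeasurable fun w : ℝ => g (Int.fract w) :=
      hgm.comp_measurable measurable_fract
    have hH : MemLp (fun w : ℝ => g (Int.fract w)) 2 (volume.restrict (Set.Ico α (α + β))) := by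
      refine memLp_two_of_lintegral hHm.aestronglyMeasurable ?_
      rw [← henergy]
      exact energy_lt_top hf
    have h1 := short_interval_bound hβ hβ1 hHm hH
    simp only [← hfint, ← henergy] at h1
    have hinj : Function.Injective fun n : ℤ => round ((n : ℝ) / β) := by
      intro m l hml
      have := hrinj ⟨m, ⟨m, rfl⟩, rfl⟩ ⟨l, ⟨l, rfl⟩, rfl⟩ (by
        simp only [add_zero, ← div_eq_inv_mul]
        exact_mod_cast hml)
      simpa [hβ.ne'] using this
    have h2 : ∑' n : ℤ, ‖fint f (round ((n : ℝ) / β) : ℤ)‖ₑ ^ 2 =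
        ∑' n : (Set.range fun n : ℤ => round ((n : ℝ) / β)), ‖fint f (n : ℤ)‖ₑ ^ 2 :=
      (tsum_range (fun m : ℤ => ‖fint f m‖ₑ ^ 2) hinj).symm
    rw [h2] at h1
    have h3 : (β⁻¹.toNNReal : ℝ≥0∞) * ENNReal.ofReal β = 1 := by
      change ENNReal.ofReal β⁻¹ * ENNReal.ofReal β = 1
      rw [← ENNReal.ofReal_mul (by positivity),
        inv_mul_cancel₀ hβ.ne', ENNReal.ofReal_one]
    calc energy f = (β⁻¹.toNNReal : ℝ≥0∞) *
          (ENNReal.ofReal β * energy f) := by rw [← mul_assoc, h3, one_mul]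
      _ ≤ _ := by
        push_cast
        rw [mul_assoc]
        gcongr
  · have h1 := (uniformDensity_range_intCast.affine (p := β⁻¹) (by positivity) 0).image
      (φ := fun a => ((round a : ℤ) : ℝ)) (r := 1 / 2)
      (fun a => by rw [abs_sub_comm]; exact abs_sub_round a) hrinj
    rw [hvol]
    convert h1 using 1
    · ext z
      simp [div_eq_inv_mul]
    · simp

end CTVGS

namespace CTVGS

/-! ### Integer valued step functions -/

/-- The right continuous step function which jumps by `w e` at each `e ∈ E` and has the value `m` to
the right of all jumps. -/
noncomputable def stepFn (E : Finset ℝ) (w : ℝ → ℤ) (m : ℤ) (u : ℝ) : ℤ :=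
  m - ∑ e ∈ E with u < e, w e

/-- The jumps of `g ∘ stepFn E w m`. -/
noncomputable def compJump (g : ℤ → ℤ) (E : Finset ℝ) (w : ℝ → ℤ) (m : ℤ) (e : ℝ) : ℤ :=
  g (stepFn E w m e) - g (stepFn E w m e - w e)

lemma measurable_stepFn (E : Finset ℝ) (w : ℝ → ℤ) (m : ℤ) : Measurable (stepFn E w m) := by
  have : stepFn E w m = fun u => m - ∑ e ∈ E, (Set.Iio e).indicator (fun _ => w e) u := by
    ext u
    simp only [stepFn, Finset.sum_filter, Set.indicator, Set.mem_Iio]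
  rw [this]
  refine measurable_const.sub (Finset.measurable_sum _ fun e _ => ?_)
  exact measurable_const.indicator measurableSet_Iio

/-- The sum telescopes: each new smallest jump joins the value on its right to the value on its
left. -/
lemma sum_compJump (g : ℤ → ℤ) (E : Finset ℝ) (w : ℝ → ℤ) (m : ℤ) :
    ∑ e ∈ E, compJump g E w m e = g m - g (m - ∑ e ∈ E, w e) := by
  induction E using Finset.induction_on_min with
  | empty => simp
  | insert a E ha ih =>
    have haE : a ∉ E := fun h => lt_irrefl _ (ha a h)
    have h1 : ∀ e ∈ E, compJump g (insert a E) w m e = compJump g E w m e := by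
      intro e he
      have : (insert a E).filter (fun e' => e < e') = E.filter (fun e' => e < e') := by
        rw [Finset.filter_insert, if_neg (not_lt.2 (ha e he).le)]
      simp only [compJump, stepFn, this]
    have h2 : (insert a E).filter (fun e' => a < e') = E := by
      rw [Finset.filter_insert, if_neg (lt_irrefl a), Finset.filter_true_of_mem ha]
    rw [Finset.sum_insert haE, Finset.sum_congr rfl h1, ih, Finset.sum_insert haE]
    simp only [compJump, stepFn, h2]
    rw [sub_sub, add_comm (w a)]
    ring

/-- Only the jumps beyond u enter the value at u, and over these the telescoping sum applies. -/
lemma comp_stepFn (g : ℤ → ℤ) (E : Finset ℝ) (w : ℝ → ℤ) (m : ℤ) (u : ℝ) :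
    g (stepFn E w m u) = stepFn E (compJump g E w m) (g m) u := by
  have h1 : ∀ e ∈ E.filter (fun e => u < e),
      compJump g E w m e = compJump g (E.filter fun e => u < e) w m e := by
    intro e he
    have : (E.filter fun e => u < e).filter (fun e' => e < e') = E.filter (fun e' => e < e') := by
      ext e'
      simp only [Finset.mem_filter] at he ⊢
      constructor
      · rintro ⟨⟨h1, _⟩, h2⟩; exact ⟨h1, h2⟩
      · rintro ⟨h1, h2⟩; exact ⟨⟨h1, he.2.trans h2⟩, h2⟩
    simp only [compJump, stepFn, this]
  have h2 : stepFn E (compJump g E w m) (g m) u = g m -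
      ∑ e ∈ E with u < e, compJump g E w m e := rfl
  rw [h2, Finset.sum_congr rfl h1, sum_compJump]
  simp only [stepFn]
  ring

lemma sum_compJump_eq_zero (g : ℤ → ℤ) {E : Finset ℝ} {w : ℝ → ℤ} (m : ℤ)
    (hw : ∑ e ∈ E, w e = 0) : ∑ e ∈ E, compJump g E w m e = 0 := by
  rw [sum_compJump, hw, sub_zero, sub_self]

lemma stepFn_filter_ne_zero (E : Finset ℝ) (w : ℝ → ℤ) (m : ℤ) (u : ℝ) :
    stepFn (E.filter fun e => w e ≠ 0) w m u = stepFn E w m u := by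
  simp only [stepFn]
  congr 1
  rw [Finset.filter_comm]
  exact Finset.sum_filter_ne_zero _

/-- The value at u is the value at the last jump not beyond u. To the left of all jumps, the
vanishing total brings back the value m taken at the largest one. So the values at the jumps are all
the values. -/
lemma exists_mem_stepFn_eq {E : Finset ℝ} (hE : E.Nonempty) {w : ℝ → ℤ}
    (hw : ∑ e ∈ E, w e = 0) (m : ℤ) (u : ℝ) : ∃ e ∈ E, stepFn E w m u = stepFn E w m e := by
  by_cases h : (E.filter fun e => e ≤ u).Nonempty
  · set e := (E.filter fun e => e ≤ u).max' h with he
    have hmem := Finset.max'_mem _ h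
    rw [← he, Finset.mem_filter] at hmem
    refine ⟨e, hmem.1, ?_⟩
    simp only [stepFn]
    congr 2
    ext e'
    simp only [Finset.mem_filter, and_congr_right_iff]
    intro he'
    constructor
    · exact fun h' => hmem.2.trans_lt h'
    · intro h'
      by_contra hcon
      have h1 := Finset.le_max' (E.filter fun e => e ≤ u) e'
        (Finset.mem_filter.2 ⟨he', not_lt.1 hcon⟩)
      rw [← he] at h1
      exact absurd h' (not_lt.2 h1)
  · refine ⟨E.max' hE, Finset.max'_mem _ _, ?_⟩
    simp only [stepFn]
    congr 1
    rw [Finset.filter_true_of_mem, Finset.filter_false_of_mem, hw, Finset.sum_empty]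
    · exact fun e he => not_lt.2 (Finset.le_max' _ _ he)
    · intro e he
      by_contra hcon
      exact h ⟨e, Finset.mem_filter.2 ⟨he, not_lt.1 hcon⟩⟩

/-! ### Folding step functions -/

/-- Replacing n by n + 1 shifts the summands and exchanges n/N for (n + N)/N, so the sum grows by
one. -/
lemma sum_range_add_ediv (N : ℕ) (hN : 0 < N) (n : ℤ) :
    ∑ k ∈ Finset.range N, (n + (k : ℕ)) / (N : ℤ) = n := by
  have hstep : ∀ n : ℤ, ∑ k ∈ Finset.range N, (n + 1 + (k : ℕ)) / (N : ℤ) =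
      ∑ k ∈ Finset.range N, (n + (k : ℕ)) / (N : ℤ) + 1 := by
    intro n
    have h1 := Finset.sum_range_succ (fun k : ℕ => (n + (k : ℕ)) / (N : ℤ)) N
    rw [Finset.sum_range_succ'] at h1
    have h2 : (n + (N : ℤ)) / (N : ℤ) = n / N + 1 :=
      Int.add_ediv_of_dvd_right (dvd_refl _) |>.trans (by rw [Int.ediv_self (by omega)])
    rw [h2] at h1
    have h3 : ∀ k : ℕ, n + ((k + 1 : ℕ) : ℤ) = n + 1 + (k : ℕ) := fun k => by push_cast; ring
    simp only [h3, Nat.cast_zero, add_zero] at h1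
    linarith
  induction n with
  | zero =>
    refine Finset.sum_eq_zero fun k hk => ?_
    rw [zero_add]
    exact Int.ediv_eq_zero_of_lt (by positivity) (by exact_mod_cast Finset.mem_range.1 hk)
  | succ n ih => rw [hstep, ih]
  | pred n ih =>
    have := hstep (-(n : ℤ) - 1)
    rw [sub_add_cancel, ih] at this
    linarith

/-- Hermite's identity. -/
lemma sum_floor_add_div (N : ℕ) (hN : 0 < N) (x : ℝ) :
    ∑ k ∈ Finset.range N, ⌊(x + (k : ℕ)) / N⌋ = ⌊x⌋ := by
  rw [← sum_range_add_ediv N hN ⌊x⌋]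
  refine Finset.sum_congr rfl fun k _ => ?_
  rw [← Int.floor_add_natCast, Int.floor_div_natCast]

/-- The multiples of the jump positions modulo one. -/
noncomputable def foldSupport (E : Finset ℝ) (N : ℕ) : Finset ℝ :=
  open Classical in E.image fun e => Int.fract ((N : ℝ) * e)

/-- The jumps of a step function folded `N` times. -/
noncomputable def foldJump (E : Finset ℝ) (w : ℝ → ℤ) (N : ℕ) (e' : ℝ) : ℤ :=
  open Classical in ∑ e ∈ E with Int.fract ((N : ℝ) * e) = e', w e

/-- Jumps are grouped by their common image. A position whose jumps cancel stays in the support with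
weight zero. -/
lemma sum_foldJump_mul {R : Type*} [CommRing R] (E : Finset ℝ) (w : ℝ → ℤ) (N : ℕ) (F : ℝ → R) :
    ∑ e' ∈ foldSupport E N, (foldJump E w N e' : R) * F e' =
      ∑ e ∈ E, (w e : R) * F (Int.fract (N * e)) := by
  classical
  unfold foldSupport foldJump
  rw [← Finset.sum_fiberwise_of_maps_to (s := E) (t := E.image fun e => Int.fract ((N : ℝ) * e))
    (g := fun e => Int.fract ((N : ℝ) * e)) (fun e he => Finset.mem_image_of_mem _ he)]
  refine Finset.sum_congr rfl fun e' _ => ?_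
  push_cast
  rw [Finset.sum_mul]
  refine Finset.sum_congr (by congr) fun e he => ?_
  rw [(Finset.mem_filter.1 he).2]

lemma sum_foldJump (E : Finset ℝ) (w : ℝ → ℤ) (N : ℕ) :
    ∑ e' ∈ foldSupport E N, foldJump E w N e' = ∑ e ∈ E, w e := by
  have := sum_foldJump_mul (R := ℤ) E w N (fun _ => 1)
  simpa using this

lemma floor_sub_of_mem {u e : ℝ} (hu : u ∈ Set.Ico (0 : ℝ) 1) (he : e ∈ Set.Ico (0 : ℝ) 1) :
    ⌊u - e⌋ = -(if u < e then 1 else 0) := by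
  split_ifs with h
  · rw [Int.floor_eq_iff]
    push_cast
    constructor <;> linarith [hu.1, he.2]
  · rw [neg_zero, Int.floor_eq_zero_iff]
    constructor <;> linarith [hu.2, he.1]

lemma stepFn_eq_floor {E : Finset ℝ} (hE : ∀ e ∈ E, e ∈ Set.Ico (0 : ℝ) 1) (w : ℝ → ℤ) (m : ℤ)
    {u : ℝ} (hu : u ∈ Set.Ico (0 : ℝ) 1) : stepFn E w m u = m + ∑ e ∈ E, w e * ⌊u - e⌋ := by
  rw [stepFn, sub_eq_add_neg, Finset.sum_filter, ← Finset.sum_neg_distrib]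
  congr 1
  refine Finset.sum_congr rfl fun e he => ?_
  rw [floor_sub_of_mem hu (hE e he)]
  split_ifs <;> ring

lemma fold_mem_Ico {N : ℕ} {u : ℝ} (hu : u ∈ Set.Ico (0 : ℝ) 1) {k : ℕ} (hk : k < N) :
    (N : ℝ)⁻¹ * (u + (0 + k)) ∈ Set.Ico (0 : ℝ) 1 := by
  have hN : (0 : ℝ) < N := by exact_mod_cast (Nat.zero_le k).trans_lt hk
  have hk' : (k : ℝ) + 1 ≤ N := by exact_mod_cast hk
  have h0 := hu.1
  constructor
  · positivity
  · rw [inv_mul_lt_iff₀ hN]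
    linarith [hu.2]

/-- By Hermite's identity the N branches of the floor function at a jump e sum to ⌊u - N e⌋. So a
jump at e becomes a jump of the same size at the fractional part of N e, while the integer part ⌊N
e⌋ goes into the constant. -/
lemma exists_sum_stepFn {E : Finset ℝ} (hE : ∀ e ∈ E, e ∈ Set.Ico (0 : ℝ) 1) (w : ℝ → ℤ) (m : ℤ)
    {N : ℕ} (hN : 0 < N) : ∃ m' : ℤ, ∀ u ∈ Set.Ico (0 : ℝ) 1,
      ∑ k : Fin N, stepFn E w m ((N : ℝ)⁻¹ * (u + (0 + (k : ℕ)))) =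
        stepFn (foldSupport E N) (foldJump E w N) m' u := by
  have hN0 : (N : ℝ) ≠ 0 := by positivity
  refine ⟨N * m - ∑ e ∈ E, w e * ⌊N * e⌋, fun u hu => ?_⟩
  rw [Fin.sum_univ_eq_sum_range (fun k => stepFn E w m ((N : ℝ)⁻¹ * (u + (0 + k))))]
  have hE' : ∀ e ∈ foldSupport E N, e ∈ Set.Ico (0 : ℝ) 1 := by
    intro e he
    obtain ⟨e, -, rfl⟩ := Finset.mem_image.1 he
    exact ⟨Int.fract_nonneg _, Int.fract_lt_one _⟩
  rw [stepFn_eq_floor hE' _ _ hu, Finset.sum_congr rfl fun k hk =>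
    stepFn_eq_floor hE w m (fold_mem_Ico hu (Finset.mem_range.1 hk))]
  have h1 := sum_foldJump_mul (R := ℤ) E w N (fun e => ⌊u - e⌋)
  simp only [Int.cast_id] at h1
  rw [h1, Finset.sum_add_distrib, Finset.sum_const, Finset.card_range, nsmul_eq_mul,
    Finset.sum_comm, sub_add, sub_eq_add_neg, ← Finset.sum_sub_distrib, ← Finset.sum_neg_distrib]
  congr 1
  refine Finset.sum_congr rfl fun e _ => ?_
  rw [← Finset.mul_sum]
  have h2 : ∀ k : ℕ, (N : ℝ)⁻¹ * (u + (0 + k)) - e = (u - N * e + k) / N := by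
    intro k
    field_simp
    ring
  simp_rw [h2]
  rw [sum_floor_add_div N hN]
  have h3 : u - N * e = u - Int.fract (N * e) - (⌊N * e⌋ : ℤ) := by
    rw [← Int.self_sub_floor]; ring
  rw [h3, Int.floor_sub_intCast]
  ring

/-- The indicator function of `{x | s < x}`. -/
def level (s : ℤ) (x : ℤ) : ℤ := if s < x then 1 else 0

lemma level_eq_one {s x : ℤ} : level s x = 1 ↔ s < x := by
  unfold level; split_ifs <;> simp [*]

lemma level_eq_zero_or_one (s x : ℤ) : level s x = 0 ∨ level s x = 1 := by
  unfold level; split_ifs <;> simp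

/-- The points where the step function crosses the level `s`. -/
noncomputable def levelSupport (s : ℤ) (E : Finset ℝ) (w : ℝ → ℤ) (m : ℤ) : Finset ℝ :=
  E.filter fun e => compJump (level s) E w m e ≠ 0

/-- The subsets of the unit interval which are bounded by at most `n` jumps have critical
sampling. -/
def CriticalUpTo (n : ℕ) : Prop :=
  ∀ (E : Finset ℝ) (w : ℝ → ℤ) (m : ℤ), E.card ≤ n → (∀ e ∈ E, e ∈ Set.Ico (0 : ℝ) 1) →
    (∀ e ∈ E, w e = 1 ∨ w e = -1) → ∑ e ∈ E, w e = 0 →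
    (∀ u ∈ Set.Ico (0 : ℝ) 1, stepFn E w m u = 0 ∨ stepFn E w m u = 1) →
    HasCriticalSampling {u | stepFn E w m u = 1 ∧ u ∈ Set.Ico 0 1}

/-- Composition with a threshold gives a step function with values 0 and 1 that jumps only where the
level is crossed. In this way a statement about jumps ±1 reaches arbitrary integer jumps. -/
lemma CriticalUpTo.level {n : ℕ} (h : CriticalUpTo n) {E : Finset ℝ}
    (hE : ∀ e ∈ E, e ∈ Set.Ico (0 : ℝ) 1) {w : ℝ → ℤ} (hw : ∑ e ∈ E, w e = 0) (m s : ℤ)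
    (hn : (levelSupport s E w m).card ≤ n) :
    HasCriticalSampling {u | s < stepFn E w m u ∧ u ∈ Set.Ico 0 1} := by
  have hcomp : ∀ u, stepFn (levelSupport s E w m) (compJump (CTVGS.level s) E w m)
      (CTVGS.level s m) u = CTVGS.level s (stepFn E w m u) := by
    intro u
    rw [comp_stepFn (CTVGS.level s), levelSupport, stepFn_filter_ne_zero]
  have := h (levelSupport s E w m) (compJump (CTVGS.level s) E w m) (CTVGS.level s m) hn
    (fun e he => hE e (Finset.mem_filter.1 he).1) (fun e he => by
      have h1 := (Finset.mem_filter.1 he).2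
      rcases level_eq_zero_or_one s (stepFn E w m e) with h2 | h2 <;>
      rcases level_eq_zero_or_one s (stepFn E w m e - w e) with h3 | h3 <;>
      simp only [compJump, h2, h3] at h1 ⊢ <;> simp at h1 ⊢)
    (by rw [levelSupport, Finset.sum_filter_ne_zero, sum_compJump_eq_zero _ _ hw])
    (fun u _ => by rw [hcomp]; exact level_eq_zero_or_one _ _)
  simpa only [hcomp, level_eq_one] using this

lemma card_foldFiber {E : Finset ℝ} {w : ℝ → ℤ} {m : ℤ}
    (h01 : ∀ u ∈ Set.Ico (0 : ℝ) 1, stepFn E w m u = 0 ∨ stepFn E w m u = 1) {N : ℕ} {u : ℝ}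
    (hu : u ∈ Set.Ico (0 : ℝ) 1) :
    ((foldFiber {u | stepFn E w m u = 1 ∧ u ∈ Set.Ico 0 1} N u).card : ℤ) =
      ∑ k : Fin N, stepFn E w m ((N : ℝ)⁻¹ * (u + (0 + (k : ℕ)))) := by
  classical
  rw [Finset.card_eq_sum_ones, ← Finset.sum_subset (Finset.subset_univ
    (foldFiber {u | stepFn E w m u = 1 ∧ u ∈ Set.Ico 0 1} N u))]
  · push_cast
    refine Finset.sum_congr rfl fun k hk => ?_
    rw [mem_foldFiber] at hk
    exact hk.1.symm
  · intro k _ hk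
    rw [mem_foldFiber] at hk
    have h1 := fold_mem_Ico hu k.2
    exact (h01 _ h1).resolve_right fun h => hk ⟨h, h1⟩

lemma foldSupport_mem {E : Finset ℝ} {N : ℕ} : ∀ e ∈ foldSupport E N, e ∈ Set.Ico (0 : ℝ) 1 := by
  intro e he
  obtain ⟨e, -, rfl⟩ := Finset.mem_image.1 he
  exact ⟨Int.fract_nonneg _, Int.fract_lt_one _⟩

lemma hasCriticalSampling_of_levels {E : Finset ℝ} {w : ℝ → ℤ} {m : ℤ}
    (h01 : ∀ u ∈ Set.Ico (0 : ℝ) 1, stepFn E w m u = 0 ∨ stepFn E w m u = 1) {N : ℕ} (hN : 0 < N)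
    {m' : ℤ} (hm' : ∀ u ∈ Set.Ico (0 : ℝ) 1,
      ∑ k : Fin N, stepFn E w m ((N : ℝ)⁻¹ * (u + (0 + (k : ℕ)))) =
        stepFn (foldSupport E N) (foldJump E w N) m' u)
    (h : ∀ s : ℕ, HasCriticalSampling
      {u | (s : ℤ) < stepFn (foldSupport E N) (foldJump E w N) m' u ∧ u ∈ Set.Ico 0 1}) :
    HasCriticalSampling {u | stepFn E w m u = 1 ∧ u ∈ Set.Ico 0 1} := by
  refine HasCriticalSampling.of_fold ?_ (fun u hu => hu.2) hN fun s => ?_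
  · exact ((measurable_stepFn E w m) (measurableSet_singleton 1)).inter measurableSet_Ico
  · convert h s using 2
    ext u
    refine and_congr_left fun hu => ?_
    rw [← hm' u hu, ← card_foldFiber h01 hu]
    norm_cast

end CTVGS

namespace CTVGS

/-! ### Exponential sums -/

/-- The exponential sum with weights `w` at the points of `E`. -/
noncomputable def expSum (E : Finset ℝ) (w : ℝ → ℤ) (t : ℝ) : ℂ := ∑ e ∈ E, (w e : ℂ) * ex (t * e)

/-- Integer frequencies do not see reduction modulo one, so folding N times rescales the frequency
by N. -/
lemma expSum_foldSupport (E : Finset ℝ) (w : ℝ → ℤ) (N : ℕ) (j : ℤ) :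
    expSum (foldSupport E N) (foldJump E w N) j = expSum E w (j * N) := by
  unfold expSum
  rw [sum_foldJump_mul]
  refine Finset.sum_congr rfl fun e _ => ?_
  rw [ex_mul_fract, mul_assoc]

lemma norm_expSum_neg (E : Finset ℝ) (w : ℝ → ℤ) (t : ℝ) :
    ‖expSum E w (-t)‖ = ‖expSum E w t‖ := by
  rw [← norm_star (expSum E w t)]
  unfold expSum
  rw [star_sum]
  congr 1
  refine Finset.sum_congr rfl fun e _ => ?_
  rw [neg_mul, ex_neg]
  simp

lemma setIntegral_ex_Ico {e : ℝ} (he : 0 ≤ e) {j : ℤ} (hj : j ≠ 0) :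
    ∫ u in Set.Ico 0 e, ex (j * u) = (ex (j * e) - 1) / (2 * Real.pi * Complex.I * j) := by
  have h := ex_mul_sub_one e (j : ℝ)
  rw [intervalIntegral.integral_const_mul] at h
  have hj' : (2 * Real.pi * Complex.I * j : ℂ) ≠ 0 :=
    mul_ne_zero Complex.two_pi_I_ne_zero (by exact_mod_cast hj)
  rw [eq_div_iff hj', mul_comm (j : ℝ) e, h, intervalIntegral.integral_of_le he,
    ← restrict_Ico_eq_Ioc, mul_comm]
  push_cast
  simp_rw [mul_comm (j : ℝ)]

/-- Each jump contributes the explicit integral over `[0, e)`; the constant parts of these cancel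
because the jumps sum to zero. -/
lemma fint_indicator_stepFn {E : Finset ℝ} (hE : ∀ e ∈ E, e ∈ Set.Ico (0 : ℝ) 1) {w : ℝ → ℤ}
    (hw : ∑ e ∈ E, w e = 0) {m s : ℤ}
    (h : ∀ u ∈ Set.Ico (0 : ℝ) 1, stepFn E w m u = s ∨ stepFn E w m u = s + 1)
    {j : ℤ} (hj : j ≠ 0) :
    fint ({u | stepFn E w m u = s + 1}.indicator 1) j =
      -(expSum E w j / (2 * Real.pi * Complex.I * j)) := by
  have hex : ∀ e, ∫ u in Set.Ico (0 : ℝ) 1, (Set.Iio e).indicator (fun u => ex (j * u)) u =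
      ∫ u in Set.Iio e ∩ Set.Ico (0 : ℝ) 1, ex (j * u) := fun e => by
    rw [integral_indicator measurableSet_Iio, Measure.restrict_restrict measurableSet_Iio]
  have hint : Integrable (fun u => ex (j * u)) unitMeasure := by
    have := integrable_mul_ex (μ := unitMeasure) (integrable_const (1 : ℂ)) j
    simpa using this
  have h0 : ∫ u in Set.Ico (0 : ℝ) 1, ex (j * u) = 0 := by
    rw [setIntegral_ex_Ico zero_le_one hj, mul_one, ex_intCast, sub_self, zero_div]
  calc fint ({u | stepFn E w m u = s + 1}.indicator 1) j
      = ∫ u in Set.Ico (0 : ℝ) 1, (((m - s : ℤ) : ℂ) * ex (j * u) -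
          ∑ e ∈ E, (w e : ℂ) * (Set.Iio e).indicator (fun u => ex (j * u)) u) := by
        refine setIntegral_congr_fun measurableSet_Ico fun u hu => ?_
        have h1 : ({u | stepFn E w m u = s + 1}.indicator 1 u : ℂ) =
            ((stepFn E w m u - s : ℤ) : ℂ) := by
          rcases h u hu with h2 | h2
          · rw [Set.indicator_of_notMem (by simp [h2]), h2]; simp
          · rw [Set.indicator_of_mem (by exact h2), h2]; simp
        simp only [h1]
        have h3 : ∀ e, (w e : ℂ) * (Set.Iio e).indicator (fun u => ex (j * u)) u =
            (if u < e then (w e : ℂ) else 0) * ex (j * u) := by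
          intro e
          by_cases hue : u < e <;> simp [Set.indicator, hue]
        simp_rw [h3]
        rw [← Finset.sum_mul, ← sub_mul, ← Finset.sum_filter]
        simp only [stepFn]
        push_cast
        ring
    _ = -∑ e ∈ E, (w e : ℂ) * ((ex (j * e) - 1) / (2 * Real.pi * Complex.I * j)) := by
        rw [integral_sub, integral_const_mul, h0, mul_zero, zero_sub, integral_finsetSum]
        · congr 1
          refine Finset.sum_congr rfl fun e he => ?_
          rw [integral_const_mul, hex, ← setIntegral_ex_Ico (hE e he).1 hj]
          congr 3
          ext u
          simp only [Set.mem_inter_iff, Set.mem_Iio, Set.mem_Ico]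
          have := (hE e he).2
          constructor
          · rintro ⟨h1, h2, h3⟩; exact ⟨h2, h1⟩
          · rintro ⟨h1, h2⟩; exact ⟨h2, h1, h2.trans this⟩
        · exact fun e _ => (hint.indicator measurableSet_Iio).const_mul _
        · exact hint.const_mul _
        · exact integrable_finsetSum _ fun e _ => (hint.indicator measurableSet_Iio).const_mul _
    _ = _ := by
        congr 1
        unfold expSum
        have hw' : ∑ e ∈ E, (w e : ℂ) = 0 := by exact_mod_cast congrArg (Int.cast (R := ℂ)) hw
        rw [Finset.sum_div]
        have h4 : ∀ e, (w e : ℂ) * ((ex (j * e) - 1) / (2 * Real.pi * Complex.I * j)) =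
            (w e : ℂ) * ex (j * e) / (2 * Real.pi * Complex.I * j) -
              (w e : ℂ) * (1 / (2 * Real.pi * Complex.I * j)) := fun e => by ring
        simp_rw [h4]
        rw [Finset.sum_sub_distrib, ← Finset.sum_mul, hw', zero_mul, sub_zero]

/-- Bessel's inequality at the frequencies 0, ±1, ±2 for the indicator function of the upper value.
Its energy is its mean p and the frequency 0 uses up p², so at most p - p² ≤ 1/4 is left for the
others. -/
lemma expSum_bound_of_two_values {E : Finset ℝ} (hE : ∀ e ∈ E, e ∈ Set.Ico (0 : ℝ) 1) {w : ℝ → ℤ}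
    (hw : ∑ e ∈ E, w e = 0) {m s : ℤ}
    (h : ∀ u ∈ Set.Ico (0 : ℝ) 1, stepFn E w m u = s ∨ stepFn E w m u = s + 1) :
    ‖expSum E w 1‖ ^ 2 + ‖expSum E w 2‖ ^ 2 / 4 ≤ Real.pi ^ 2 / 2 := by
  set A := {u | stepFn E w m u = s + 1} with hA
  have hAm : MeasurableSet A := (measurable_stepFn E w m) (measurableSet_singleton _)
  set χ : ℝ → ℂ := A.indicator 1 with hχ
  have hmem : MemLp χ 2 unitMeasure := (memLp_const (1 : ℂ)).indicator hAm
  set p := volume.real (A ∩ Set.Ico 0 1) with hp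
  have hpt : volume (A ∩ Set.Ico 0 1) ≠ ⊤ :=
    ((measure_mono Set.inter_subset_right).trans_lt (by simp)).ne
  have hen : energy χ = ENNReal.ofReal p := by
    have h1 : ∀ u, ‖χ u‖ₑ ^ 2 = A.indicator 1 u := by
      intro u
      by_cases hu : u ∈ A <;> simp [hχ, hu]
    unfold energy
    simp_rw [h1]
    rw [lintegral_indicator_one hAm, Measure.restrict_apply hAm, hp, ofReal_measureReal hpt]
  have h0 : fint χ ((0 : ℤ) : ℝ) = p := by
    simp only [fint, Int.cast_zero, zero_mul, ex_zero, mul_one]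
    rw [hχ, integral_indicator hAm]
    simp only [Pi.one_apply, integral_const, Measure.restrict_restrict hAm]
    simp [Measure.real, hp]
  have hn : ∀ j : ℤ, j ≠ 0 → ‖fint χ j‖ ^ 2 = ‖expSum E w j‖ ^ 2 / (4 * Real.pi ^ 2 * j ^ 2) := by
    intro j hj
    rw [fint_indicator_stepFn hE hw h hj, norm_neg, norm_div, div_pow]
    congr 1
    simp only [norm_mul, Complex.norm_ofNat, Complex.norm_real, Complex.norm_I, mul_one,
      Complex.norm_intCast, mul_pow, sq_abs, Real.norm_eq_abs]
    ring
  have hb := tsum_fint_sq_le hmem (({0, 1, -1, 2, -2} : Finset ℤ) : Set ℤ)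
  rw [Finset.tsum_subtype' ({0, 1, -1, 2, -2} : Finset ℤ) (fun n : ℤ => ‖fint χ n‖ₑ ^ 2), hen] at hb
  have hconv : ∀ n : ℤ, ‖fint χ n‖ₑ ^ 2 = ENNReal.ofReal (‖fint χ n‖ ^ 2) := fun n => by
    rw [ENNReal.ofReal_pow (norm_nonneg _), ofReal_norm]
  simp_rw [hconv] at hb
  rw [← ENNReal.ofReal_sum_of_nonneg (fun n _ => by positivity),
    ENNReal.ofReal_le_ofReal_iff measureReal_nonneg] at hb
  rw [Finset.sum_insert (by decide), Finset.sum_insert (by decide), Finset.sum_insert (by decide),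
    Finset.sum_insert (by decide), Finset.sum_singleton, h0, hn 1 (by decide), hn (-1) (by decide),
    hn 2 (by decide), hn (-2) (by decide)] at hb
  push_cast at hb
  rw [norm_expSum_neg, norm_expSum_neg, Complex.norm_real, Real.norm_eq_abs, sq_abs] at hb
  have hpi : 0 < Real.pi ^ 2 := by positivity
  have h5 : p ^ 2 + (‖expSum E w 1‖ ^ 2 + ‖expSum E w 2‖ ^ 2 / 4) / (2 * Real.pi ^ 2) ≤ p := by
    refine le_trans (le_of_eq ?_) hb
    field_simp
    ring
  have h6 : (‖expSum E w 1‖ ^ 2 + ‖expSum E w 2‖ ^ 2 / 4) / (2 * Real.pi ^ 2) ≤ 1 / 4 := by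
    nlinarith [sq_nonneg (p - 1 / 2)]
  rw [div_le_iff₀ (by positivity)] at h6
  linarith

lemma norm_sum_ex_le {z : ℝ} (hz : ex z ≠ 1) (T : ℕ) :
    ‖∑ n ∈ Finset.range T, ex ((n + 1 : ℕ) * z)‖ ≤ 2 / ‖ex z - 1‖ := by
  have h1 : ∀ n : ℕ, ex ((n + 1 : ℕ) * z) = ex z * ex z ^ n := by
    intro n
    rw [← ex_pow, pow_succ']
  simp_rw [h1]
  have h2 : 0 < ‖ex z - 1‖ := norm_pos_iff.2 (sub_ne_zero.2 hz)
  rw [← Finset.mul_sum, norm_mul, norm_ex, one_mul, geom_sum_eq hz, norm_div]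
  gcongr
  calc ‖ex z ^ T - 1‖ ≤ ‖ex z ^ T‖ + ‖(1 : ℂ)‖ := norm_sub_le _ _
    _ = 2 := by rw [norm_pow, norm_ex]; norm_num

/-- In the expanded square the diagonal gives |E| for each n, and every off-diagonal pair gives a
geometric sum with ratio different from 1, bounded independently of T. -/
lemma exists_expSum_average {E : Finset ℝ} {w : ℝ → ℤ} (hw : ∀ e ∈ E, w e = 1 ∨ w e = -1) {c : ℝ}
    (hc : ∀ e ∈ E, ∀ e' ∈ E, e ≠ e' → ex (c * (e - e')) ≠ 1) :
    ∃ K : ℝ, ∀ T : ℕ, T * (E.card : ℝ) - K ≤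
      ∑ n ∈ Finset.range T, ‖expSum E w (c * (n + 1 : ℕ))‖ ^ 2 := by
  classical
  refine ⟨∑ e ∈ E, ∑ e' ∈ E with e' ≠ e, 2 / ‖ex (c * (e - e')) - 1‖, fun T => ?_⟩
  have hsq : ∀ t : ℝ, ((‖expSum E w t‖ ^ 2 : ℝ) : ℂ) =
      ∑ e ∈ E, ∑ e' ∈ E, (w e * w e' : ℂ) * ex (t * (e - e')) := by
    intro t
    have h1 : ((‖expSum E w t‖ ^ 2 : ℝ) : ℂ) = expSum E w t * star (expSum E w t) := by
      rw [Complex.star_def, Complex.mul_conj, Complex.normSq_eq_norm_sq]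
    rw [h1]
    unfold expSum
    rw [star_sum, Finset.sum_mul_sum]
    refine Finset.sum_congr rfl fun e _ => Finset.sum_congr rfl fun e' _ => ?_
    rw [show t * (e - e') = t * e + -(t * e') by ring, ex_add, ex_neg, star_mul']
    simp
    ring
  have hT : ((∑ n ∈ Finset.range T, ‖expSum E w (c * (n + 1 : ℕ))‖ ^ 2 : ℝ) : ℂ) =
      T * (E.card : ℂ) + ∑ e ∈ E, ∑ e' ∈ E with e' ≠ e, (w e * w e' : ℂ) *
        ∑ n ∈ Finset.range T, ex ((n + 1 : ℕ) * (c * (e - e'))) := by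
    rw [Complex.ofReal_sum]
    simp_rw [hsq]
    rw [Finset.sum_comm]
    have h2 : (T * (E.card : ℂ)) = ∑ e ∈ E, (T : ℂ) := by
      rw [Finset.sum_const, nsmul_eq_mul, mul_comm]
    rw [h2, ← Finset.sum_add_distrib]
    refine Finset.sum_congr rfl fun e he => ?_
    rw [Finset.sum_comm, ← Finset.sum_filter_add_sum_filter_not E (fun e' => e' = e)]
    congr 1
    · rw [Finset.filter_eq', if_pos he, Finset.sum_singleton]
      have h3 : (w e * w e : ℂ) = 1 := by
        rcases hw e he with h | h <;> simp [h]
      simp [h3, ex_zero]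
    · refine Finset.sum_congr rfl fun e' _ => ?_
      rw [Finset.mul_sum]
      refine Finset.sum_congr rfl fun n _ => ?_
      congr 2
      ring
  have hre := congrArg Complex.re hT
  rw [Complex.ofReal_re, Complex.add_re] at hre
  rw [hre]
  have h4 : ((T : ℂ) * (E.card : ℂ)).re = T * (E.card : ℝ) := by
    rw [← Nat.cast_mul, Complex.natCast_re, Nat.cast_mul]
  rw [h4]
  have h5 : ‖∑ e ∈ E, ∑ e' ∈ E with e' ≠ e, (w e * w e' : ℂ) *
        ∑ n ∈ Finset.range T, ex ((n + 1 : ℕ) * (c * (e - e')))‖ ≤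
      ∑ e ∈ E, ∑ e' ∈ E with e' ≠ e, 2 / ‖ex (c * (e - e')) - 1‖ := by
    refine (norm_sum_le _ _).trans (Finset.sum_le_sum fun e he => (norm_sum_le _ _).trans
      (Finset.sum_le_sum fun e' he' => ?_))
    rw [Finset.mem_filter] at he'
    have h6 : ‖(w e * w e' : ℂ)‖ = 1 := by
      rcases hw e he with h | h <;> rcases hw e' he'.1 with h' | h' <;> simp [h, h']
    rw [norm_mul, h6, one_mul]
    exact norm_sum_ex_le (hc e he e' he'.1 he'.2.symm) T
  have h7 := (abs_le.1 (Complex.abs_re_le_norm (∑ e ∈ E, ∑ e' ∈ E with e' ≠ e, (w e * w e' : ℂ) *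
        ∑ n ∈ Finset.range T, ex ((n + 1 : ℕ) * (c * (e - e')))))).1
  linarith

lemma ex_mul_sub_ne_one {N : ℕ} {e e' : ℝ} (h : Int.fract ((N : ℝ) * e) ≠ Int.fract (N * e')) :
    ex (N * (e - e')) ≠ 1 := by
  intro h1
  obtain ⟨n, hn⟩ := ex_eq_one_iff.1 h1
  apply h
  rw [Int.fract_eq_fract]
  exact ⟨n, by rw [← hn]; ring⟩

/-- If the multiples of the jump positions never collide, then some fold of the step function takes
more than two values. -/
lemma exists_fold_many_values {E : Finset ℝ} (hE4 : 4 ≤ E.card)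
    {w : ℝ → ℤ} (hw : ∀ e ∈ E, w e = 1 ∨ w e = -1) (hw0 : ∑ e ∈ E, w e = 0)
    (hinj : ∀ N : ℕ, 0 < N → Set.InjOn (fun e : ℝ => Int.fract ((N : ℝ) * e)) E) :
    ∃ N : ℕ, 0 < N ∧ ∀ m s : ℤ, ∃ u ∈ Set.Ico (0 : ℝ) 1,
      stepFn (foldSupport E N) (foldJump E w N) m u ≠ s ∧
      stepFn (foldSupport E N) (foldJump E w N) m u ≠ s + 1 := by
  -- If all folds had only two values, Bessel's bound would hold at the frequencies N and 2N for
  -- every N. The mean squares there are at least |E| ≥ 4, so averaging gives 4 + 4/4 = 5 ≤ π²/2 <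
  -- 4.97. The second harmonic matters: the value 4 alone is no contradiction.
  by_contra! hcon
  have hbound : ∀ n : ℕ, ‖expSum E w (1 * (n + 1 : ℕ))‖ ^ 2 +
      ‖expSum E w (2 * (n + 1 : ℕ))‖ ^ 2 / 4 ≤ Real.pi ^ 2 / 2 := by
    intro n
    obtain ⟨m, s, hms⟩ := hcon (n + 1) n.succ_pos
    have h1 := expSum_bound_of_two_values foldSupport_mem
      (by rw [sum_foldJump, hw0] : ∑ e ∈ foldSupport E (n + 1), foldJump E w (n + 1) e = 0)
      (m := m) (s := s) (fun u hu => by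
        by_cases h : stepFn (foldSupport E (n + 1)) (foldJump E w (n + 1)) m u = s
        · exact Or.inl h
        · exact Or.inr (hms u hu h))
    have h2 := expSum_foldSupport E w (n + 1) 1
    have h3 := expSum_foldSupport E w (n + 1) 2
    rw [Int.cast_one] at h2
    rw [Int.cast_ofNat] at h3
    rwa [h2, h3] at h1
  obtain ⟨K₁, hK₁⟩ := exists_expSum_average hw (c := 1) fun e he e' he' hne => by
    have := ex_mul_sub_ne_one fun h => hne (hinj 1 one_pos he he' h)
    simpa using this
  obtain ⟨K₂, hK₂⟩ := exists_expSum_average hw (c := 2) fun e he e' he' hne => by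
    have := ex_mul_sub_ne_one fun h => hne (hinj 2 two_pos he he' h)
    simpa using this
  have hpi : Real.pi ^ 2 / 2 < 4.97 := by
    have := Real.pi_lt_d2
    have h0 := Real.pi_pos
    nlinarith
  have hcard : (4 : ℝ) ≤ E.card := by exact_mod_cast hE4
  -- 0.03 is the gap between 5 and 4.97.
  obtain ⟨T, hT⟩ := exists_nat_gt ((K₁ + K₂ / 4) / 0.03)
  rw [div_lt_iff₀ (by norm_num)] at hT
  have h1 := Finset.sum_le_sum fun n (_ : n ∈ Finset.range T) => hbound n
  rw [Finset.sum_add_distrib, ← Finset.sum_div, Finset.sum_const, Finset.card_range,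
    nsmul_eq_mul] at h1
  have h2 := hK₁ T
  have h3 := hK₂ T
  have hT0 : (0 : ℝ) ≤ T := by positivity
  have h4 : (T : ℝ) * 4 ≤ T * (E.card : ℝ) := by gcongr
  have h5 : (T : ℝ) * (Real.pi ^ 2 / 2) ≤ T * 4.97 := by gcongr
  linarith

/-- Dirichlet's theorem puts some kθ within 1/11 of an integer. If it lies below by η, then ⌊1/η⌋
further steps down by η end less than η above an integer. -/
lemma exists_small_fract {θ : ℝ} (hθ : ∀ N : ℕ, 0 < N → Int.fract ((N : ℝ) * θ) ≠ 0) :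
    ∃ N : ℕ, 0 < N ∧ 0 < Int.fract ((N : ℝ) * θ) ∧ Int.fract ((N : ℝ) * θ) ≤ 1 / 10 := by
  suffices h : ∃ N : ℕ, 0 < N ∧ Int.fract ((N : ℝ) * θ) ≤ 1 / 10 by
    obtain ⟨N, hN, h⟩ := h
    exact ⟨N, hN, lt_of_le_of_ne (Int.fract_nonneg _) (hθ N hN).symm, h⟩
  obtain ⟨k, hk, -, hk'⟩ := Real.exists_nat_abs_mul_sub_round_le θ (n := 10) (by norm_num)
  rw [abs_le] at hk'
  set r := round ((k : ℝ) * θ) with hr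
  by_cases hpos : 0 ≤ (k : ℝ) * θ - r
  · refine ⟨k, hk, ?_⟩
    have : Int.fract ((k : ℝ) * θ) = k * θ - r := by
      rw [Int.fract_eq_iff]
      refine ⟨hpos, by norm_num at hk'; linarith [hk'.2], r, by ring⟩
    rw [this]
    norm_num at hk' ⊢
    linarith [hk'.2]
  · push Not at hpos
    set η := r - (k : ℝ) * θ with hη
    have hη0 : 0 < η := by linarith
    have hη1 : η ≤ 1 / 11 := by norm_num at hk' ⊢; linarith [hk'.1]
    set j := ⌊1 / η⌋₊ with hj
    have hj1 : (j : ℝ) * η ≤ 1 := by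
      have := Nat.floor_le (a := 1 / η) (by positivity)
      rwa [le_div_iff₀ hη0] at this
    have hj2 : 1 < ((j : ℝ) + 1) * η := by
      have := Nat.lt_floor_add_one (1 / η)
      rwa [div_lt_iff₀ hη0] at this
    have hj0 : 0 < j := by
      rw [hj, Nat.floor_pos, le_div_iff₀ hη0]; linarith
    refine ⟨j * k, Nat.mul_pos hj0 hk, ?_⟩
    have : Int.fract (((j * k : ℕ) : ℝ) * θ) = 1 - j * η := by
      rw [Int.fract_eq_iff]
      refine ⟨by linarith, by nlinarith, j * r - 1, ?_⟩
      push_cast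
      rw [hη]
      ring
    rw [this]
    linarith

end CTVGS

namespace CTVGS

/-! ### Critical sampling for finite unions of intervals -/

lemma hasCriticalSampling_empty : HasCriticalSampling ∅ := by
  refine ⟨∅, ⟨0, fun f _ h0 => ?_⟩, ?_⟩
  · rw [energy, setLIntegral_congr_fun (g := fun _ => 0) measurableSet_Ico]
    · simp
    · intro u hu
      simp [h0 u hu (Set.notMem_empty u)]
  · simpa using uniformDensity_empty

lemma hasCriticalSampling_Ico : HasCriticalSampling (Set.Ico 0 1) := by
  refine ⟨Set.univ, ⟨1, fun f hf _ => ?_⟩, ?_⟩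
  · rw [ENNReal.coe_one, one_mul, tsum_univ (fun n : ℤ => ‖fint f n‖ₑ ^ 2), tsum_fint_sq hf]
  · simpa using uniformDensity_range_intCast

/-- The function has two values on the circle, the upper one on the arc from a to b. Hence each
level set is empty, everything, or this short arc. -/
lemma hasCriticalSampling_two_jumps {a b : ℝ} (ha : a ∈ Set.Ico (0 : ℝ) 1)
    (hb : b ∈ Set.Ico (0 : ℝ) 1) (h0 : 0 < Int.fract (b - a)) (h1 : Int.fract (b - a) ≤ 1 / 10)
    {g : ℝ → ℤ} (hg : Measurable g) {m : ℤ}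
    (hgu : ∀ u ∈ Set.Ico (0 : ℝ) 1, g u = m + (⌊u - a⌋ - ⌊u - b⌋)) (s : ℤ) :
    HasCriticalSampling {u | s < g u ∧ u ∈ Set.Ico 0 1} := by
  have hmeas : MeasurableSet {u | s < g u ∧ u ∈ Set.Ico (0 : ℝ) 1} :=
    (hg (measurableSet_Ioi (a := s))).inter measurableSet_Ico
  have hval : ∀ u ∈ Set.Ico (0 : ℝ) 1,
      g u = m + ((if u < b then 1 else 0) - if u < a then 1 else 0) := by
    intro u hu
    rw [hgu u hu, floor_sub_of_mem hu ha, floor_sub_of_mem hu hb]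
    ring
  have hne : a ≠ b := by
    rintro rfl
    simp at h0
  have key : (∀ u ∈ Set.Ico (0 : ℝ) 1, ¬ s < g u) ∨ (∀ u ∈ Set.Ico (0 : ℝ) 1, s < g u) ∨
      ∀ w ∈ Set.Ico a (a + 1), s < g (Int.fract w) ↔ w < a + Int.fract (b - a) := by
    have hfr : ∀ w ∈ Set.Ico a (a + 1),
        (w < 1 ∧ Int.fract w = w) ∨ (1 ≤ w ∧ Int.fract w = w - 1) := by
      intro w hw
      rcases lt_or_ge w 1 with h | h
      · exact Or.inl ⟨h, Int.fract_eq_self.2 ⟨ha.1.trans hw.1, h⟩⟩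
      · refine Or.inr ⟨h, ?_⟩
        rw [← Int.fract_sub_one, Int.fract_eq_self]
        constructor <;> linarith [hw.2, ha.2]
    rcases lt_or_gt_of_ne hne with hab | hab
    · have hf : Int.fract (b - a) = b - a :=
        Int.fract_eq_self.2 ⟨by linarith, by linarith [ha.1, hb.2]⟩
      rw [hf]
      rcases lt_trichotomy s m with hs | hs | hs
      · refine Or.inr (Or.inl fun u hu => ?_)
        rw [hval u hu]
        split_ifs <;> first | omega | linarith
      · refine Or.inr (Or.inr fun w hw => ?_)
        rw [hval _ ⟨Int.fract_nonneg w, Int.fract_lt_one w⟩, hs]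
        rcases hfr w hw with ⟨h2, h3⟩ | ⟨h2, h3⟩ <;> rw [h3]
        · rw [if_neg (not_lt.2 hw.1)]
          split_ifs with h4
          · simp; linarith
          · simp; linarith
        · rw [if_pos (by linarith [hw.2] : w - 1 < a), if_pos (by linarith [hw.2] : w - 1 < b)]
          simp; linarith [hb.2]
      · refine Or.inl fun u hu => ?_
        rw [hval u hu]
        split_ifs <;> omega
    · have hf : Int.fract (b - a) = b - a + 1 := by
        rw [← Int.fract_add_one]
        exact Int.fract_eq_self.2 ⟨by linarith [ha.2, hb.1], by linarith⟩
      rw [hf]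
      -- For b < a the value m is taken on the arc from a through 1 to b, and m - 1 on `[b, a)`, so
      -- the only proper level is m - 1.
      rcases lt_trichotomy s (m - 1) with hs | hs | hs
      · refine Or.inr (Or.inl fun u hu => ?_)
        rw [hval u hu]
        split_ifs <;> omega
      · refine Or.inr (Or.inr fun w hw => ?_)
        rw [hval _ ⟨Int.fract_nonneg w, Int.fract_lt_one w⟩, hs]
        rcases hfr w hw with ⟨h2, h3⟩ | ⟨h2, h3⟩ <;> rw [h3]
        · rw [if_neg (not_lt.2 hw.1), if_neg (not_lt.2 (hab.le.trans hw.1))]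
          simp; linarith [hb.1]
        · rw [if_pos (by linarith [hw.2] : w - 1 < a)]
          split_ifs with h4
          · simp; linarith
          · simp; linarith
      · refine Or.inl fun u hu => ?_
        rw [hval u hu]
        split_ifs <;> first | omega | linarith
  rcases key with h | h | h
  · convert hasCriticalSampling_empty
    ext u
    simp only [Set.mem_ofPred_eq, Set.mem_empty_iff_false, iff_false]
    exact fun hu => h u hu.2 hu.1
  · convert hasCriticalSampling_Ico
    ext u
    exact ⟨fun hu => hu.2, fun hu => ⟨h u hu, hu⟩⟩
  · refine hasCriticalSampling_arc (α := a) hmeas (fun u hu => hu.2) h0 h1 fun w hw => ?_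
    rw [← h w hw]
    exact ⟨fun h => h.1, fun h => ⟨h, Int.fract_nonneg w, Int.fract_lt_one w⟩⟩

lemma stepFn_fold_eq (E : Finset ℝ) (w : ℝ → ℤ) (N : ℕ) (m : ℤ) {u : ℝ}
    (hu : u ∈ Set.Ico (0 : ℝ) 1) : stepFn (foldSupport E N) (foldJump E w N) m u =
      m + ∑ e ∈ E, w e * ⌊u - Int.fract (N * e)⌋ := by
  have h1 := sum_foldJump_mul (R := ℤ) E w N (fun e => ⌊u - e⌋)
  simp only [Int.cast_id] at h1
  rw [stepFn_eq_floor foldSupport_mem _ _ hu, h1]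

lemma foldJump_of_injOn {E : Finset ℝ} (w : ℝ → ℤ) {N : ℕ}
    (hinj : Set.InjOn (fun e : ℝ => Int.fract ((N : ℝ) * e)) E) {e : ℝ} (he : e ∈ E) :
    foldJump E w N (Int.fract (N * e)) = w e := by
  classical
  rw [foldJump, Finset.sum_eq_single_of_mem e]
  · simpa using he
  · intro e' he' hne
    rw [Finset.mem_filter] at he'
    exact absurd (hinj he'.1 he he'.2) hne

lemma card_foldSupport_le (E : Finset ℝ) (N : ℕ) : (foldSupport E N).card ≤ E.card := by
  classical
  exact Finset.card_image_le

lemma card_foldSupport_lt {E : Finset ℝ} {N : ℕ}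
    (hinj : ¬ Set.InjOn (fun e : ℝ => Int.fract ((N : ℝ) * e)) E) :
    (foldSupport E N).card < E.card := by
  classical
  refine lt_of_le_of_ne (card_foldSupport_le E N) fun h => hinj ?_
  refine Finset.card_image_iff.1 ?_
  rw [← h]
  unfold foldSupport
  congr

/-- If all jumps are at the level `s` then the step function takes only the values `s`, `s + 1`. -/
lemma stepFn_mem_of_levelSupport_eq {E : Finset ℝ} {w : ℝ → ℤ}
    (hw : ∀ e ∈ E, w e = 1 ∨ w e = -1) {m s : ℤ} (h : levelSupport s E w m = E) {e : ℝ}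
    (he : e ∈ E) : stepFn E w m e = s ∨ stepFn E w m e = s + 1 := by
  rw [← h, levelSupport, Finset.mem_filter] at he
  have h1 := he.2
  unfold compJump level at h1
  rcases hw e he.1 with h2 | h2 <;> rw [h2] at h1 <;> split_ifs at h1 <;> omega

lemma even_card_of_sum_eq_zero {E : Finset ℝ} {w : ℝ → ℤ} (hw : ∀ e ∈ E, w e = 1 ∨ w e = -1)
    (h0 : ∑ e ∈ E, w e = 0) : Even E.card := by
  have h1 : ∀ e ∈ E, (w e : ZMod 2) = 1 := by
    intro e he
    rcases hw e he with h | h <;> rw [h] <;> decide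
  have h2 : ((∑ e ∈ E, w e : ℤ) : ZMod 2) = E.card := by
    push_cast
    rw [Finset.sum_congr rfl h1]
    simp
  rw [h0, Int.cast_zero] at h2
  exact (ZMod.natCast_eq_zero_iff_even).1 h2.symm

theorem criticalUpTo (n : ℕ) : CriticalUpTo n := by
  induction n with
  | zero =>
    intro E w m hE _ _ _ h01
    obtain rfl : E = ∅ := by simpa using hE
    have hm : ∀ u, stepFn ∅ w m u = m := fun u => by simp [stepFn]
    simp only [hm] at h01 ⊢
    rcases h01 0 ⟨le_rfl, one_pos⟩ with h | h
    · convert hasCriticalSampling_empty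
      ext u
      simp [h]
    · convert hasCriticalSampling_Ico
      ext u
      simp [h]
  | succ n ih =>
    intro E w m hE hE01 hw hw0 h01
    have hws : ∀ N, ∑ e ∈ foldSupport E N, foldJump E w N e = 0 := fun N => by
      rw [sum_foldJump, hw0]
    by_cases hinj : ∀ N : ℕ, 0 < N → Set.InjOn (fun e : ℝ => Int.fract ((N : ℝ) * e)) E
    swap
    -- Two jumps collide after this fold, so all its levels have fewer jumps.
    · push Not at hinj
      obtain ⟨N, hN, hinj⟩ := hinj
      obtain ⟨m', hm'⟩ := exists_sum_stepFn hE01 w m hN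
      refine hasCriticalSampling_of_levels h01 hN hm' fun s =>
        ih.level foldSupport_mem (hws N) _ _ ?_
      have h1 := card_foldSupport_lt hinj
      have h2 : (levelSupport s (foldSupport E N) (foldJump E w N) m').card ≤ _ :=
        Finset.card_filter_le _ _
      omega
    rcases Nat.lt_or_ge E.card 4 with h4 | h4
    -- Parity leaves no jumps, covered by the induction hypothesis, or two, which a suitable fold
    -- brings close together.
    · obtain ⟨k, hk⟩ := even_card_of_sum_eq_zero hw hw0
      rcases Nat.lt_or_ge k 1 with hk1 | hk1
      · exact ih E w m (by omega) hE01 hw hw0 h01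
      obtain ⟨a, b, hab, hEab, ha⟩ : ∃ a b, a ≠ b ∧ E = {a, b} ∧ w a = 1 := by
        obtain ⟨a, b, hab, rfl⟩ := Finset.card_eq_two.1 (by omega : E.card = 2)
        rw [Finset.sum_pair hab] at hw0
        rcases hw a (by simp) with h | h
        · exact ⟨a, b, hab, rfl, h⟩
        · exact ⟨b, a, hab.symm, Finset.pair_comm _ _, by omega⟩
      have hb : w b = -1 := by
        rw [hEab, Finset.sum_pair hab] at hw0
        omega
      have hfr : ∀ N : ℕ, Int.fract (Int.fract ((N : ℝ) * b) - Int.fract ((N : ℝ) * a)) =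
          Int.fract ((N : ℝ) * (b - a)) := by
        intro N
        rw [Int.fract_eq_fract]
        refine ⟨⌊(N : ℝ) * a⌋ - ⌊(N : ℝ) * b⌋, ?_⟩
        rw [← Int.self_sub_floor, ← Int.self_sub_floor]
        push_cast
        ring
      obtain ⟨N, hN, hN0, hN1⟩ := exists_small_fract (θ := b - a) fun N hN h => by
        rw [← Int.fract_zero (R := ℝ), Int.fract_eq_fract] at h
        obtain ⟨z, hz⟩ := h
        refine hab (hinj N hN (by simp [hEab]) (by simp [hEab]) ?_)
        refine Int.fract_eq_fract.2 ⟨-z, ?_⟩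
        push_cast
        linarith
      rw [← hfr] at hN0 hN1
      obtain ⟨m', hm'⟩ := exists_sum_stepFn hE01 w m hN
      refine hasCriticalSampling_of_levels h01 hN hm' fun s =>
        hasCriticalSampling_two_jumps (m := m') ⟨Int.fract_nonneg _, Int.fract_lt_one _⟩
          ⟨Int.fract_nonneg _, Int.fract_lt_one _⟩ hN0 hN1 (measurable_stepFn _ _ _)
          (fun u hu => ?_) s
      rw [stepFn_fold_eq _ _ _ _ hu, hEab, Finset.sum_pair hab, ha, hb]
      ring
    · obtain ⟨N, hN, hNv⟩ := exists_fold_many_values h4 hw hw0 hinj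
      obtain ⟨m', hm'⟩ := exists_sum_stepFn hE01 w m hN
      refine hasCriticalSampling_of_levels h01 hN hm' fun s =>
        ih.level foldSupport_mem (hws N) _ _ ?_
      have h1 := card_foldSupport_le E N
      -- A level crossed at every jump would confine the values at the jumps, hence all values, to s
      -- and s + 1.
      by_contra hcon
      have h2 : levelSupport s (foldSupport E N) (foldJump E w N) m' = foldSupport E N :=
        Finset.eq_of_subset_of_card_le (Finset.filter_subset _ _) (by omega)
      have h3 : ∀ e ∈ foldSupport E N, foldJump E w N e = 1 ∨ foldJump E w N e = -1 := by
        intro e he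
        obtain ⟨e, he', rfl⟩ := Finset.mem_image.1 he
        rw [foldJump_of_injOn w (hinj N hN) he']
        exact hw e he'
      obtain ⟨u, -, hu1, hu2⟩ := hNv m' s
      obtain ⟨e, he, hue⟩ := exists_mem_stepFn_eq (E := foldSupport E N) (by
        obtain ⟨e, he⟩ := Finset.card_pos.1 (by omega : 0 < E.card)
        exact ⟨_, Finset.mem_image_of_mem _ he⟩) (hws N) m' u
      rw [hue] at hu1 hu2
      rcases stepFn_mem_of_levelSupport_eq h3 h2 he with h | h
      · exact hu1 h
      · exact hu2 h

/-- Every set with finitely many boundary points in the unit interval has critical sampling. -/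
theorem hasCriticalSampling_of_piecewise {A : Set ℝ} (hA : A ⊆ Set.Ico 0 1) (B : Finset ℝ)
    (hB : ∀ u ∈ Set.Ico (0 : ℝ) 1, ∀ v ∈ Set.Ico (0 : ℝ) 1, u < v →
      (∀ b ∈ B, ¬ (u < b ∧ b ≤ v)) → (u ∈ A ↔ v ∈ A)) : HasCriticalSampling A := by
  classical
  -- Breakpoints are inserted from left to right. A new largest one, a, changes the final value from
  -- m to the value at a; p is the last breakpoint up to u.
  have key : ∀ B : Finset ℝ, (∀ b ∈ B, b ∈ Set.Ioo (0 : ℝ) 1) →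
      ∃ w : ℝ → ℤ, ∃ m : ℤ, ∀ u ∈ Set.Ico (0 : ℝ) 1, ∀ p ∈ insert 0 B, p ≤ u →
        (∀ b ∈ B, ¬ (p < b ∧ b ≤ u)) → stepFn B w m u = if p ∈ A then 1 else 0 := by
    intro B
    induction B using Finset.induction_on_max with
    | empty =>
      intro _
      refine ⟨0, if 0 ∈ A then 1 else 0, fun u _ p hp _ _ => ?_⟩
      obtain rfl : p = 0 := by simpa using hp
      simp [stepFn]
    | insert a B ha ih =>
      intro hB
      obtain ⟨w, m, h⟩ := ih fun b hb => hB b (Finset.mem_insert_of_mem hb)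
      have haB : a ∉ B := fun h => lt_irrefl _ (ha a h)
      have ha01 := hB a (Finset.mem_insert_self _ _)
      set m₁ : ℤ := if a ∈ A then 1 else 0 with hm₁
      refine ⟨Function.update w a (m₁ - m), m₁, fun u hu p hp hpu hb => ?_⟩
      have hsum : ∀ u, ∑ e ∈ B with u < e, Function.update w a (m₁ - m) e =
          ∑ e ∈ B with u < e, w e := fun u => Finset.sum_congr rfl fun e he => by
        rw [Function.update_of_ne]
        rintro rfl
        exact haB (Finset.mem_filter.1 he).1
      rcases lt_or_ge u a with hua | hua
      · have hpB : p ∈ insert 0 B := by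
          simp only [Finset.mem_insert] at hp ⊢
          rcases hp with h | h | h
          · exact Or.inl h
          · exact absurd hua (not_lt.2 (h ▸ hpu))
          · exact Or.inr h
        rw [← h u hu p hpB hpu fun b hbB => hb b (Finset.mem_insert_of_mem hbB)]
        simp only [stepFn]
        rw [Finset.filter_insert, if_pos hua, Finset.sum_insert
          (fun h => haB (Finset.mem_filter.1 h).1), hsum, Function.update_self]
        ring
      · have hpa : p = a := by
          have h1 := hb a (Finset.mem_insert_self _ _)
          have h2 : a ≤ p := not_lt.1 fun h => h1 ⟨h, hua⟩
          simp only [Finset.mem_insert] at hp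
          rcases hp with h | h | h
          · linarith [ha01.1]
          · exact h
          · exact absurd (ha p h) (not_lt.2 h2)
        simp only [stepFn]
        rw [Finset.filter_false_of_mem, Finset.sum_empty, sub_zero, hpa]
        intro b hbB
        rcases Finset.mem_insert.1 hbB with h | h
        · exact not_lt.2 (h ▸ hua)
        · exact not_lt.2 ((ha b h).le.trans hua)
  set B' := B.filter fun b => b ∈ Set.Ioo (0 : ℝ) 1 with hB'
  have hB'm : ∀ b ∈ B', b ∈ Set.Ioo (0 : ℝ) 1 := fun b hb => (Finset.mem_filter.1 hb).2
  obtain ⟨w, m, h⟩ := key B' hB'm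
  have h0 : (0 : ℝ) ∉ B' := fun h => lt_irrefl _ (hB'm 0 h).1
  -- A jump at 0 is invisible on `[0, 1)`, since `stepFn` counts only jumps beyond u. It makes the
  -- total vanish, closing the function up on the circle.
  set w' := Function.update w 0 (-∑ b ∈ B', w b) with hw'
  have hsum : ∑ b ∈ B', w' b = ∑ b ∈ B', w b := Finset.sum_congr rfl fun e he => by
    rw [hw', Function.update_of_ne]
    rintro rfl
    exact h0 he
  have hstep : ∀ u ∈ Set.Ico (0 : ℝ) 1, stepFn (insert 0 B') w' m u = if u ∈ A then 1 else 0 := by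
    intro u hu
    have hne : ((insert 0 B').filter fun b => b ≤ u).Nonempty :=
      ⟨0, Finset.mem_filter.2 ⟨Finset.mem_insert_self _ _, hu.1⟩⟩
    set p := ((insert 0 B').filter fun b => b ≤ u).max' hne with hp
    obtain ⟨hpB, hpu⟩ := Finset.mem_filter.1 (hp ▸ Finset.max'_mem _ hne)
    have hpb : ∀ b ∈ B', ¬ (p < b ∧ b ≤ u) := fun b hb hbu =>
      absurd (Finset.le_max' ((insert 0 B').filter fun b => b ≤ u) b
        (Finset.mem_filter.2 ⟨Finset.mem_insert_of_mem hb, hbu.2⟩)) (not_le.2 hbu.1)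
    have hp01 : p ∈ Set.Ico (0 : ℝ) 1 := by
      refine ⟨?_, hpu.trans_lt hu.2⟩
      rcases Finset.mem_insert.1 hpB with h | h
      · exact h.ge
      · exact (hB'm p h).1.le
    have hpA : p ∈ A ↔ u ∈ A := by
      rcases hpu.eq_or_lt with h | h
      · rw [h]
      · refine hB p hp01 u hu h fun b hb hbu => hpb b (Finset.mem_filter.2 ⟨hb, ?_⟩) hbu
        exact ⟨hp01.1.trans_lt hbu.1, hbu.2.trans_lt hu.2⟩
    rw [← if_congr hpA rfl rfl, ← h u hu p hpB hpu hpb]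
    simp only [stepFn]
    rw [Finset.filter_insert, if_neg (not_lt.2 hu.1)]
    congr 1
    refine Finset.sum_congr rfl fun e he => ?_
    rw [hw', Function.update_of_ne]
    rintro rfl
    exact h0 (Finset.mem_filter.1 he).1
  have := (criticalUpTo _).level (E := insert 0 B') (w := w') (fun e he => by
    rcases Finset.mem_insert.1 he with h | h
    · rw [h]; exact ⟨le_rfl, one_pos⟩
    · exact Set.Ioo_subset_Ico_self (hB'm e h)) (by
    rw [Finset.sum_insert h0, hsum, hw', Function.update_self]
    ring) m 0 le_rfl
  convert this
  ext u
  constructor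
  · exact fun hu => ⟨by rw [hstep u (hA hu), if_pos hu]; exact one_pos, hA hu⟩
  · rintro ⟨h1, h2⟩
    rw [hstep u h2] at h1
    by_contra hcon
    rw [if_neg hcon] at h1
    exact lt_irrefl _ h1

end CTVGS

namespace CTVGS

/-! ### Inverse Fourier transforms -/

lemma fourierInv_eq_integral_ex (z : ℝ → ℂ) (t : ℝ) : 𝓕⁻ z t = ∫ f, z f * ex (t * f) := by
  rw [Real.fourierInv_eq']
  refine integral_congr_ae (ae_of_all _ fun f => ?_)
  simp only [ex, smul_eq_mul, RCLike.inner_apply, conj_trivial]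
  rw [mul_comm]
  congr 2
  push_cast
  ring

lemma continuous_fourierInv_of_integrable {z : ℝ → ℂ} (hz : Integrable z) : Continuous (𝓕⁻ z) := by
  rw [← Real.Lp.fourierTransformInv_toLp (memLp_one_iff_integrable.2 hz)]
  exact BoundedContinuousFunction.continuous _

/-- The `L²` inverse Fourier transform of an integrable function is given by the integral. -/
lemma coeFn_fourierInv_toLp {z : ℝ → ℂ} (hz : MemLp z 2) (hz1 : Integrable z) :
    ((𝓕⁻ (hz.toLp z) : Lp ℂ 2 (volume : Measure ℝ)) : ℝ → ℂ) =ᵐ[volume] 𝓕⁻ z := by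
  have hcont := continuous_fourierInv_of_integrable hz1
  -- Both sides are tested against smooth functions of compact support. The square integrable
  -- transform moves to the test function by duality of tempered distributions, the integral by
  -- Fubini.
  refine ae_eq_of_integral_contDiff_smul_eq
    ((Lp.memLp _).locallyIntegrable one_le_two) hcont.locallyIntegrable fun g hg hgc => ?_
  have hg₁ : HasCompactSupport (Complex.ofRealCLM ∘ g) := hgc.comp_left rfl
  have hg₂ : ContDiff ℝ ((⊤ : ℕ∞) : WithTop ℕ∞) (Complex.ofRealCLM ∘ g) := Complex.ofRealCLM.contDiff.comp hg
  set G : SchwartzMap ℝ ℂ := hg₁.toSchwartzMap hg₂ with hG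
  have hGg : ∀ x, G x = (g x : ℂ) := fun x => rfl
  have h1 : Lp.toTemperedDistribution (𝓕⁻ (hz.toLp z) : Lp ℂ 2 (volume : Measure ℝ)) G =
      Lp.toTemperedDistribution (hz.toLp z) (𝓕⁻ G) := by
    rw [← Lp.fourierInv_toTemperedDistribution_eq, TemperedDistribution.fourierInv_apply]
  rw [Lp.toTemperedDistribution_apply, Lp.toTemperedDistribution_apply] at h1
  have h2 : ∫ x, (𝓕⁻ G) x • (hz.toLp z) x = ∫ x, (𝓕⁻ G) x * z x := by
    refine integral_congr_ae ?_
    filter_upwards [hz.coeFn_toLp] with x hx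
    rw [hx, smul_eq_mul]
  have h3 : ∫ x, (𝓕⁻ (G : ℝ → ℂ)) x • z x = ∫ x, (G : ℝ → ℂ) x • (𝓕⁻ z) x := by
    have := VectorFourier.integral_fourierIntegral_smul_eq_flip (L := -innerₗ ℝ)
      (μ := (volume : Measure ℝ)) (ν := (volume : Measure ℝ)) Real.continuous_fourierChar
      (continuous_inner (𝕜 := ℝ) (E := ℝ)).neg G.integrable hz1
    have hflip : (-innerₗ ℝ : ℝ →ₗ[ℝ] ℝ →ₗ[ℝ] ℝ).flip = -innerₗ ℝ := by
      ext
      simp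
    rw [hflip] at this
    exact this
  rw [h2] at h1
  simp only [smul_eq_mul, ← SchwartzMap.fourierInv_coe, hGg] at h1 h3
  simp only [Complex.real_smul]
  rw [h1, ← h3]

end CTVGS

namespace CTVGS

/-! ### Band-limited signals in terms of their joint spectrum -/

section Unitary

variable {V : Type*} [Fintype V] [DecidableEq V] {U : Matrix V V ℂ}

lemma sum_mul_star_of_unitary (hU : U ∈ Matrix.unitaryGroup V ℂ) (v w : V) :
    ∑ i, U v i * star (U w i) = if v = w then 1 else 0 := by
  have h := congrFun (congrFun (Matrix.mem_unitaryGroup_iff.1 hU) v) w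
  rw [Matrix.mul_apply, Matrix.one_apply] at h
  exact h

lemma sum_smul_sum_star_smul {H : Type*} [AddCommGroup H] [Module ℂ H]
    (hU : U ∈ Matrix.unitaryGroup V ℂ) (y : V → H) (v : V) :
    ∑ i, U v i • ∑ w, star (U w i) • y w = y v := by
  simp_rw [Finset.smul_sum, smul_smul]
  rw [Finset.sum_comm]
  simp_rw [← Finset.sum_smul, sum_mul_star_of_unitary hU, ite_smul, one_smul, zero_smul]
  simp

lemma sum_norm_sq_sum_star_smul {H : Type*} [NormedAddCommGroup H] [InnerProductSpace ℂ H]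
    (hU : U ∈ Matrix.unitaryGroup V ℂ) (y : V → H) :
    ∑ i, ‖∑ w, star (U w i) • y w‖ ^ 2 = ∑ v, ‖y v‖ ^ 2 := by
  have h : ∀ x : H, ((‖x‖ ^ 2 : ℝ) : ℂ) = inner ℂ x x := fun x => by
    rw [inner_self_eq_norm_sq_to_K]; norm_cast
  apply Complex.ofReal_injective
  push_cast [-Complex.ofReal_pow]
  simp_rw [h, sum_inner, inner_smul_left]
  rw [Finset.sum_comm]
  refine Finset.sum_congr rfl fun v _ => ?_
  have h2 := congrArg (inner ℂ (y v)) (sum_smul_sum_star_smul hU y v)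
  rw [inner_sum] at h2
  rw [← h2]
  refine Finset.sum_congr rfl fun i _ => ?_
  rw [inner_smul_right]
  simp

end Unitary

lemma enorm_toLp_sq {f : ℝ → ℂ} (hf : MemLp f 2 volume) :
    ‖hf.toLp f‖ₑ ^ 2 = ∫⁻ t, ‖f t‖ₑ ^ 2 := by
  rw [Lp.enorm_toLp]
  have := eLpNorm_nnreal_pow_eq_lintegral (f := f) (μ := volume) (p := 2) (by norm_num)
  simpa using this

/-- The spectra are made to vanish everywhere off `G i`; finite measure makes them integrable, so
the inversion integral holds at each single time. The energy identity is Plancherel's theorem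
together with unitarity. -/
theorem exists_spectrum {V : Type*} [Fintype V] [DecidableEq V] {U : Matrix V V ℂ}
    (hU : U ∈ Matrix.unitaryGroup V ℂ) {F G : V → Set ℝ} (hFG : ∀ i, F i =ᵐ[volume] G i)
    (hG : ∀ i, MeasurableSet (G i)) (hGv : ∀ i, volume (G i) ≠ ⊤) {X : V → ℝ → ℂ}
    (hX : X ∈ BL U F) :
    ∃ z : V → ℝ → ℂ, (∀ i, MemLp (z i) 2 volume) ∧ (∀ i, Integrable (z i)) ∧
      (∀ i, ∀ f ∉ G i, z i f = 0) ∧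
      (∀ v t, X v t = ∑ i, U v i * ∫ f, z i f * ex (t * f)) ∧
      normSq X = ∑ i, ∫⁻ f, ‖z i f‖ₑ ^ 2 := by
  obtain ⟨hXc, hXm, hX0⟩ := hX
  set Y : V → Lp ℂ 2 (volume : Measure ℝ) := fun v => (hXm v).toLp (X v) with hY
  set z : V → ℝ → ℂ := fun i => (G i).indicator (jft U Y i) with hz
  have hzm : ∀ i, MemLp (z i) 2 volume := fun i => (Lp.memLp _).indicator (hG i)
  have hz1 : ∀ i, Integrable (z i) := by
    intro i
    have : IsFiniteMeasure (volume.restrict (G i)) :=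
      ⟨by rw [Measure.restrict_apply_univ]; exact (hGv i).lt_top⟩
    rw [hz, integrable_indicator_iff (hG i)]
    exact ((Lp.memLp (jft U Y i)).restrict (G i)).integrable one_le_two
  have hzZ : ∀ i, (hzm i).toLp (z i) = jft U Y i := by
    intro i
    apply Lp.ext
    filter_upwards [(hzm i).coeFn_toLp, hX0 i, (hFG i).mem_iff] with f h1 h2 h3
    rw [h1]
    simp only [hz]
    by_cases h : f ∈ G i
    · rw [Set.indicator_of_mem h]
    · rw [Set.indicator_of_notMem h, h2 fun h' => h (h3.1 h')]
  refine ⟨z, hzm, hz1, fun i f hf => Set.indicator_of_notMem hf _, ?_, ?_⟩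
  · intro v
    have h1 : Y v = ∑ i, U v i • 𝓕⁻ (jft U Y i) := by
      have h2 := sum_smul_sum_star_smul hU (fun w => 𝓕 (Y w)) v
      have h3 := congrArg (Lp.fourierTransformₗᵢ ℝ ℂ).symm h2
      rw [map_sum] at h3
      simp_rw [map_smul] at h3
      exact (h3.trans ((Lp.fourierTransformₗᵢ ℝ ℂ).symm_apply_apply (Y v))).symm
    have h2 : (fun t => X v t) =ᵐ[volume] fun t => ∑ i, U v i * 𝓕⁻ (z i) t := by
      have h3 := fun i => coeFn_fourierInv_toLp (hzm i) (hz1 i)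
      have h4 := Lp.coeFn_finsetSum (Finset.univ : Finset V) fun i => U v i • 𝓕⁻ (jft U Y i)
      have h5 := fun i => Lp.coeFn_smul (U v i) (𝓕⁻ (jft U Y i))
      rw [← h1] at h4
      filter_upwards [(hXm v).coeFn_toLp, h4, ae_all_iff.2 h3, ae_all_iff.2 h5]
        with t h6 h7 h8 h9
      rw [← h6, h7]
      simp only [Finset.sum_apply]
      refine Finset.sum_congr rfl fun i _ => ?_
      rw [h9 i, Pi.smul_apply, smul_eq_mul, ← h8 i, hzZ]
    -- Both sides are continuous, so equality almost everywhere is equality at every sampling time.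
    have h3 := (Continuous.ae_eq_iff_eq volume (hXc v) (continuous_finsetSum _ fun i _ =>
      continuous_const.mul (continuous_fourierInv_of_integrable (hz1 i)))).1 h2
    intro t
    rw [h3]
    simp only [Pi.mul_apply, fourierInv_eq_integral_ex]
  · have h1 : ∀ i, ∫⁻ f, ‖z i f‖ₑ ^ 2 = ENNReal.ofReal (‖jft U Y i‖ ^ 2) := fun i => by
      rw [← enorm_toLp_sq (hzm i), hzZ, ← ofReal_norm, ENNReal.ofReal_pow (norm_nonneg _)]
    have h2 : ∀ v, ∫⁻ t, ‖X v t‖ₑ ^ 2 = ENNReal.ofReal (‖𝓕 (Y v)‖ ^ 2) := fun v => by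
      rw [← enorm_toLp_sq (hXm v), Lp.norm_fourier_eq, ← ofReal_norm,
        ENNReal.ofReal_pow (norm_nonneg _)]
    rw [normSq]
    simp_rw [h1, h2]
    rw [← ENNReal.ofReal_sum_of_nonneg fun _ _ => sq_nonneg _,
      ← ENNReal.ofReal_sum_of_nonneg fun _ _ => sq_nonneg _]
    congr 1
    exact (sum_norm_sq_sum_star_smul hU fun v => 𝓕 (Y v)).symm

end CTVGS

namespace CTVGS

/-! ### Finite unions of half-open intervals -/

/-- A set whose indicator function is piecewise constant and right continuous. -/
def IsStepSet (A : Set ℝ) : Prop :=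
  ∃ B : Finset ℝ, ∀ u v, u < v → (∀ b ∈ B, ¬ (u < b ∧ b ≤ v)) → (u ∈ A ↔ v ∈ A)

lemma ae_eq_Ico_of_ordConnected {J : Set ℝ} (hJ : J.OrdConnected) (hv : volume J ≠ ⊤) :
    J =ᵐ[volume] Set.Ico (sInf J) (sSup J) := by
  rcases J.eq_empty_or_nonempty with rfl | ⟨x, hx⟩
  -- Here `sInf ∅ = sSup ∅ = 0`, so the half-open interval is empty too.
  · simp
  have hab : BddAbove J := by
    by_contra hcon
    refine hv (top_unique ?_)
    rw [← Real.volume_Ici (a := x)]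
    refine measure_mono fun y hy => ?_
    obtain ⟨w, hw, hyw⟩ := not_bddAbove_iff.1 hcon y
    exact hJ.out hx hw ⟨hy, hyw.le⟩
  have hbb : BddBelow J := by
    by_contra hcon
    refine hv (top_unique ?_)
    rw [← Real.volume_Iic (a := x)]
    refine measure_mono fun y hy => ?_
    obtain ⟨w, hw, hyw⟩ := not_bddBelow_iff.1 hcon y
    exact hJ.out hw hx ⟨hyw.le, hy⟩
  have h1 : Set.Ioo (sInf J) (sSup J) ⊆ J := by
    intro y hy
    obtain ⟨a, ha, hay⟩ := exists_lt_of_csInf_lt ⟨x, hx⟩ hy.1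
    obtain ⟨b, hb, hyb⟩ := exists_lt_of_lt_csSup ⟨x, hx⟩ hy.2
    exact hJ.out ha hb ⟨hay.le, hyb.le⟩
  have h2 : J ⊆ Set.Icc (sInf J) (sSup J) := subset_Icc_csInf_csSup hbb hab
  refine EventuallyLE.antisymm ?_ ?_
  · exact (LE.le.eventuallyLE h2).trans Ico_ae_eq_Icc.symm.le
  · exact Ioo_ae_eq_Ico.symm.le.trans (LE.le.eventuallyLE h1)

/-- Passing to half-open intervals changes null sets only and makes the indicator function right
continuous. Empty sets stay empty, so that they cost no vertex. -/
lemma exists_stepSet {s : Set ℝ} (hs : IsFiniteUnionOfIntervals s) (hv : volume s ≠ ⊤) :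
    ∃ G : Set ℝ, IsStepSet G ∧ MeasurableSet G ∧ s =ᵐ[volume] G ∧ (s = ∅ → G = ∅) ∧
      ∃ K : ℝ, G ⊆ Set.Ico (-K) K := by
  classical
  obtain ⟨T, hT, hTo, rfl⟩ := hs
  have hTv : ∀ J ∈ T, volume J ≠ ⊤ := fun J hJ =>
    ne_top_of_le_ne_top hv (measure_mono (Set.subset_sUnion_of_mem hJ))
  refine ⟨⋃ J ∈ T, Set.Ico (sInf J) (sSup J), ?_, ?_, ?_, ?_, ?_⟩
  · refine ⟨hT.toFinset.image sInf ∪ hT.toFinset.image sSup, fun u v huv hB => ?_⟩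
    simp only [Set.mem_iUnion, Set.mem_Ico, exists_prop]
    refine exists_congr fun J => and_congr_right fun hJ => ?_
    have h1 := hB (sInf J)
      (Finset.mem_union_left _ (Finset.mem_image_of_mem _ (hT.mem_toFinset.2 hJ)))
    have h2 := hB (sSup J)
      (Finset.mem_union_right _ (Finset.mem_image_of_mem _ (hT.mem_toFinset.2 hJ)))
    constructor
    · rintro ⟨h3, h4⟩
      exact ⟨h3.trans huv.le, not_le.1 fun h => h2 ⟨h4, h⟩⟩
    · rintro ⟨h3, h4⟩
      exact ⟨not_lt.1 fun h => h1 ⟨h, h3⟩, huv.trans h4⟩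
  · exact hT.measurableSet_biUnion fun J _ => measurableSet_Ico
  · rw [Set.sUnion_eq_biUnion]
    exact Filter.EventuallyEq.countable_bUnion hT.countable fun J hJ =>
      ae_eq_Ico_of_ordConnected (hTo J hJ) (hTv J hJ)
  · intro h
    simp only [Set.iUnion_eq_empty]
    intro J hJ
    rw [Set.sUnion_eq_empty.1 h J hJ]
    simp
  · obtain ⟨K, hK⟩ := ((hT.toFinset.image fun J : Set ℝ => max (-sInf J) (sSup J))).bddAbove
    refine ⟨K, Set.iUnion₂_subset fun J hJ => ?_⟩
    have h : max (-sInf J) (sSup J) ≤ K := hK (by simpa using ⟨J, hJ, rfl⟩)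
    rw [max_le_iff] at h
    exact Set.Ico_subset_Ico (by linarith [h.1]) h.2

/-! ### Selection of vertices -/

/-- Among the equations of an injective linear system, as many as there are unknowns suffice. -/
lemma exists_finset_card_le_of_injective {V ι : Type*} [Fintype V] [Fintype ι] (R : V → ι → ℂ)
    (hR : ∀ x : ι → ℂ, (∀ v, ∑ i, R v i * x i = 0) → x = 0) :
    ∃ V' : Finset V, V'.card ≤ Fintype.card ι ∧
      ∀ x : ι → ℂ, (∀ v ∈ V', ∑ i, R v i * x i = 0) → x = 0 := by
  classical
  obtain ⟨κ, a, ha, hspan, hli⟩ := exists_linearIndependent' ℂ R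
  have : Fintype κ := Fintype.ofInjective a ha
  refine ⟨Finset.univ.image a, ?_, fun x hx => hR x fun v => ?_⟩
  · refine Finset.card_image_le.trans ?_
    have := hli.fintype_card_le_finrank
    rwa [Module.finrank_fintype_fun_eq_card] at this
  · have hmem : R v ∈ Submodule.span ℂ (Set.range (R ∘ a)) := by
      rw [hspan]
      exact Submodule.subset_span ⟨v, rfl⟩
    generalize R v = r at hmem
    induction hmem using Submodule.span_induction with
    | mem r hr =>
      obtain ⟨k, rfl⟩ := hr
      exact hx _ (Finset.mem_image_of_mem _ (Finset.mem_univ k))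
    | zero => simp
    | add r s _ _ hr hs =>
      simp only [Pi.add_apply, add_mul, Finset.sum_add_distrib, hr, hs, add_zero]
    | smul c r _ hr =>
      simp only [Pi.smul_apply, smul_eq_mul, mul_assoc, ← Finset.mul_sum, hr, mul_zero]

end CTVGS

namespace CTVGS

/-! ### Sampling of multiband vector signals -/

lemma enorm_sq_eq_ofReal (y : ℂ) : ‖y‖ₑ ^ 2 = ENNReal.ofReal (‖y‖ ^ 2) := by
  rw [← ofReal_norm, ENNReal.ofReal_pow (norm_nonneg _)]

lemma exists_row_bound {ρ κ : Type*} [Fintype ρ] [Fintype κ] (M : Matrix ρ κ ℂ) :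
    ∃ K : ℝ≥0, ∀ (x : κ → ℂ) (r : ρ),
      ‖∑ c, M r c * x c‖ₑ ^ 2 ≤ K * ∑ c, ‖x c‖ₑ ^ 2 := by
  refine ⟨∑ r, ∑ c, ‖M r c‖₊ ^ 2, fun x r => ?_⟩
  have h1 : ‖∑ c, M r c * x c‖ ^ 2 ≤ (∑ c, ‖M r c‖ ^ 2) * ∑ c, ‖x c‖ ^ 2 := by
    refine le_trans ?_ (Finset.sum_mul_sq_le_sq_mul_sq Finset.univ _ _)
    gcongr
    refine (norm_sum_le _ _).trans (Finset.sum_le_sum fun c _ => norm_mul_le _ _)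
  have h2 : ∑ c, ‖M r c‖ ^ 2 ≤ ∑ r, ∑ c, ‖M r c‖ ^ 2 :=
    Finset.single_le_sum (f := fun r => ∑ c, ‖M r c‖ ^ 2)
      (fun r _ => Finset.sum_nonneg fun c _ => sq_nonneg _) (Finset.mem_univ r)
  have h3 : ((∑ r, ∑ c, ‖M r c‖₊ ^ 2 : ℝ≥0) : ℝ≥0∞) =
      ENNReal.ofReal (∑ r, ∑ c, ‖M r c‖ ^ 2) := by
    rw [← ENNReal.ofReal_coe_nnreal]
    push_cast
    rfl
  simp_rw [enorm_sq_eq_ofReal]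
  rw [h3, ← ENNReal.ofReal_sum_of_nonneg fun _ _ => sq_nonneg _,
    ← ENNReal.ofReal_mul (Finset.sum_nonneg fun _ _ => Finset.sum_nonneg fun _ _ => sq_nonneg _)]
  refine ENNReal.ofReal_le_ofReal (h1.trans ?_)
  gcongr

section Cells

variable {a : ℤ} {N : ℕ}

lemma setLIntegral_cells (F : ℝ → ℝ≥0∞) : ∫⁻ w in Set.Ico (a : ℝ) (a + N), F w =
    ∑ k : Fin N, ∫⁻ u in Set.Ico (0 : ℝ) 1, F (u + (a + (k : ℕ))) := by
  have := setLIntegral_pieces one_pos (a : ℝ) N F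
  simpa using this

lemma setIntegral_cells {F : ℝ → ℂ} (hF : Integrable F) : ∫ w in Set.Ico (a : ℝ) (a + N), F w =
    ∑ k : Fin N, ∫ u in Set.Ico (0 : ℝ) 1, F (u + (a + (k : ℕ))) := by
  have := setIntegral_pieces one_pos (a : ℝ) N F hF.integrableOn
  simpa using this

lemma memLp_cell {z : ℝ → ℂ} (hz : MemLp z 2) (k : Fin N) :
    MemLp (fun u => z (u + (a + (k : ℕ)))) 2 unitMeasure := by
  have := memLp_piece one_pos (a : ℝ) (n := N) (f := z) (hz.restrict _) k
  simpa using this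

lemma sum_energy_cells {z : ℝ → ℂ} (h0 : ∀ f ∉ Set.Ico (a : ℝ) (a + N), z f = 0) :
    ∑ k : Fin N, energy (fun u => z (u + (a + (k : ℕ)))) = ∫⁻ f, ‖z f‖ₑ ^ 2 := by
  have h1 := setLIntegral_cells (a := a) (N := N) fun f => ‖z f‖ₑ ^ 2
  rw [← lintegral_indicator measurableSet_Ico, Set.indicator_eq_self.2] at h1
  · exact h1.symm
  · intro f hf
    by_contra hcon
    exact hf (by simp [h0 f hcon])

lemma sum_volume_cells {G : Set ℝ} (hG : MeasurableSet G) (hGI : G ⊆ Set.Ico (a : ℝ) (a + N)) :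
    ∑ k : Fin N, volume.real ({u : ℝ | u + (a + (k : ℕ)) ∈ G} ∩ Set.Ico 0 1) = volume.real G := by
  have h1 := setLIntegral_cells (a := a) (N := N) (G.indicator 1)
  rw [lintegral_indicator_one hG, Measure.restrict_apply hG, Set.inter_eq_left.2 hGI] at h1
  have hm : ∀ k : Fin N, MeasurableSet {u : ℝ | u + (a + (k : ℕ)) ∈ G} := fun k =>
    hG.preimage (by fun_prop : Measurable fun u : ℝ => u + (a + (k : ℕ)))
  have h3 : ∀ k : Fin N, ∫⁻ u in Set.Ico (0 : ℝ) 1,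
      G.indicator (1 : ℝ → ℝ≥0∞) (u + (a + (k : ℕ))) =
      volume ({u : ℝ | u + (a + (k : ℕ)) ∈ G} ∩ Set.Ico 0 1) := by
    intro k
    rw [← Measure.restrict_apply (hm k), ← lintegral_indicator_one (hm k)]
    rfl
  simp_rw [h3] at h1
  simp only [Measure.real]
  rw [h1, ENNReal.toReal_sum fun k _ => ((measure_mono Set.inter_subset_right).trans_lt
    (by simp : volume (Set.Ico (0 : ℝ) 1) < ⊤)).ne]

lemma ex_add_intCast_mul (n : ℤ) (u : ℝ) (k : Fin N) : ex (n * (u + (a + (k : ℕ)))) = ex (n * u) := by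
  have : (n : ℝ) * (u + (a + (k : ℕ))) = n * u + ((n * (a + (k : ℕ)) : ℤ) : ℝ) := by
    push_cast; ring
  rw [this, ex_add, ex_intCast, mul_one]

/-- On cell k the phase at time n + s/N is a character in u, times a modulation independent of k,
times a DFT entry, because n (a + k) is an integer. -/
lemma integral_mul_ex_cells {z : ℝ → ℂ} (hz : Integrable z)
    (h0 : ∀ f ∉ Set.Ico (a : ℝ) (a + N), z f = 0) (n : ℤ) (s : Fin N) :
    ∫ f, z f * ex ((n + (s : ℕ) / N) * f) = ∑ k : Fin N, ∫ u in Set.Ico (0 : ℝ) 1,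
      ex ((s : ℕ) / N * (u + a)) * (dft N s k * z (u + (a + (k : ℕ)))) * ex (n * u) := by
  have h1 := setIntegral_cells (a := a) (N := N) (integrable_mul_ex hz (n + (s : ℕ) / N))
  rw [← integral_indicator measurableSet_Ico, Set.indicator_eq_self.2] at h1
  swap
  · intro f hf
    by_contra hcon
    exact hf (by simp [h0 f hcon])
  rw [h1]
  refine Finset.sum_congr rfl fun k _ => integral_congr_ae (ae_of_all _ fun u => ?_)
  have h2 : ((n : ℝ) + (s : ℕ) / N) * (u + (a + (k : ℕ))) = n * (u + (a + (k : ℕ))) +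
      ((s : ℕ) / N * (u + a) + (s : ℕ) * ((k : ℕ) / N)) := by ring
  simp only
  rw [h2, ex_add, ex_add, ex_add_intCast_mul, dft_apply, ex_pow]
  ring

end Cells

section BandMatrix

variable {W ι : Type*} (R : W → ι → ℂ)

/-- The matrix which sends the pieces of the spectra, cut at the integers, to the `N` shifts of the
signals. -/
noncomputable def bandMatrix (N : ℕ) : Matrix (W × Fin N) (ι × Fin N) ℂ :=
  Matrix.of fun r c => R r.1 c.1 * dft N r.2 c.2

lemma bandMatrix_apply (N : ℕ) (r : W × Fin N) (c : ι × Fin N) :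
    bandMatrix R N r c = R r.1 c.1 * dft N r.2 c.2 := rfl

variable [Fintype ι]

lemma bandMatrix_mulVec (N : ℕ) (x : ι × Fin N → ℂ) (v : W) (s : Fin N) :
    (bandMatrix R N).mulVec x (v, s) =
      (dft N).mulVec (fun k => ∑ i, R v i * x (i, k)) s := by
  simp only [Matrix.mulVec, dotProduct, bandMatrix_apply, Fintype.sum_prod_type]
  rw [Finset.sum_comm]
  refine Finset.sum_congr rfl fun k _ => ?_
  rw [Finset.mul_sum]
  exact Finset.sum_congr rfl fun i _ => by ring

variable {R}

/-- The matrix is a tensor product: the DFT is undone for each vertex, then `R` for each cell. -/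
lemma bandMatrix_mulVec_injective (hR : ∀ x : ι → ℂ, (∀ v, ∑ i, R v i * x i = 0) → x = 0)
    (N : ℕ) : Function.Injective (bandMatrix R N).mulVec := by
  rw [← Matrix.coe_mulVecLin, ← LinearMap.ker_eq_bot, LinearMap.ker_eq_bot']
  intro x hx
  have h1 : ∀ v k, ∑ i, R v i * x (i, k) = 0 := by
    intro v
    have h2 : (dft N).mulVec (fun k => ∑ i, R v i * x (i, k)) = 0 := by
      ext s
      rw [← bandMatrix_mulVec]
      exact congrFun hx (v, s)
    exact congrFun (dft_mulVec_injective N (h2.trans (Matrix.mulVec_zero _).symm))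
  ext ⟨i, k⟩
  exact congrFun (hR (fun i => x (i, k)) fun v => h1 v k) i

lemma fint_bandMatrix {a : ℤ} {N : ℕ} {z : ι → ℝ → ℂ} (hz : ∀ i, MemLp (z i) 2)
    (hz1 : ∀ i, Integrable (z i)) (h0 : ∀ i, ∀ f ∉ Set.Ico (a : ℝ) (a + N), z i f = 0)
    (r : W × Fin N) (n : ℤ) :
    fint (fun u => ex ((r.2 : ℕ) / N * (u + a)) *
      ∑ c, bandMatrix R N r c * z c.1 (u + (a + (c.2 : ℕ)))) n =
      ∑ i, R r.1 i * ∫ f, z i f * ex ((n + (r.2 : ℕ) / N) * f) := by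
  have hint : ∀ c : ι × Fin N, Integrable (fun u => ex ((r.2 : ℕ) / N * (u + a)) *
      (dft N r.2 c.2 * z c.1 (u + (a + (c.2 : ℕ)))) * ex (n * u)) unitMeasure := by
    intro c
    refine integrable_mul_ex ?_ n
    refine ((memLp_cell (hz c.1) c.2).integrable_unit.const_mul (dft N r.2 c.2)).bdd_mul (c := 1)
      ?_ (ae_of_all _ fun u => (norm_ex _).le)
    exact (continuous_ex.comp (by fun_prop)).aestronglyMeasurable
  have h1 : ∀ i, R r.1 i * ∫ f, z i f * ex ((n + (r.2 : ℕ) / N) * f) =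
      ∑ k : Fin N, ∫ u in Set.Ico (0 : ℝ) 1, R r.1 i * (ex ((r.2 : ℕ) / N * (u + a)) *
        (dft N r.2 k * z i (u + (a + (k : ℕ)))) * ex (n * u)) := by
    intro i
    rw [integral_mul_ex_cells (hz1 i) (h0 i), Finset.mul_sum]
    exact Finset.sum_congr rfl fun k _ => (integral_const_mul _ _).symm
  simp_rw [h1]
  rw [← Fintype.sum_prod_type' (f := fun i (k : Fin N) => ∫ u in Set.Ico (0 : ℝ) 1,
    R r.1 i * (ex ((r.2 : ℕ) / N * (u + a)) *
        (dft N r.2 k * z i (u + (a + (k : ℕ)))) * ex (n * u))),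
    ← integral_finsetSum _ fun c _ => (hint c).const_mul _]
  refine integral_congr_ae (ae_of_all _ fun u => ?_)
  simp only [bandMatrix_apply]
  rw [Finset.mul_sum, Finset.sum_mul]
  exact Finset.sum_congr rfl fun c _ => by ring

end BandMatrix

/-- Bessel's inequality for each row, whatever the sets `Λ r`, and boundedness of the matrix. -/
lemma exists_upper_bound {ρ κ : Type*} [Fintype ρ] [Fintype κ] (M : Matrix ρ κ ℂ)
    (φ : ρ → ℝ → ℂ) (hφ : ∀ r u, ‖φ r u‖ₑ = 1) (hφc : ∀ r, Continuous (φ r)) (Λ : ρ → Set ℤ) :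
    ∃ K : ℝ≥0, ∀ x : κ → ℝ → ℂ, (∀ c, MemLp (x c) 2 unitMeasure) →
      ∑ r, ∑' m : Λ r, ‖fint (fun u => φ r u * ∑ c, M r c * x c u) (m : ℤ)‖ₑ ^ 2 ≤
        K * ∑ c, energy (x c) := by
  obtain ⟨K, hK⟩ := exists_row_bound M
  refine ⟨Fintype.card ρ * K, fun x hx => ?_⟩
  have hr : ∀ r, ∑' m : Λ r, ‖fint (fun u => φ r u * ∑ c, M r c * x c u) (m : ℤ)‖ₑ ^ 2 ≤
      K * ∑ c, energy (x c) := by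
    intro r
    have hg : MemLp (fun u => φ r u * ∑ c, M r c * x c u) 2 unitMeasure := by
      have h1 : MemLp (fun u => ∑ c, M r c * x c u) 2 unitMeasure :=
        memLp_finsetSum _ fun c _ => (hx c).const_mul (M r c)
      refine MemLp.of_le_enorm h1 ((hφc r).aestronglyMeasurable.mul h1.1) (ae_of_all _ fun u => ?_)
      rw [enorm_mul, hφ, one_mul]
    refine (tsum_fint_sq_le hg _).trans ?_
    unfold energy
    rw [← lintegral_finsetSum' _ fun c _ => (hx c).1.enorm.pow_const 2,
      ← lintegral_const_mul' _ _ ENNReal.coe_ne_top]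
    refine lintegral_mono fun u => ?_
    simp only [enorm_mul, hφ, one_mul]
    exact hK (fun c => x c u) r
  refine (Finset.sum_le_sum fun r _ => hr r).trans_eq ?_
  rw [Finset.sum_const, Finset.card_univ, nsmul_eq_mul, ← mul_assoc]
  push_cast
  rfl

/-- A lower and an upper sampling bound at the critical rate for vectors of functions with spectra in
given bounded sets, which are observed through linear functionals and `N` shifts of the integers. -/
theorem exists_multiband_sampling {W ι : Type*} [Fintype W] [Fintype ι] (R : W → ι → ℂ)
    (hR : ∀ x : ι → ℂ, (∀ v, ∑ i, R v i * x i = 0) → x = 0) {G : ι → Set ℝ}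
    (hGs : ∀ i, IsStepSet (G i)) (hGm : ∀ i, MeasurableSet (G i)) {a : ℤ} {N : ℕ}
    (hG : ∀ i, G i ⊆ Set.Ico (a : ℝ) (a + N)) :
    ∃ (Λ : W × Fin N → Set ℤ) (d : W × Fin N → ℝ),
      (∀ r, UniformDensity (((↑) : ℤ → ℝ) '' Λ r) (d r)) ∧ ∑ r, d r = ∑ i, volume.real (G i) ∧
      ∃ C₁ C₂ : ℝ≥0, ∀ z : ι → ℝ → ℂ, (∀ i, MemLp (z i) 2) → (∀ i, Integrable (z i)) →
        (∀ i, ∀ f ∉ G i, z i f = 0) →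
        ∑ i, ∫⁻ f, ‖z i f‖ₑ ^ 2 ≤ C₁ * ∑ r : W × Fin N, ∑' n : Λ r,
          ‖∑ i, R r.1 i * ∫ f, z i f * ex (((n : ℤ) + (r.2 : ℕ) / N) * f)‖ₑ ^ 2 ∧
        ∑ r : W × Fin N, ∑' n : Λ r,
          ‖∑ i, R r.1 i * ∫ f, z i f * ex (((n : ℤ) + (r.2 : ℕ) / N) * f)‖ₑ ^ 2 ≤
          C₂ * ∑ i, ∫⁻ f, ‖z i f‖ₑ ^ 2 := by
  classical
  -- Greedy selection needs the rows in a linear order; any order will do.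
  set ρ := (Fintype.equivFin (W × Fin N)).symm with hρ
  set M : Matrix (Fin (Fintype.card (W × Fin N))) (ι × Fin N) ℂ :=
    (bandMatrix R N).submatrix ρ id with hM
  have hMinj : Function.Injective M.mulVec := by
    intro x y hxy
    refine bandMatrix_mulVec_injective hR N (funext fun r => ?_)
    have := congrFun hxy (ρ.symm r)
    simpa [hM, Matrix.mulVec, dotProduct] using this
  set C : ℝ → Finset (ι × Fin N) := fun u =>
    Finset.univ.filter fun c => u + (a + (c.2 : ℕ)) ∈ G c.1 with hC
  have hCmem : ∀ u c, c ∈ C u ↔ u + (a + (c.2 : ℕ)) ∈ G c.1 := fun u c => by simp [hC]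
  have hCmeas : ∀ c, MeasurableSet {u | c ∈ C u} := fun c => by
    simp only [hCmem]
    exact (hGm c.1).preimage (by fun_prop : Measurable fun u : ℝ => u + (a + (c.2 : ℕ)))
  have hmeas : ∀ r, MeasurableSet {u | r ∈ greedyRows M (C u)} := fun r =>
    measurableSet_of_finset hCmeas fun D => r ∈ greedyRows M D
  choose B hB using hGs
  -- C(u) changes only where some translate of u crosses a breakpoint of some `G i`, so the greedy
  -- sets have finitely many breakpoints.
  have hcrit : ∀ r, HasCriticalSampling ({u | r ∈ greedyRows M (C u)} ∩ Set.Ico 0 1) := by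
    intro r
    refine hasCriticalSampling_of_piecewise Set.inter_subset_right
      (Finset.univ.biUnion fun c : ι × Fin N => (B c.1).image fun b => b - (a + (c.2 : ℕ)))
      fun u hu v hv huv hb => ?_
    have : C u = C v := by
      ext c
      rw [hCmem, hCmem]
      refine hB c.1 _ _ (by linarith) fun b hbB hbu => hb (b - (a + (c.2 : ℕ))) ?_ ?_
      · exact Finset.mem_biUnion.2 ⟨c, Finset.mem_univ _, Finset.mem_image_of_mem _ hbB⟩
      · constructor <;> linarith [hbu.1, hbu.2]
    simp only [Set.mem_inter_iff, Set.mem_ofPred_eq, this, hu, hv]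
  choose Λ hΛ hΛd using hcrit
  set φ : Fin (Fintype.card (W × Fin N)) → ℝ → ℂ := fun r u =>
    ex (((ρ r).2 : ℕ) / N * (u + a)) with hφ
  obtain ⟨K₁, hK₁⟩ := exists_elimination_bound M hMinj C φ (fun r u => enorm_ex _)
    (fun r => continuous_ex.comp (by fun_prop)) Λ hmeas
    fun r => (hΛ r).mono fun u hu hur => ⟨hur, hu⟩
  obtain ⟨K₂, hK₂⟩ := exists_upper_bound M φ (fun r u => enorm_ex _)
    (fun r => continuous_ex.comp (by fun_prop)) Λ
  refine ⟨fun r => Λ (ρ.symm r), fun r => volume.real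
    ({u | ρ.symm r ∈ greedyRows M (C u)} ∩ Set.Ico 0 1), fun r => hΛd _, ?_,
    K₁, K₂, fun z hz hz1 hz0 => ?_⟩
  · rw [Equiv.sum_comp ρ.symm fun r => volume.real ({u | r ∈ greedyRows M (C u)} ∩ Set.Ico 0 1),
      sum_volume_eq_of_ncard_eq hmeas hCmeas, Fintype.sum_prod_type]
    · simp only [hCmem]
      exact Finset.sum_congr rfl fun i _ => sum_volume_cells (hGm i) (hG i)
    · intro u _
      have h1 := ncard_greedyRows M hMinj (C u)
      rw [← Set.ncard_coe_finset] at h1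
      exact h1
  · have hz0' : ∀ i, ∀ f ∉ Set.Ico (a : ℝ) (a + N), z i f = 0 := fun i f hf =>
      hz0 i f fun h => hf (hG i h)
    set x : ι × Fin N → ℝ → ℂ := fun c u => z c.1 (u + (a + (c.2 : ℕ))) with hx
    have hxm : ∀ c, MemLp (x c) 2 unitMeasure := fun c => memLp_cell (hz c.1) c.2
    have hxe : ∑ c, energy (x c) = ∑ i, ∫⁻ f, ‖z i f‖ₑ ^ 2 := by
      rw [Fintype.sum_prod_type]
      refine Finset.sum_congr rfl fun i _ => ?_
      simp only [hx]
      exact sum_energy_cells (z := z i) (hz0' i)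
    have hsum : ∑ r : W × Fin N, ∑' n : Λ (ρ.symm r),
          ‖∑ i, R r.1 i * ∫ f, z i f * ex (((n : ℤ) + (r.2 : ℕ) / N) * f)‖ₑ ^ 2 =
        ∑ r, ∑' m : Λ r, ‖fint (fun u => φ r u * ∑ c, M r c * x c u) (m : ℤ)‖ₑ ^ 2 := by
      rw [← Equiv.sum_comp ρ]
      refine Finset.sum_congr rfl fun r _ => ?_
      rw [Equiv.symm_apply_apply]
      refine tsum_congr fun m => ?_
      rw [← fint_bandMatrix hz hz1 hz0']
      simp only [hM, hx, hφ, Matrix.submatrix_apply, id_eq]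
    rw [hsum, ← hxe]
    exact ⟨hK₁ x hxm fun u _ c hc => hz0 c.1 _ fun h => hc ((hCmem u c).2 h), hK₂ x hxm⟩

end CTVGS

namespace CTVGS

/-! ### Critical sampling of band-limited graph signals -/

section Density

variable {V ρ : Type*} [Fintype ρ] {T : ρ → Set ℝ} {v : ρ → V} {d : ρ → ℝ}

lemma isSamplingSet_iUnion (hT : ∀ r, UniformDensity (T r) (d r)) :
    IsSamplingSet (⋃ r, Prod.mk (v r) '' T r) := by
  intro w t
  choose K hK using hT
  rcases le_or_gt (-t) t with h | h
  · refine (Set.finite_iUnion fun r => (hK r (-t) t h).1).subset ?_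
    rintro s ⟨hs, hst⟩
    obtain ⟨r, s', hs', h⟩ := Set.mem_iUnion.1 hs
    obtain ⟨-, rfl⟩ := Prod.mk.inj h
    exact Set.mem_iUnion.2 ⟨r, hs', hst⟩
  · convert Set.finite_empty
    ext s
    simp only [Set.Icc_eq_empty (not_le.2 h), Set.mem_ofPred_eq, Set.mem_empty_iff_false, and_false]

/-- The count is 2t times the sum of the `d r`, up to a bounded error, so the lower limit is a
limit. -/
lemma density_iUnion [Fintype V] [Nonempty V] (hT : ∀ r, UniformDensity (T r) (d r))
    (hdisj : Pairwise (Function.onFun Disjoint fun r => Prod.mk (v r) '' T r)) :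
    density (⋃ r, Prod.mk (v r) '' T r) =
      ENNReal.ofReal (∑ r, d r) / (Fintype.card V : ℝ≥0∞) := by
  choose K hK using hT
  have hN : (0 : ℝ) < Fintype.card V := by exact_mod_cast Fintype.card_pos
  set n : ℝ → ℕ := fun t => ∑ r, (T r ∩ Set.Icc (-t) t).ncard with hn
  have hcount : ∀ t : ℝ, 0 < t →
      ((⋃ r, Prod.mk (v r) '' T r) ∩ Set.univ ×ˢ Set.Icc (-t) t).encard = n t := by
    intro t ht
    have hfin := fun r => (hK r (-t) t (by linarith)).1
    have h1 : (⋃ r, Prod.mk (v r) '' T r) ∩ Set.univ ×ˢ Set.Icc (-t) t =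
        ⋃ r, Prod.mk (v r) '' (T r ∩ Set.Icc (-t) t) := by
      rw [Set.iUnion_inter]
      refine Set.iUnion_congr fun r => ?_
      ext ⟨w, s⟩
      simp only [Set.mem_inter_iff, Set.mem_image, Set.mem_prod, Set.mem_univ, true_and,
        Prod.mk.injEq]
      constructor
      · rintro ⟨⟨s, hs, hw, rfl⟩, hst⟩
        exact ⟨s, ⟨hs, hst⟩, hw, rfl⟩
      · rintro ⟨s, ⟨hs, hst⟩, hw, rfl⟩
        exact ⟨⟨s, hs, hw, rfl⟩, hst⟩
    have h2 : ∀ r, (Prod.mk (v r) '' (T r ∩ Set.Icc (-t) t)).Finite := fun r => (hfin r).image _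
    rw [h1, ← (Set.finite_iUnion h2).cast_ncard_eq, Set.ncard_iUnion_of_finite h2,
      finsum_eq_sum_of_fintype]
    · congr 1
      exact Finset.sum_congr rfl fun r _ =>
        Set.ncard_image_of_injective _ (Prod.mk_right_injective (v r))
    · exact fun r s hrs => (hdisj hrs).mono (Set.image_mono Set.inter_subset_left)
        (Set.image_mono Set.inter_subset_left)
  have hn' : ∀ t : ℝ, 0 < t → |(n t : ℝ) - (∑ r, d r) * (2 * t)| ≤ ∑ r, K r := by
    intro t ht
    simp only [hn]
    push_cast
    rw [Finset.sum_mul, ← Finset.sum_sub_distrib]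
    refine (Finset.abs_sum_le_sum_abs _ _).trans (Finset.sum_le_sum fun r _ => ?_)
    have := (hK r (-t) t (by linarith)).2
    rwa [sub_neg_eq_add, ← two_mul] at this
  have hlim : Tendsto (fun t : ℝ => (n t : ℝ) / (2 * t * Fintype.card V)) atTop
      (nhds ((∑ r, d r) / Fintype.card V)) := by
    rw [tendsto_iff_dist_tendsto_zero]
    have h1 : Tendsto (fun t : ℝ => (∑ r, K r) / (2 * Fintype.card V) / t) atTop (nhds 0) :=
      tendsto_const_nhds.div_atTop tendsto_id
    refine squeeze_zero' (Eventually.of_forall fun t => dist_nonneg) ?_ h1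
    filter_upwards [eventually_gt_atTop 0] with t ht
    have h2 : (n t : ℝ) / (2 * t * Fintype.card V) - (∑ r, d r) / Fintype.card V =
        ((n t : ℝ) - (∑ r, d r) * (2 * t)) / (2 * t * Fintype.card V) := by
      field_simp
    have h3 : (∑ r, K r) / (2 * Fintype.card V) / t = (∑ r, K r) / (2 * t * Fintype.card V) := by
      rw [div_div]; ring_nf
    rw [Real.dist_eq, h2, abs_div, abs_of_pos (by positivity : 0 < 2 * t * Fintype.card V), h3]
    gcongr
    exact hn' t ht
  have hlim' := (ENNReal.continuous_ofReal.tendsto _).comp hlim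
  rw [ENNReal.ofReal_div_of_pos hN, ENNReal.ofReal_natCast] at hlim'
  refine Tendsto.liminf_eq (hlim'.congr' ?_)
  filter_upwards [eventually_gt_atTop 0] with t ht
  rw [hcount t ht, Function.comp_apply, ENNReal.ofReal_div_of_pos (by positivity),
    ENNReal.ofReal_natCast]
  simp

lemma sampleEnergy_iUnion (hdisj : Pairwise (Function.onFun Disjoint fun r => Prod.mk (v r) '' T r))
    (X : V → ℝ → ℂ) : sampleEnergy (⋃ r, Prod.mk (v r) '' T r) X =
      ∑ r, ∑' t : T r, ‖X (v r) t‖ₑ ^ 2 := by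
  rw [sampleEnergy, ENNReal.tsum_biUnion (f := fun p : V × ℝ => ‖X p.1 p.2‖ₑ ^ 2)
    fun i _ j _ hij => hdisj hij, tsum_fintype]
  exact Finset.sum_congr rfl fun r _ =>
    tsum_image (fun p : V × ℝ => ‖X p.1 p.2‖ₑ ^ 2) (Prod.mk_right_injective (v r)).injOn

end Density

/-- The integers in `Λ`, translated by `τ`. -/
def translate (Λ : Set ℤ) (τ : ℝ) : Set ℝ := (fun x => 1 * x + τ) '' (((↑) : ℤ → ℝ) '' Λ)

lemma tsum_translate (Λ : Set ℤ) (τ : ℝ) (f : ℝ → ℝ≥0∞) :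
    ∑' t : translate Λ τ, f t = ∑' n : Λ, f ((n : ℤ) + τ) := by
  rw [translate, tsum_image f (fun x _ y _ h => by simpa using h),
    tsum_image (fun x => f (1 * x + τ)) Int.cast_injective.injOn]
  simp

/-- On one vertex, N times a sampling time is an integer congruent to s modulo N, so different
shifts never meet. -/
lemma disjoint_translate {V : Type*} {N : ℕ} {v w : V} {s s' : Fin N} (h : (v, s) ≠ (w, s'))
    (Λ Λ' : Set ℤ) : Disjoint (Prod.mk v '' translate Λ ((s : ℕ) / N))
      (Prod.mk w '' translate Λ' ((s' : ℕ) / N)) := by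
  rw [Set.disjoint_left]
  rintro _ ⟨_, ⟨_, ⟨n, -, rfl⟩, rfl⟩, rfl⟩ ⟨_, ⟨_, ⟨n', -, rfl⟩, rfl⟩, h'⟩
  obtain ⟨hw, hs⟩ := Prod.mk.inj h'
  have hN : (N : ℝ) ≠ 0 := by
    have := s.pos
    positivity
  refine h (Prod.ext hw.symm ?_)
  field_simp at hs
  have h1 : (s : ℤ) + N * n = s' + N * n' := by
    have : ((s : ℕ) : ℝ) + N * n = (s' : ℕ) + N * n' := by linarith
    exact_mod_cast this
  have h2 := congrArg (· % (N : ℤ)) h1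
  simp only [Int.add_mul_emod_self_left] at h2
  rw [Int.emod_eq_of_lt (by positivity) (by exact_mod_cast s.2),
    Int.emod_eq_of_lt (by positivity) (by exact_mod_cast s'.2)] at h2
  exact Fin.ext (by exact_mod_cast h2)

lemma sum_subtype_eq {V M : Type*} [Fintype V] [AddCommMonoid M] (p : V → Prop)
    [Fintype {i // p i}] (f : V → M) (hf : ∀ i, ¬ p i → f i = 0) :
    ∑ i : {i // p i}, f i = ∑ i, f i := by
  classical
  rw [← Finset.sum_subtype (Finset.univ.filter p) (by simp) f]
  exact Finset.sum_filter_of_ne fun i _ hi => by_contra fun h => hi (hf i h)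

lemma eq_zero_of_unitary {V : Type*} [Fintype V] [DecidableEq V] {U : Matrix V V ℂ}
    (hU : U ∈ Matrix.unitaryGroup V ℂ) {p : V → Prop} [Fintype {i // p i}] {x : {i // p i} → ℂ}
    (hx : ∀ v, ∑ i : {i // p i}, U v i * x i = 0) : x = 0 := by
  ext j
  have h : ∀ i, ∑ v, star (U v j) * U v i = if (j : V) = i then 1 else 0 := fun i => by
    have h := congrFun (congrFun (Matrix.mem_unitaryGroup_iff'.1 hU) j) i
    rw [Matrix.mul_apply, Matrix.one_apply] at h
    exact h
  calc x j = ∑ i : {i // p i}, (∑ v, star (U v j) * U v i) * x i := by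
        simp_rw [h, Subtype.coe_inj]
        simp
    _ = ∑ v, star (U v j) * ∑ i : {i // p i}, U v i * x i := by
        simp_rw [Finset.sum_mul, Finset.mul_sum]
        rw [Finset.sum_comm]
        simp_rw [mul_assoc]
    _ = 0 := by simp [hx]

lemma vertexBandwidth_eq {V : Type*} (F : V → Set ℝ) [Fintype {i // (F i).Nonempty}] :
    vertexBandwidth F = Fintype.card {i // (F i).Nonempty} := by
  rw [vertexBandwidth, ← Nat.card_eq_fintype_card]
  change Set.ncard _ = Set.ncard {i | (F i).Nonempty}
  congr 1
  ext i
  simp [Set.Nonempty]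

end CTVGS

/-! ### Assembly of the sampling set. -/

theorem mainTheorem3 {V : Type*} [Fintype V] [DecidableEq V]
    (W : Matrix V V ℝ) (hW : W.IsSymm)
    (U : Matrix V V ℂ) (hU : CTVGS.IsGraphFourierBasis W U)
    (F : V → Set ℝ) (hF : ∀ i, CTVGS.IsFiniteUnionOfIntervals (F i))
    (hB : CTVGS.jointBandwidth F < ⊤) :
    ∃ S : Set (V × ℝ), CTVGS.IsCriticalSamplingSet U F S ∧
      (CTVGS.vertexProjection S).ncard ≤ CTVGS.vertexBandwidth F := by
  classical
  have hFv : ∀ i, volume (F i) ≠ ⊤ := fun i =>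
    ((Finset.single_le_sum (f := fun i => volume (F i)) (fun i _ => zero_le) (Finset.mem_univ i)).trans_lt hB).ne
  choose G hGs hGm hFG hG0 K₀ hK₀ using fun i => CTVGS.exists_stepSet (hF i) (hFv i)
  have hGv : ∀ i, volume (G i) ≠ ⊤ := fun i => by rw [← measure_congr (hFG i)]; exact hFv i
  obtain ⟨K, hK⟩ : ∃ K : ℕ, ∀ i, K₀ i ≤ K := by
    obtain ⟨K', hK'⟩ := (Set.finite_range K₀).bddAbove
    obtain ⟨K, hK⟩ := exists_nat_ge K'
    exact ⟨K, fun i => (hK' ⟨i, rfl⟩).trans hK⟩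
  have hG : ∀ i, G i ⊆ Set.Ico ((-K : ℤ) : ℝ) ((-K : ℤ) + (2 * K : ℕ)) := fun i =>
    (hK₀ i).trans (Set.Ico_subset_Ico (by push_cast; linarith [hK i])
      (by push_cast; linarith [hK i]))
  -- Spectra with empty `F i` vanish. Only B_G columns of `U` remain, and as many rows suffice to
  -- keep them independent.
  set ι := {i // (F i).Nonempty} with hι
  obtain ⟨V', hV'c, hV'⟩ := CTVGS.exists_finset_card_le_of_injective
    (fun (v : V) (i : ι) => U v i) fun x hx => CTVGS.eq_zero_of_unitary hU.1 hx
  obtain ⟨Λ, d, hΛ, hd, C₁, C₂, hC⟩ := CTVGS.exists_multiband_sampling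
    (fun (v : V') (i : ι) => U v i) (fun x hx => hV' x fun v hv => hx ⟨v, hv⟩)
    (G := fun i : ι => G i) (fun i => hGs i) (fun i => hGm i) (fun i => hG i)
  set T : V' × Fin (2 * K) → Set ℝ := fun r => CTVGS.translate (Λ r) ((r.2 : ℕ) / (2 * K : ℕ))
    with hT
  have hTd : ∀ r, CTVGS.UniformDensity (T r) (d r) := fun r => by
    have := (hΛ r).affine one_pos ((r.2 : ℕ) / (2 * K : ℕ))
    rwa [div_one] at this
  have hdisj : Pairwise (Function.onFun Disjoint fun r : V' × Fin (2 * K) =>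
      Prod.mk (r.1 : V) '' T r) := fun r r' hrr =>
    CTVGS.disjoint_translate (fun h => hrr (by
      obtain ⟨h1, h2⟩ := Prod.mk.inj h
      exact Prod.ext (Subtype.ext h1) h2)) _ _
  -- The lower constant is the inverse of C₁ + 1, which is positive even when C₁ = 0.
  refine ⟨⋃ r : V' × Fin (2 * K), Prod.mk (r.1 : V) '' T r,
    ⟨⟨CTVGS.isSamplingSet_iUnion hTd, (C₁ + 1)⁻¹, C₂, by positivity, fun X hX => ?_⟩, ?_⟩, ?_⟩
  · obtain ⟨z, hz, hz1, hz0, hXz, hXn⟩ := CTVGS.exists_spectrum hU.1 hFG hGm hGv hX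
    have hzero : ∀ i, ¬ (F i).Nonempty → ∀ f, z i f = 0 := fun i hi f =>
      hz0 i f (by rw [hG0 i (Set.not_nonempty_iff_eq_empty.1 hi)]; exact Set.notMem_empty f)
    have hn : CTVGS.normSq X = ∑ i : ι, ∫⁻ f, ‖z i f‖ₑ ^ 2 := by
      rw [hXn, CTVGS.sum_subtype_eq _ (fun i => ∫⁻ f, ‖z i f‖ₑ ^ 2)]
      intro i hi
      simp [hzero i hi]
    have hS : CTVGS.sampleEnergy (⋃ r : V' × Fin (2 * K), Prod.mk (r.1 : V) '' T r) X =
        ∑ r : V' × Fin (2 * K), ∑' n : Λ r, ‖∑ i : ι, U r.1 i *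
          ∫ f, z i f * CTVGS.ex (((n : ℤ) + (r.2 : ℕ) / (2 * K : ℕ)) * f)‖ₑ ^ 2 := by
      rw [CTVGS.sampleEnergy_iUnion hdisj]
      refine Finset.sum_congr rfl fun r _ => ?_
      rw [CTVGS.tsum_translate _ _ fun t => ‖X r.1 t‖ₑ ^ 2]
      refine tsum_congr fun n => ?_
      rw [hXz, CTVGS.sum_subtype_eq _ (fun i => U r.1 i *
        ∫ f, z i f * CTVGS.ex (((n : ℤ) + (r.2 : ℕ) / (2 * K : ℕ)) * f))]
      intro i hi
      simp [hzero i hi]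
    obtain ⟨h1, h2⟩ := hC (fun i => z i) (fun i => hz i) (fun i => hz1 i) fun i => hz0 i
    rw [← hn, ← hS] at h1 h2
    refine ⟨?_, h2⟩
    rw [ENNReal.coe_inv (by positivity)]
    refine ENNReal.inv_mul_le_iff (by simp) (by simp) |>.2 (h1.trans ?_)
    gcongr
    exact_mod_cast le_self_add
  · have hsum : CTVGS.jointBandwidth F = ENNReal.ofReal (∑ r, d r) := by
      rw [hd, ENNReal.ofReal_sum_of_nonneg fun _ _ => measureReal_nonneg,
        CTVGS.sum_subtype_eq _ (fun i => ENNReal.ofReal (volume.real (G i)))]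
      · refine Finset.sum_congr rfl fun i _ => ?_
        rw [measure_congr (hFG i), ofReal_measureReal (hGv i)]
      · intro i hi
        simp [hG0 i (Set.not_nonempty_iff_eq_empty.1 hi)]
    rcases isEmpty_or_nonempty V with hV | hV
    -- Without vertices both sides are 0, by the convention 0/0 = 0.
    · simp [CTVGS.density, CTVGS.jointBandwidth]
    · rw [CTVGS.density_iUnion hTd hdisj, hsum]
  · rw [CTVGS.vertexBandwidth_eq]
    refine le_trans ?_ hV'c
    rw [← Set.ncard_coe_finset]
    refine Set.ncard_le_ncard ?_ V'.finite_toSet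
    rintro v ⟨t, ht⟩
    obtain ⟨r, t', -, h⟩ := Set.mem_iUnion.1 ht
    obtain ⟨rfl, -⟩ := Prod.mk.inj h
    exact r.1.2
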